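/- Let $n \ge 1$. For $t>0$ let $p_t(x) = t^{-n}p(x/t)$ with $p(x)=\gamma_n(1+|x|^2)^{-\frac{n+1}{2}}$, $\gamma_n=\Gamma(\tfrac{n+1}{2})\pi^{-\frac{n+1}{2}}$, be the Poisson kernel on $\mathbb{R}^n$. For a function $v$ on $\mathbb{R}^n$ with values in a Euclidean space put $$ |d_{1/2}v|^2(x)=\frac{\gamma_n}{2}\int_{\mathbb{R}^n}\frac{|v(x)-v(y)|^2}{|x-y|^{n+1}}\,dy\in[0,\infty], $$ taken in the space variable for functions of $(x,t)$. Let $m\ge 0$, $T\in[0,\infty]$; let $\nabla$ be the weak gradient in the space variable on $\mathbb{R}^n\times(0,T)$, with $|\nabla u|^2=\sum_j|\partial_j u|^2$; let all essential suprema be over $0<t<T$, $x\in\mathbb{R}^n$, let $B_t(x)$ be the ball of radius $t$ about $x$, $|B_t|$ its volume. For measurable $u,f:\mathbb{R}^n\times(0,T)\to\mathbb{R}^m$ set $$ \begin{aligned} |||u|||_{X_T} ={}& \operatorname{ess\,sup}|u(x,t)| + \operatorname{ess\,sup}\, t^{\frac12}|d_{1/2}u|(x,t) + \operatorname{ess\,sup}\Big(\int_0^t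 \frac{1}{|B_t|}\int_{B_t(x)}|d_{1/2}u|^2(y,s)\,dy\,ds\Big)^{\frac12}\\ &+ \operatorname{ess\,sup}\, t^{\frac32}|d_{1/2}\nabla u|(x,t) + \operatorname{ess\,sup}\Big(\int_0^t \frac{1}{|B_t|}\int_{B_t(x)}s^2|d_{1/2}\nabla u|^2(y,s)\,dy\,ds\Big)^{\frac12},\\ |||f|||_{Y_T} ={}& \operatorname{ess\,sup}\, t|f(x,t)| + \operatorname{ess\,sup}\int_0^t \frac{1}{|B_t|}\int_{B_t(x)}|f(y,s)|\,dy\,ds\\ &+ \operatorname{ess\,sup}\, t^2|\nabla f(x,t)| + \operatorname{ess\,sup}\int_0^t \frac{1}{|B_t|}\int_{B_t(x)}s|\nabla f(y,s)|\,dy\,ds, \end{aligned} $$ each being $\infty$ if the weak gradient (a locally integrable function) does not exist, and let $X_T$, $Y_T$ be the sets of measurable functions for which these are finite. **Proposition.** There is a constant $c>0$ depending only on $n$ such that for all $m$, all $T\in[0,\infty]$ and all $f\in Y_T$ the following holds. The Duhamel integral $$G(f)(x,t)=\int_0^t (p_{t-s}*f(\cdot,s))(x)\,ds=\int_0^t\int_{\mathbb{R}^n}p_{t-s}(x-y)f(y,s)\,dy\,ds$$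 converges absolutely for all $x\in\mathbb{R}^n$ and $0<t<T$, $G(f)\in X_T$, and $$|||G(f)|||_{X_T}\le c\,|||f|||_{Y_T}.$$ -/

import Mathlib

open MeasureTheory Set
open scoped ENNReal NNReal ContDiff

noncomputable section

/-- The space `ℝⁿ` with its Euclidean norm and Lebesgue measure. -/
abbrev Rn (n : ℕ) : Type := EuclideanSpace ℝ (Fin n)

/-- Values of a gradient `∇u` of a map `u` into `ℝᵐ`: the `n` partial derivatives `∂ⱼu ∈ ℝᵐ`, with
the Euclidean (Frobenius) norm `|∇u|² = ∑ⱼ |∂ⱼu|²`. -/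
abbrev GradVal (n m : ℕ) : Type := PiLp 2 (fun _ : Fin n => Rn m)

/-- The space-time domain `ℝⁿ × (0,T)`, for `T ∈ [0,∞]`. Its points are written `(x, t)`. -/
def slab (n : ℕ) (T : ℝ≥0∞) : Set (Rn n × ℝ) :=
  {z | 0 < z.2 ∧ ENNReal.ofReal z.2 < T}

/-- The essential supremum over `x ∈ ℝⁿ`, `0 < t < T` (it is `0` if `T = 0`). -/
def slabSup {n : ℕ} (T : ℝ≥0∞) (g : Rn n → ℝ → ℝ≥0∞) : ℝ≥0∞ :=
  essSup (fun z : Rn n × ℝ => g z.1 z.2) (volume.restrict (slab n T))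

/-- `∫₀ᵗ ⨍_{B_t(x)} g(y,s) dy ds`. -/
def boxMean {n : ℕ} (g : Rn n → ℝ → ℝ≥0∞) (x : Rn n) (t : ℝ) : ℝ≥0∞ :=
  ∫⁻ s in Ioo 0 t, ⨍⁻ y, g y s ∂(volume.restrict (Metric.ball x t))

/-- `γₙ = Γ((n+1)/2) / π^((n+1)/2)`. -/
def gammaConst (n : ℕ) : ℝ :=
  Real.Gamma (((n : ℝ) + 1) / 2) / Real.pi ^ (((n : ℝ) + 1) / 2)

/-- The Poisson kernel `p(x) = γₙ (1 + |x|²)^(-(n+1)/2)`. -/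
def poisson {n : ℕ} (x : Rn n) : ℝ :=
  gammaConst n * (1 / (1 + ‖x‖ ^ 2) ^ (((n : ℝ) + 1) / 2))

/-- The rescaled Poisson kernel `p_t(x) = t⁻ⁿ p(x/t)`, for `t > 0`. -/
def poissonKernelAt {n : ℕ} (t : ℝ) (x : Rn n) : ℝ :=
  1 / t ^ n * poisson (t⁻¹ • x)

/-- The Poisson semigroup `(p_t * g)(x) = ∫ p_t(x - y) g(y) dy`. -/
def poissonSemigroup {n m : ℕ} (t : ℝ) (g : Rn n → Rn m) (x : Rn n) : Rn m :=
  ∫ y, poissonKernelAt t (x - y) • g y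

/-- The Duhamel term `G(f)(x,t) = ∫₀ᵗ (p_{t-s} * f(s))(x) ds`. -/
def duhamel {n m : ℕ} (f : Rn n × ℝ → Rn m) : Rn n × ℝ → Rn m :=
  fun z => ∫ s in (0 : ℝ)..z.2, poissonSemigroup (z.2 - s) (fun y => f (y, s)) z.1

/-- The fractional gradient `d_{1/2} v(x,y) = √(γₙ/2) (v(x) - v(y)) / |x - y|^{1/2}`. -/
def fracGrad {n : ℕ} {F : Type*} [NormedAddCommGroup F] [NormedSpace ℝ F]
    (v : Rn n → F) (x y : Rn n) : F :=
  (Real.sqrt (gammaConst n / 2) / Real.sqrt ‖x - y‖) • (v x - v y)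

/-- The squared off-diagonal modulus `|V|²_od(x) = ∫ |V(x,y)|² / |x - y|ⁿ dy`, in `[0,∞]`. -/
def odSq {n : ℕ} {F : Type*} [NormedAddCommGroup F]
    (V : Rn n → Rn n → F) (x : Rn n) : ℝ≥0∞ :=
  ∫⁻ y, ‖V x y‖ₑ ^ 2 / ‖x - y‖ₑ ^ n

/-- `|d_{1/2} w|²_od(x,t)`, the fractional gradient being taken in the space variable. -/
def fracSq {n : ℕ} {F : Type*} [NormedAddCommGroup F] [NormedSpace ℝ F]
    (w : Rn n × ℝ → F) (x : Rn n) (t : ℝ) : ℝ≥0∞ :=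
  odSq (fracGrad fun y => w (y, t)) x

/-- `v` is the weak (distributional) spatial gradient of `u` on `ℝⁿ × (0,T)`: both are locally
integrable there and `∫ u ∂ⱼφ = - ∫ vⱼ φ` for all `φ ∈ C_c^∞(ℝⁿ × (0,T))` and all `j`. -/
def IsWeakGrad {n m : ℕ} (T : ℝ≥0∞) (u : Rn n × ℝ → Rn m) (v : Rn n × ℝ → GradVal n m) : Prop :=
  LocallyIntegrableOn u (slab n T) ∧ LocallyIntegrableOn v (slab n T) ∧
    ∀ φ : Rn n × ℝ → ℝ, ContDiff ℝ ∞ φ → HasCompactSupport φ → tsupport φ ⊆ slab n T →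
      ∀ j : Fin n,
        ∫ z in slab n T, (fderiv ℝ φ z (EuclideanSpace.single j 1, 0)) • u z =
          -∫ z in slab n T, φ z • v z j

/-- `‖u‖_{X_T} = ess sup |u(x,t)|`. -/
def supNormX {n m : ℕ} (T : ℝ≥0∞) (u : Rn n × ℝ → Rn m) : ℝ≥0∞ :=
  slabSup T fun x t => ‖u (x, t)‖ₑ

/-- `[u]_{X_T^{(0)}}`. -/
def seminormX0 {n m : ℕ} (T : ℝ≥0∞) (u : Rn n × ℝ → Rn m) : ℝ≥0∞ :=
  slabSup T (fun x t => ENNReal.ofReal t ^ (1 / 2 : ℝ) * fracSq u x t ^ (1 / 2 : ℝ)) +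
    slabSup T (fun x t => boxMean (fun y s => fracSq u y s) x t ^ (1 / 2 : ℝ))

/-- `[u]_{X_T^{(1)}}`, as a function of the gradient `v = ∇u`. -/
def gradPartX {n m : ℕ} (T : ℝ≥0∞) (v : Rn n × ℝ → GradVal n m) : ℝ≥0∞ :=
  slabSup T (fun x t => ENNReal.ofReal t ^ (3 / 2 : ℝ) * fracSq v x t ^ (1 / 2 : ℝ)) +
    slabSup T (fun x t =>
      boxMean (fun y s => ENNReal.ofReal s ^ 2 * fracSq v y s) x t ^ (1 / 2 : ℝ))

/-- `[u]_{X_T^{(1)}}`. The weak gradient is unique up to null sets, so the infimum is the value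
at `∇u`; it is `∞` if `u` has no weak gradient. -/
def seminormX1 {n m : ℕ} (T : ℝ≥0∞) (u : Rn n × ℝ → Rn m) : ℝ≥0∞ :=
  ⨅ (v : Rn n × ℝ → GradVal n m) (_ : IsWeakGrad T u v), gradPartX T v

/-- `|||u|||_{X_T} = ‖u‖_{X_T} + [u]_{X_T}`, with `[u]_{X_T} = [u]_{X_T^{(0)}} + [u]_{X_T^{(1)}}`. -/
def normX {n m : ℕ} (T : ℝ≥0∞) (u : Rn n × ℝ → Rn m) : ℝ≥0∞ :=
  supNormX T u + (seminormX0 T u + seminormX1 T u)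

/-- `u ∈ X_T`: `u` is (Lebesgue) measurable on `ℝⁿ × (0,T)` and `|||u|||_{X_T} < ∞`. -/
def MemX {n m : ℕ} (T : ℝ≥0∞) (u : Rn n × ℝ → Rn m) : Prop :=
  AEStronglyMeasurable u (volume.restrict (slab n T)) ∧ normX T u < ⊤

/-- `‖f‖_{Y_T}`. -/
def baseNormY {n m : ℕ} (T : ℝ≥0∞) (f : Rn n × ℝ → Rn m) : ℝ≥0∞ :=
  slabSup T (fun x t => ENNReal.ofReal t * ‖f (x, t)‖ₑ) +
    slabSup T (fun x t => boxMean (fun y s => ‖f (y, s)‖ₑ) x t)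

/-- `[f]_{Y_T}`, as a function of the gradient `v = ∇f`. -/
def gradPartY {n m : ℕ} (T : ℝ≥0∞) (v : Rn n × ℝ → GradVal n m) : ℝ≥0∞ :=
  slabSup T (fun x t => ENNReal.ofReal t ^ 2 * ‖v (x, t)‖ₑ) +
    slabSup T (fun x t => boxMean (fun y s => ENNReal.ofReal s * ‖v (y, s)‖ₑ) x t)

/-- `[f]_{Y_T}`. As above, the infimum is the value at the weak gradient of `f`, and it is `∞` if
`f` has no weak gradient. -/
def seminormY {n m : ℕ} (T : ℝ≥0∞) (f : Rn n × ℝ → Rn m) : ℝ≥0∞ :=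
  ⨅ (v : Rn n × ℝ → GradVal n m) (_ : IsWeakGrad T f v), gradPartY T v

/-- `|||f|||_{Y_T} = ‖f‖_{Y_T} + [f]_{Y_T}`. -/
def normY {n m : ℕ} (T : ℝ≥0∞) (f : Rn n × ℝ → Rn m) : ℝ≥0∞ :=
  baseNormY T f + seminormY T f

/-- `f ∈ Y_T`: `f` is (Lebesgue) measurable on `ℝⁿ × (0,T)` and `|||f|||_{Y_T} < ∞`. -/
def MemY {n m : ℕ} (T : ℝ≥0∞) (f : Rn n × ℝ → Rn m) : Prop :=
  AEStronglyMeasurable f (volume.restrict (slab n T)) ∧ normY T f < ⊤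

end

/-!
The Duhamel term `u = G(f)` of a function `f` in `Y_T` is estimated in `X_T` by kernel bounds and an
energy inequality for the Poisson semigroup.

After a change on a null set, `f` and its weak gradient obey the bounds of `IsSource` with
`K` comparable to the norm of `f`: `|f| ≤ K / t` and `|∇f| ≤ K / t²` at every point, and the Carleson
bounds, in which averages over boxes are replaced by averages against Poisson kernels
(`exists_isSource`). Such averages go well with the semigroup law, which is obtained from the Fourier
transform of the Poisson kernel, that is, from subordination to Gaussians. The term `u` is written as
a potential `dPot f` over all of space-time, the kernel being `0` at nonpositive times.

*Pointwise bounds.* Sources before time `t / 2` contribute to `u(t)` at most a Carleson average, the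
later ones at most the integral of `K / s`; this bounds `u` (`IsSource.eDPot_le`). Restarting
the evolution at time `a` gives `u(t) = p_{t-a} * u(a) + ∫ₐᵗ p_{t-s} * f(s) ds`
(`dPot_eq_pconv_add`). The source being bounded after time `a > 0`, the same formula holds for `∇u`
and `∇f` (`IsSource.potGrad_eq_pconv_add`); that the potential of the weak gradient is the classical
gradient of the potential is seen from increments (`IsSource.ae_increment`,
`IsSource.hasFDerivAt_dPot_cut`). With `a = t / 2` these formulas give Hölder bounds of exponent `3/4`
at scale `t` for `u` and `t ∇u`, and any exponent above `1/2` suffices to bound `t |d_{1/2} u|²` and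
`t³ |d_{1/2} ∇u|²` (`odSq_fracGrad_le_of_holder`).

*Carleson bound for `|d_{1/2} u|²`.* The generator of the semigroup is `-(-Δ)^{1/2}`, and
`∫ |d_{1/2} u|²` is the dissipation of `∫ |u|² / 2`. Testing the equation with `u` bounds the total
dissipation by `sup |u| ∫∫ |f|` (`lintegral_odSq_fracGrad_dPot_le`); the proof discretizes time and
uses the variance identity for the probability measures `p_δ`. Over a box of size `R` this is applied
to the sources within distance `2R` of the centre, while those further away have a potential that is
Lipschitz at scale `R` (`setLIntegral_odSq_fracGrad_dPot_le`, `IsSource.boxMean_fracSq_dPot_le`).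

*Carleson bound for `t² |d_{1/2} ∇u|²`.* The gradient of `p_{t-a} * u(a)`, with
`a` between `t / 4` and `t / 2`, is a convolution with a kernel of mass of order `1 / t`, so that this
part reduces to the previous bound at time `a`. The other part is the potential of `∇f` after time
`a`, at times comparable to `a`, and the localized energy inequality applies to it, with `sup` of order
`K / a`. Averaging over the free parameter `a` (`lintegral_le_of_forall_start`) turns the mass of
`|∇f|` into that of `s |∇f|`, which is what the norm of `Y_T` controls
(`IsSource.boxMean_fracSq_potGrad_le`).

The bounds are collected in `IsSource.normX_le`.
-/

noncomputable section

variable {n : ℕ}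

/-! ### The Poisson kernel as a mixture of Gaussians -/

/-- The substitution `y = τ v - c / v` maps `(0,∞)` onto `ℝ`; symmetrising under `v ↦ c / (τ v)`
turns the Gaussian integral into this one. -/
lemma integral_exp_neg_sq_sub_div {τ c : ℝ} (hτ : 0 < τ) (hc : 0 < c) :
    IntegrableOn (fun v : ℝ => τ * Real.exp (-(τ * v - c / v) ^ 2)) (Ioi 0) ∧
    ∫ v in Ioi (0 : ℝ), τ * Real.exp (-(τ * v - c / v) ^ 2) = Real.sqrt Real.pi / 2 := by
  have hderiv : ∀ v ∈ Ioi (0 : ℝ),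
      HasDerivWithinAt (fun v : ℝ => τ * v - c / v) (τ + c / v ^ 2) (Ioi 0) v := by
    intro v hv
    have hv0 : v ≠ 0 := ne_of_gt hv
    have h1 := ((hasDerivAt_id v).const_mul τ).sub ((hasDerivAt_inv hv0).const_mul c)
    refine (h1.congr_deriv ?_).hasDerivWithinAt
    field_simp
    ring
  have hinj : InjOn (fun v : ℝ => τ * v - c / v) (Ioi 0) := by
    have : StrictMonoOn (fun v : ℝ => τ * v - c / v) (Ioi 0) := by
      intro a ha b hb hab
      have h1 : τ * a < τ * b := by gcongr
      have h2 : c / b < c / a := div_lt_div_of_pos_left hc ha hab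
      simp only
      linarith
    exact this.injOn
  have himg : (fun v : ℝ => τ * v - c / v) '' Ioi 0 = univ := by
    refine eq_univ_of_forall fun y => ?_
    have hlt : |y| < Real.sqrt (y ^ 2 + 4 * τ * c) := by
      rw [← Real.sqrt_sq_eq_abs]
      apply Real.sqrt_lt_sqrt (sq_nonneg y)
      have : 0 < 4 * τ * c := by positivity
      linarith
    have hs : Real.sqrt (y ^ 2 + 4 * τ * c) ^ 2 = y ^ 2 + 4 * τ * c :=
      Real.sq_sqrt (by positivity)
    have hpos : 0 < y + Real.sqrt (y ^ 2 + 4 * τ * c) := by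
      have := neg_abs_le y
      linarith
    refine ⟨(y + Real.sqrt (y ^ 2 + 4 * τ * c)) / (2 * τ), div_pos hpos (by positivity), ?_⟩
    simp only
    have hne := hpos.ne'
    have h1 : τ * ((y + Real.sqrt (y ^ 2 + 4 * τ * c)) / (2 * τ)) =
        (y + Real.sqrt (y ^ 2 + 4 * τ * c)) / 2 := by field_simp
    have h2 : c / ((y + Real.sqrt (y ^ 2 + 4 * τ * c)) / (2 * τ)) =
        (Real.sqrt (y ^ 2 + 4 * τ * c) - y) / 2 := by
      rw [div_div_eq_mul_div, div_eq_iff hne]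
      linear_combination (-1 / 2 : ℝ) * hs
    rw [h1, h2]
    ring
  have hint := integrableOn_image_iff_integrableOn_abs_deriv_smul measurableSet_Ioi hderiv hinj
    (fun y => Real.exp (-y ^ 2))
  have heq := integral_image_eq_integral_abs_deriv_smul measurableSet_Ioi hderiv hinj
    (fun y => Real.exp (-y ^ 2))
  rw [himg] at hint heq
  have hgauss : IntegrableOn (fun y : ℝ => Real.exp (-y ^ 2)) univ := by
    rw [integrableOn_univ]
    simpa using integrable_exp_neg_mul_sq one_pos
  have habs : ∀ v : ℝ, |τ + c / v ^ 2| = τ + c / v ^ 2 := fun v => abs_of_pos (by positivity)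
  simp only [habs, smul_eq_mul] at hint heq
  have hI := hint.1 hgauss
  have hmeas : Measurable fun v : ℝ => Real.exp (-(τ * v - c / v) ^ 2) := by fun_prop
  have hI1 : IntegrableOn (fun v : ℝ => τ * Real.exp (-(τ * v - c / v) ^ 2)) (Ioi 0) := by
    refine Integrable.mono' hI (by fun_prop) (ae_of_all _ fun v => ?_)
    rw [Real.norm_of_nonneg (by positivity)]
    gcongr
    have : 0 ≤ c / v ^ 2 := by positivity
    linarith
  have hI2 : IntegrableOn (fun v : ℝ => c / v ^ 2 * Real.exp (-(τ * v - c / v) ^ 2)) (Ioi 0) := by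
    refine Integrable.mono' hI (by fun_prop) (ae_of_all _ fun v => ?_)
    rw [Real.norm_of_nonneg (by positivity)]
    gcongr
    linarith
  refine ⟨hI1, ?_⟩
  have hderiv' : ∀ v ∈ Ioi (0 : ℝ),
      HasDerivWithinAt (fun v : ℝ => c / τ / v) (-(c / τ / v ^ 2)) (Ioi 0) v := by
    intro v hv
    have hv0 : v ≠ 0 := ne_of_gt hv
    have h1 := (hasDerivAt_inv hv0).const_mul (c / τ)
    refine (h1.congr_deriv ?_).hasDerivWithinAt
    field_simp
  have hinj' : InjOn (fun v : ℝ => c / τ / v) (Ioi 0) := by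
    intro a ha b hb hab
    have ha0 : a ≠ 0 := ne_of_gt ha
    have hb0 : b ≠ 0 := ne_of_gt hb
    simp only at hab
    field_simp at hab
    exact hab.symm
  have himg' : (fun v : ℝ => c / τ / v) '' Ioi 0 = Ioi 0 := by
    ext y
    constructor
    · rintro ⟨v, hv, rfl⟩
      have : 0 < v := hv
      exact div_pos (div_pos hc hτ) this
    · intro hy
      have hy' : 0 < y := hy
      refine ⟨c / τ / y, div_pos (div_pos hc hτ) hy', ?_⟩
      simp only
      field_simp
  have heq' := integral_image_eq_integral_abs_deriv_smul measurableSet_Ioi hderiv' hinj'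
    (fun v => τ * Real.exp (-(τ * v - c / v) ^ 2))
  rw [himg'] at heq'
  have hsym : ∫ v in Ioi (0 : ℝ), τ * Real.exp (-(τ * v - c / v) ^ 2) =
      ∫ v in Ioi (0 : ℝ), c / v ^ 2 * Real.exp (-(τ * v - c / v) ^ 2) := by
    rw [heq']
    refine setIntegral_congr_fun measurableSet_Ioi fun v hv => ?_
    have hv' : 0 < v := hv
    have h1 : |-(c / τ / v ^ 2)| = c / τ / v ^ 2 := by
      rw [abs_neg, abs_of_pos (by positivity)]
    have h2 : -(τ * (c / τ / v) - c / (c / τ / v)) ^ 2 = -(τ * v - c / v) ^ 2 := by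
      field_simp
      ring
    simp only [h1, h2, smul_eq_mul]
    field_simp
  have hsum : ∫ v in Ioi (0 : ℝ), (τ + c / v ^ 2) * Real.exp (-(τ * v - c / v) ^ 2) =
      (∫ v in Ioi (0 : ℝ), τ * Real.exp (-(τ * v - c / v) ^ 2)) +
      ∫ v in Ioi (0 : ℝ), c / v ^ 2 * Real.exp (-(τ * v - c / v) ^ 2) := by
    rw [← integral_add hI1 hI2]
    simp only [add_mul]
  have hg : ∫ y : ℝ, Real.exp (-y ^ 2) = Real.sqrt Real.pi := by
    simpa using integral_gaussian 1
  rw [setIntegral_univ, hg] at heq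
  linarith

/-- The Poisson kernel of the upper half space, `γₙ τ / (τ² + |x|²)^((n+1)/2)`, extended by `0` to
`τ ≤ 0`. The extension lets Duhamel integrals be written as integrals over all of space-time. -/
def pker {n : ℕ} (τ : ℝ) (x : Rn n) : ℝ :=
  if 0 < τ then gammaConst n * τ / (τ ^ 2 + ‖x‖ ^ 2) ^ (((n : ℝ) + 1) / 2) else 0


lemma gammaConst_pos (n : ℕ) : 0 < gammaConst n := by
  unfold gammaConst
  have : 0 < Real.Gamma (((n : ℝ) + 1) / 2) := Real.Gamma_pos_of_pos (by positivity)
  have := Real.pi_pos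
  positivity

lemma pker_of_pos {τ : ℝ} (hτ : 0 < τ) (x : Rn n) :
    pker τ x = gammaConst n * τ / (τ ^ 2 + ‖x‖ ^ 2) ^ (((n : ℝ) + 1) / 2) := if_pos hτ

lemma pker_of_nonpos {τ : ℝ} (hτ : τ ≤ 0) (x : Rn n) : pker τ x = 0 := if_neg hτ.not_gt

lemma pker_pos {τ : ℝ} (hτ : 0 < τ) (x : Rn n) : 0 < pker τ x := by
  rw [pker_of_pos hτ]
  have := gammaConst_pos n
  positivity

lemma pker_nonneg (τ : ℝ) (x : Rn n) : 0 ≤ pker τ x := by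
  rcases lt_or_ge 0 τ with h | h
  · exact (pker_pos h x).le
  · exact (pker_of_nonpos h x).ge

lemma pker_congr {τ : ℝ} {x y : Rn n} (h : ‖x‖ = ‖y‖) : pker τ x = pker τ y := by
  simp only [pker, h]

lemma pker_sub_comm (τ : ℝ) (x y : Rn n) : pker τ (x - y) = pker τ (y - x) :=
  pker_congr (norm_sub_rev x y)

lemma poissonKernelAt_eq_pker {τ : ℝ} (hτ : 0 < τ) (x : Rn n) :
    poissonKernelAt τ x = pker τ x := by
  rw [pker_of_pos hτ, poissonKernelAt, poisson, norm_smul, norm_inv, Real.norm_of_nonneg hτ.le]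
  have h1 : 1 + (τ⁻¹ * ‖x‖) ^ 2 = (τ ^ 2 + ‖x‖ ^ 2) / τ ^ 2 := by field_simp
  have h2 : (τ ^ 2) ^ (((n : ℝ) + 1) / 2) = τ ^ n * τ := by
    rw [← Real.rpow_natCast τ 2, ← Real.rpow_mul hτ.le, ← pow_succ, ← Real.rpow_natCast]
    congr 1
    push_cast
    ring
  rw [h1, Real.div_rpow (by positivity) (by positivity), h2]
  field_simp

@[fun_prop]
lemma measurable_pker : Measurable fun z : ℝ × Rn n => pker z.1 z.2 := by
  unfold pker
  refine Measurable.ite (measurableSet_lt measurable_const measurable_fst) ?_ measurable_const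
  fun_prop

@[fun_prop]
lemma Measurable.pker {α : Type*} [MeasurableSpace α] {f : α → ℝ} {g : α → Rn n}
    (hf : Measurable f) (hg : Measurable g) : Measurable fun a => pker (f a) (g a) :=
  measurable_pker.comp (hf.prodMk hg)

lemma continuous_pker (τ : ℝ) : Continuous (pker τ : Rn n → ℝ) := by
  rcases lt_or_ge 0 τ with h | h
  · have : (pker τ : Rn n → ℝ) =
        fun x => gammaConst n * τ / (τ ^ 2 + ‖x‖ ^ 2) ^ (((n : ℝ) + 1) / 2) := by
      ext x
      exact pker_of_pos h x
    rw [this]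
    have h1 : ∀ x : Rn n, (τ ^ 2 + ‖x‖ ^ 2) ^ (((n : ℝ) + 1) / 2) ≠ 0 := fun x => by positivity
    refine continuous_const.div ?_ h1
    refine Continuous.rpow_const (by fun_prop) fun x => Or.inl (by positivity)
  · have : (pker τ : Rn n → ℝ) = fun x => 0 := by
      ext x
      exact pker_of_nonpos h x
    rw [this]
    exact continuous_const

/-- The Poisson kernel as a mixture of Gaussians. -/
lemma pker_eq_integral {τ : ℝ} (hτ : 0 < τ) (x : Rn n) :
    pker τ x = ∫ v in Ioi (0 : ℝ), 2 * Real.pi ^ (-(((n : ℝ) + 1) / 2)) * τ *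
      (v ^ n * Real.exp (-(τ ^ 2 + ‖x‖ ^ 2) * v ^ 2)) := by
  have hn : (-1 : ℝ) < n := by
    have : (0 : ℝ) ≤ n := by positivity
    linarith
  have hA : 0 < τ ^ 2 + ‖x‖ ^ 2 := by positivity
  have h := integral_rpow_mul_exp_neg_mul_rpow (p := 2) (q := n) two_pos hn hA
  rw [integral_const_mul]
  have h' : ∫ v in Ioi (0 : ℝ), v ^ n * Real.exp (-(τ ^ 2 + ‖x‖ ^ 2) * v ^ 2) =
      (τ ^ 2 + ‖x‖ ^ 2) ^ (-((n : ℝ) + 1) / 2) * (1 / 2) * Real.Gamma (((n : ℝ) + 1) / 2) := by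
    rw [← h]
    refine setIntegral_congr_fun measurableSet_Ioi fun v _ => ?_
    simp
  rw [h', pker_of_pos hτ, gammaConst, Real.rpow_neg Real.pi_pos.le, neg_div,
    Real.rpow_neg hA.le]
  field_simp

/-! ### Mass and semigroup law of the Poisson kernel -/

lemma integral_exp_neg_mul_sq_norm_mul_cexp {v : ℝ} (hv : 0 < v) (ξ : Rn n) :
    Integrable (fun x : Rn n => (Real.exp (-‖x‖ ^ 2 * v ^ 2) : ℂ) *
      Complex.exp (inner ℝ x ξ * Complex.I)) ∧
    ∫ x : Rn n, (Real.exp (-‖x‖ ^ 2 * v ^ 2) : ℂ) * Complex.exp (inner ℝ x ξ * Complex.I) =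
      (Real.pi ^ ((n : ℝ) / 2) / v ^ n * Real.exp (-(‖ξ‖ / 2 / v) ^ 2) : ℝ) := by
  have hb : 0 < ((v ^ 2 : ℝ) : ℂ).re := by
    rw [Complex.ofReal_re]
    positivity
  have hfun : (fun x : Rn n => (Real.exp (-‖x‖ ^ 2 * v ^ 2) : ℂ) *
      Complex.exp (inner ℝ x ξ * Complex.I)) = fun x : Rn n =>
        Complex.exp (-((v ^ 2 : ℝ) : ℂ) * ‖x‖ ^ 2 + Complex.I * (inner ℝ ξ x : ℝ)) := by
    ext x
    rw [Complex.ofReal_exp, ← Complex.exp_add, real_inner_comm x ξ]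
    congr 1
    push_cast
    ring
  rw [hfun]
  refine ⟨GaussianFourier.integrable_cexp_neg_mul_sq_norm_add hb Complex.I ξ, ?_⟩
  rw [GaussianFourier.integral_cexp_neg_mul_sq_norm_add hb Complex.I ξ]
  have h1 : ((Real.pi : ℂ) / ((v ^ 2 : ℝ) : ℂ)) ^ ((Module.finrank ℝ (Rn n) : ℂ) / 2) =
      ((Real.pi ^ ((n : ℝ) / 2) / v ^ n : ℝ) : ℂ) := by
    have : ((Real.pi : ℂ) / ((v ^ 2 : ℝ) : ℂ)) = ((Real.pi / v ^ 2 : ℝ) : ℂ) := by push_cast; rfl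
    rw [this, finrank_euclideanSpace, Fintype.card_fin]
    have h2 : ((n : ℂ) / 2) = (((n : ℝ) / 2 : ℝ) : ℂ) := by push_cast; rfl
    rw [h2, ← Complex.ofReal_cpow (by positivity)]
    congr 1
    rw [Real.div_rpow Real.pi_pos.le (by positivity), ← Real.rpow_natCast v 2,
      ← Real.rpow_mul hv.le, ← Real.rpow_natCast v n]
    congr 2
    push_cast
    ring
  rw [h1, Complex.ofReal_mul, Complex.ofReal_exp]
  congr 2
  push_cast
  rw [Complex.I_sq]
  have : (v : ℂ) ≠ 0 := by exact_mod_cast hv.ne'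
  field_simp
  norm_num

lemma integral_exp_neg_sq_add {τ : ℝ} (hτ : 0 < τ) {ρ : ℝ} (hρ : 0 ≤ ρ) :
    ∫ v in Ioi (0 : ℝ), τ * (Real.exp (-τ ^ 2 * v ^ 2) * Real.exp (-(ρ / 2 / v) ^ 2)) =
      Real.sqrt Real.pi / 2 * Real.exp (-(τ * ρ)) := by
  rcases hρ.eq_or_lt with rfl | hρ
  · have h := integral_gaussian_Ioi (τ ^ 2)
    have h0 : ∀ v : ℝ, τ * (Real.exp (-τ ^ 2 * v ^ 2) * Real.exp (-(0 / 2 / v) ^ 2)) =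
        τ * Real.exp (-τ ^ 2 * v ^ 2) := fun v => by simp
    simp only [h0, mul_zero, neg_zero, Real.exp_zero, mul_one]
    rw [integral_const_mul, h, Real.sqrt_div Real.pi_pos.le, Real.sqrt_sq hτ.le]
    field_simp
  · rw [← (integral_exp_neg_sq_sub_div hτ (half_pos hρ)).2, ← integral_mul_const]
    refine setIntegral_congr_fun measurableSet_Ioi fun v hv => ?_
    have hv' : v ≠ 0 := ne_of_gt hv
    rw [mul_assoc, ← Real.exp_add, ← Real.exp_add]
    congr 2
    field_simp
    ring

lemma integrable_pker_integrand {τ : ℝ} (hτ : 0 < τ) :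
    Integrable (fun z : Rn n × ℝ => z.2 ^ n * Real.exp (-(τ ^ 2 + ‖z.1‖ ^ 2) * z.2 ^ 2))
      ((volume : Measure (Rn n)).prod (volume.restrict (Ioi 0))) := by
  have hsplit : ∀ (x : Rn n) (v : ℝ), Real.exp (-(τ ^ 2 + ‖x‖ ^ 2) * v ^ 2) =
      Real.exp (-τ ^ 2 * v ^ 2) * Real.exp (-‖x‖ ^ 2 * v ^ 2) := by
    intro x v
    rw [← Real.exp_add]
    congr 1
    ring
  have hG : ∀ v : ℝ, 0 < v → Integrable (fun x : Rn n => Real.exp (-‖x‖ ^ 2 * v ^ 2)) ∧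
      ∫ x : Rn n, Real.exp (-‖x‖ ^ 2 * v ^ 2) = Real.pi ^ ((n : ℝ) / 2) / v ^ n := by
    intro v hv
    obtain ⟨h1, h2⟩ := integral_exp_neg_mul_sq_norm_mul_cexp hv (0 : Rn n)
    simp only [inner_zero_right, Complex.ofReal_zero, zero_mul, Complex.exp_zero, mul_one,
      norm_zero, zero_div, ne_eq, OfNat.ofNat_ne_zero, not_false_eq_true, zero_pow, neg_zero,
      Real.exp_zero] at h1 h2
    rw [integral_complex_ofReal] at h2
    exact ⟨by simpa only [RCLike.re_to_complex, Complex.ofReal_re] using h1.re, by exact_mod_cast h2⟩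
  rw [integrable_prod_iff' (by fun_prop)]
  constructor
  · refine (ae_restrict_iff' measurableSet_Ioi).2 (ae_of_all _ fun v hv => ?_)
    simp only [hsplit]
    exact ((hG v hv).1.const_mul _).const_mul _
  · have : ∀ v ∈ Ioi (0 : ℝ), (∫ x : Rn n, ‖v ^ n * Real.exp (-(τ ^ 2 + ‖x‖ ^ 2) * v ^ 2)‖) =
        Real.pi ^ ((n : ℝ) / 2) * Real.exp (-τ ^ 2 * v ^ 2) := by
      intro v hv
      have hv' : 0 < v := hv
      have : ∀ x : Rn n, ‖v ^ n * Real.exp (-(τ ^ 2 + ‖x‖ ^ 2) * v ^ 2)‖ =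
          v ^ n * Real.exp (-τ ^ 2 * v ^ 2) * Real.exp (-‖x‖ ^ 2 * v ^ 2) := by
        intro x
        rw [Real.norm_of_nonneg (by positivity), hsplit, mul_assoc]
      simp only [this]
      rw [integral_const_mul, (hG v hv').2]
      field_simp
    refine (integrableOn_congr_fun this measurableSet_Ioi).2 ?_
    exact ((integrable_exp_neg_mul_sq (by positivity : 0 < τ ^ 2)).const_mul _).integrableOn

/-- The Fourier transform of the Poisson kernel. -/
lemma integral_pker_mul_cexp {τ : ℝ} (hτ : 0 < τ) (ξ : Rn n) :
    ∫ x : Rn n, (pker τ x : ℂ) * Complex.exp (inner ℝ x ξ * Complex.I) =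
      (Real.exp (-(τ * ‖ξ‖)) : ℝ) := by
  set c : ℝ := 2 * Real.pi ^ (-(((n : ℝ) + 1) / 2)) * τ with hc
  have hint := integrable_pker_integrand (n := n) hτ
  have hint' : Integrable (fun z : Rn n × ℝ =>
      ((c * (z.2 ^ n * Real.exp (-(τ ^ 2 + ‖z.1‖ ^ 2) * z.2 ^ 2)) : ℝ) : ℂ) *
        Complex.exp (inner ℝ z.1 ξ * Complex.I))
      ((volume : Measure (Rn n)).prod (volume.restrict (Ioi 0))) := by
    refine ((hint.const_mul c).norm).mono' ?_ (ae_of_all _ fun z => ?_)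
    · apply Measurable.aestronglyMeasurable
      apply Measurable.mul
      · fun_prop
      · exact (Complex.continuous_exp.comp (by fun_prop)).measurable
    · rw [norm_mul, Complex.norm_exp_ofReal_mul_I, mul_one, Complex.norm_real]
  have h1 : ∀ x : Rn n, (pker τ x : ℂ) * Complex.exp (inner ℝ x ξ * Complex.I) =
      ∫ v in Ioi (0 : ℝ), ((c * (v ^ n * Real.exp (-(τ ^ 2 + ‖x‖ ^ 2) * v ^ 2)) : ℝ) : ℂ) *
        Complex.exp (inner ℝ x ξ * Complex.I) := by
    intro x
    rw [integral_mul_const, integral_complex_ofReal, pker_eq_integral hτ]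
  simp only [h1]
  rw [integral_integral_swap hint']
  have h2 : ∀ v ∈ Ioi (0 : ℝ), (∫ x : Rn n,
      ((c * (v ^ n * Real.exp (-(τ ^ 2 + ‖x‖ ^ 2) * v ^ 2)) : ℝ) : ℂ) *
        Complex.exp (inner ℝ x ξ * Complex.I)) =
      ((2 / Real.sqrt Real.pi * (τ * (Real.exp (-τ ^ 2 * v ^ 2) *
        Real.exp (-(‖ξ‖ / 2 / v) ^ 2))) : ℝ) : ℂ) := by
    intro v hv
    have hv' : 0 < v := hv
    have : ∀ x : Rn n, ((c * (v ^ n * Real.exp (-(τ ^ 2 + ‖x‖ ^ 2) * v ^ 2)) : ℝ) : ℂ) *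
        Complex.exp (inner ℝ x ξ * Complex.I) =
        ((c * v ^ n * Real.exp (-τ ^ 2 * v ^ 2) : ℝ) : ℂ) *
          ((Real.exp (-‖x‖ ^ 2 * v ^ 2) : ℂ) * Complex.exp (inner ℝ x ξ * Complex.I)) := by
      intro x
      have : Real.exp (-(τ ^ 2 + ‖x‖ ^ 2) * v ^ 2) =
          Real.exp (-τ ^ 2 * v ^ 2) * Real.exp (-‖x‖ ^ 2 * v ^ 2) := by
        rw [← Real.exp_add]
        congr 1
        ring
      rw [this]
      push_cast
      ring
    simp only [this]
    rw [integral_const_mul, (integral_exp_neg_mul_sq_norm_mul_cexp hv' ξ).2, ← Complex.ofReal_mul]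
    congr 1
    have hpi : Real.pi ^ (-(((n : ℝ) + 1) / 2)) * Real.pi ^ ((n : ℝ) / 2) = 1 / Real.sqrt Real.pi := by
      rw [← Real.rpow_add Real.pi_pos, Real.sqrt_eq_rpow, one_div, ← Real.rpow_neg Real.pi_pos.le]
      congr 1
      ring
    have hvn : v ^ n ≠ 0 := by positivity
    calc c * v ^ n * Real.exp (-τ ^ 2 * v ^ 2) * (Real.pi ^ ((n : ℝ) / 2) / v ^ n *
          Real.exp (-(‖ξ‖ / 2 / v) ^ 2))
        = 2 * (Real.pi ^ (-(((n : ℝ) + 1) / 2)) * Real.pi ^ ((n : ℝ) / 2)) * (τ *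
          (Real.exp (-τ ^ 2 * v ^ 2) * Real.exp (-(‖ξ‖ / 2 / v) ^ 2))) := by
            rw [hc]
            field_simp
      _ = _ := by rw [hpi]; ring
  rw [setIntegral_congr_fun measurableSet_Ioi h2, integral_complex_ofReal, integral_const_mul,
    integral_exp_neg_sq_add hτ (norm_nonneg ξ)]
  congr 1
  have : Real.sqrt Real.pi ≠ 0 := (Real.sqrt_pos.2 Real.pi_pos).ne'
  field_simp

lemma integral_pker {τ : ℝ} (hτ : 0 < τ) : ∫ x : Rn n, pker τ x = 1 := by
  have h := integral_pker_mul_cexp (n := n) hτ 0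
  simp only [inner_zero_right, Complex.ofReal_zero, zero_mul, Complex.exp_zero, mul_one,
      norm_zero, mul_zero, neg_zero, Real.exp_zero] at h
  rw [integral_complex_ofReal] at h
  exact_mod_cast h

lemma integrable_pker (τ : ℝ) : Integrable (pker τ : Rn n → ℝ) := by
  rcases lt_or_ge 0 τ with h | h
  · refine Integrable.of_integral_ne_zero ?_
    rw [integral_pker h]
    exact one_ne_zero
  · have : (pker τ : Rn n → ℝ) = fun x => 0 := by
      ext x
      exact pker_of_nonpos h x
    rw [this]
    exact integrable_zero _ _ _

/-- The Poisson kernel as an extended nonnegative function. -/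
def epker (τ : ℝ) (x : Rn n) : ℝ≥0∞ := ENNReal.ofReal (pker τ x)

lemma enorm_pker (τ : ℝ) (x : Rn n) : ‖pker τ x‖ₑ = epker τ x := by
  rw [epker, Real.enorm_eq_ofReal (pker_nonneg τ x)]

lemma epker_sub_comm (τ : ℝ) (x y : Rn n) : epker τ (x - y) = epker τ (y - x) := by
  rw [epker, epker, pker_sub_comm]

lemma epker_of_nonpos {τ : ℝ} (hτ : τ ≤ 0) (x : Rn n) : epker τ x = 0 := by
  rw [epker, pker_of_nonpos hτ, ENNReal.ofReal_zero]

lemma epker_lt_top (τ : ℝ) (x : Rn n) : epker τ x < ⊤ := ENNReal.ofReal_lt_top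

@[fun_prop]
lemma Measurable.epker {α : Type*} [MeasurableSpace α] {f : α → ℝ} {g : α → Rn n}
    (hf : Measurable f) (hg : Measurable g) : Measurable fun a => epker (f a) (g a) :=
  (hf.pker hg).ennreal_ofReal

lemma lintegral_epker {τ : ℝ} (hτ : 0 < τ) : ∫⁻ x : Rn n, epker τ x = 1 := by
  unfold epker
  rw [← ofReal_integral_eq_lintegral_ofReal (integrable_pker τ)
    (ae_of_all _ fun x => pker_nonneg τ x), integral_pker hτ, ENNReal.ofReal_one]

lemma lintegral_epker_sub {τ : ℝ} (hτ : 0 < τ) (x : Rn n) : ∫⁻ y : Rn n, epker τ (x - y) = 1 := by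
  rw [lintegral_sub_left_eq_self (fun y => epker τ y) x, lintegral_epker hτ]

lemma charFun_withDensity_epker {τ : ℝ} (hτ : 0 < τ) (ξ : Rn n) :
    charFun (volume.withDensity (epker τ : Rn n → ℝ≥0∞)) ξ = (Real.exp (-(τ * ‖ξ‖)) : ℝ) := by
  rw [charFun_apply, integral_withDensity_eq_integral_toReal_smul (by fun_prop)
    (ae_of_all _ fun x => epker_lt_top τ x), ← integral_pker_mul_cexp hτ]
  refine integral_congr_ae (ae_of_all _ fun x => ?_)
  simp only [epker, ENNReal.toReal_ofReal (pker_nonneg τ x)]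
  rfl

/-- The semigroup law `p_τ * p_σ = p_{τ+σ}`, from the multiplicativity of `e^{-τ|ξ|}`. -/
lemma lintegral_epker_mul_epker {τ σ : ℝ} (hτ : 0 < τ) (hσ : 0 < σ) :
    (fun x : Rn n => ∫⁻ y, epker τ (x - y) * epker σ y) =ᵐ[volume] epker (τ + σ) := by
  have hfin : ∀ {ρ : ℝ}, 0 < ρ →
      IsFiniteMeasure (volume.withDensity (epker ρ : Rn n → ℝ≥0∞)) := by
    intro ρ hρ
    refine isFiniteMeasure_withDensity ?_
    rw [lintegral_epker hρ]
    exact ENNReal.one_ne_top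
  have := hfin hτ
  have := hfin hσ
  have := hfin (add_pos hτ hσ)
  have h : (volume.withDensity (epker σ : Rn n → ℝ≥0∞)).conv (volume.withDensity (epker τ)) =
      volume.withDensity (epker (τ + σ)) := by
    refine Measure.ext_of_charFun (funext fun ξ => ?_)
    rw [charFun_conv, charFun_withDensity_epker hτ, charFun_withDensity_epker hσ,
      charFun_withDensity_epker (add_pos hτ hσ), ← Complex.ofReal_mul, ← Real.exp_add]
    congr 2
    ring
  rw [conv_withDensity_eq_lconvolution (by fun_prop) (by fun_prop)] at h
  have hm : Measurable fun x : Rn n => ∫⁻ y, epker τ (x - y) * epker σ y := by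
    apply Measurable.lintegral_prod_right
    fun_prop
  have hcomm : lconvolution (epker σ : Rn n → ℝ≥0∞) (epker τ) volume =
      fun x : Rn n => ∫⁻ y, epker τ (x - y) * epker σ y := by
    ext x
    simp only [lconvolution_def]
    refine lintegral_congr fun y => ?_
    rw [neg_add_eq_sub, mul_comm]
  rw [hcomm] at h
  refine (withDensity_eq_iff_of_sigmaFinite hm.aemeasurable (by fun_prop)).1 h

/-! ### Comparison and regularity of Poisson kernels -/

/-- A Poisson kernel at `x` is controlled by one at `y` as soon as `τ² + |y|²` is controlled by
`σ² + |x|²`, with the ratio of the times as a factor. -/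
lemma pker_le_of_sq_le {σ τ L : ℝ} (hσ : 0 < σ) (hτ : 0 < τ) (hL : 0 ≤ L) {x y : Rn n}
    (h : τ ^ 2 + ‖y‖ ^ 2 ≤ L * (σ ^ 2 + ‖x‖ ^ 2)) :
    pker σ x ≤ σ / τ * L ^ (((n : ℝ) + 1) / 2) * pker τ y := by
  have hs : 0 ≤ ((n : ℝ) + 1) / 2 := by positivity
  have h1 : (τ ^ 2 + ‖y‖ ^ 2) ^ (((n : ℝ) + 1) / 2) ≤
      L ^ (((n : ℝ) + 1) / 2) * (σ ^ 2 + ‖x‖ ^ 2) ^ (((n : ℝ) + 1) / 2) := by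
    rw [← Real.mul_rpow hL (by positivity)]
    exact Real.rpow_le_rpow (by positivity) h hs
  have hA : 0 < (τ ^ 2 + ‖y‖ ^ 2) ^ (((n : ℝ) + 1) / 2) := by positivity
  have hB : 0 < (σ ^ 2 + ‖x‖ ^ 2) ^ (((n : ℝ) + 1) / 2) := by positivity
  have hγ := gammaConst_pos n
  rw [pker_of_pos hσ, pker_of_pos hτ, div_le_iff₀ hB]
  have : σ / τ * L ^ (((n : ℝ) + 1) / 2) * (gammaConst n * τ / (τ ^ 2 + ‖y‖ ^ 2) ^
      (((n : ℝ) + 1) / 2)) * (σ ^ 2 + ‖x‖ ^ 2) ^ (((n : ℝ) + 1) / 2) = gammaConst n * σ *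
      ((L ^ (((n : ℝ) + 1) / 2) * (σ ^ 2 + ‖x‖ ^ 2) ^ (((n : ℝ) + 1) / 2)) /
        (τ ^ 2 + ‖y‖ ^ 2) ^ (((n : ℝ) + 1) / 2)) := by
    field_simp
  rw [this]
  have h2 : 1 ≤ (L ^ (((n : ℝ) + 1) / 2) * (σ ^ 2 + ‖x‖ ^ 2) ^ (((n : ℝ) + 1) / 2)) /
        (τ ^ 2 + ‖y‖ ^ 2) ^ (((n : ℝ) + 1) / 2) := (one_le_div hA).2 h1
  exact le_mul_of_one_le_right (by positivity) h2

/-- The form in which the comparison of Poisson kernels is mostly used. -/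
lemma pker_le_of_sq_le' {σ τ L : ℝ} (hσ : 0 < σ) (hστ : σ ≤ τ) (hL : 0 ≤ L) {x y : Rn n}
    (h : τ ^ 2 + ‖y‖ ^ 2 ≤ L * (σ ^ 2 + ‖x‖ ^ 2)) :
    pker σ x ≤ L ^ (((n : ℝ) + 1) / 2) * pker τ y := by
  have hτ := hσ.trans_le hστ
  refine (pker_le_of_sq_le hσ hτ hL h).trans ?_
  have h1 : σ / τ ≤ 1 := (div_le_one hτ).2 hστ
  have := pker_nonneg τ y
  have h2 : 0 ≤ L ^ (((n : ℝ) + 1) / 2) := by positivity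
  calc σ / τ * L ^ (((n : ℝ) + 1) / 2) * pker τ y
      ≤ 1 * L ^ (((n : ℝ) + 1) / 2) * pker τ y := by gcongr
    _ = _ := by rw [one_mul]

lemma pker_le_of_dist_le {τ : ℝ} {x y : Rn n} (h : ‖x - y‖ ≤ τ) :
    pker τ x ≤ 3 ^ (((n : ℝ) + 1) / 2) * pker τ y := by
  rcases lt_or_ge 0 τ with hτ | hτ
  · refine pker_le_of_sq_le' hτ le_rfl (by norm_num) ?_
    have h1 : ‖y‖ ≤ ‖x‖ + τ := by
      have := norm_sub_norm_le y x
      rw [norm_sub_rev] at this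
      linarith
    nlinarith [norm_nonneg y, norm_nonneg x, sq_nonneg (‖x‖ - τ)]
  · rw [pker_of_nonpos hτ, pker_of_nonpos hτ, mul_zero]

/-- The space derivative of the Poisson kernel. -/
def kgrad (τ : ℝ) (x : Rn n) : Rn n →L[ℝ] ℝ :=
  (-(((n : ℝ) + 1) * pker τ x / (τ ^ 2 + ‖x‖ ^ 2))) • innerSL ℝ x

lemma hasFDerivAt_pker (τ : ℝ) (x : Rn n) : HasFDerivAt (pker τ) (kgrad τ x) x := by
  rcases lt_or_ge 0 τ with hτ | hτ
  · have hA : 0 < τ ^ 2 + ‖x‖ ^ 2 := by positivity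
    have h1 : HasFDerivAt (fun y : Rn n => τ ^ 2 + ‖y‖ ^ 2) (2 • innerSL ℝ x) x :=
      (hasStrictFDerivAt_norm_sq x).hasFDerivAt.const_add _
    have h2 := (h1.rpow_const (p := -(((n : ℝ) + 1) / 2)) (Or.inl hA.ne')).const_mul
      (gammaConst n * τ)
    have hfun : (pker τ : Rn n → ℝ) =
        fun y => gammaConst n * τ * (τ ^ 2 + ‖y‖ ^ 2) ^ (-(((n : ℝ) + 1) / 2)) := by
      ext y
      rw [pker_of_pos hτ, Real.rpow_neg (by positivity)]
      rfl
    rw [hfun]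
    refine h2.congr_fderiv ?_
    rw [kgrad, pker_of_pos hτ, Real.rpow_sub_one hA.ne', Real.rpow_neg hA.le, smul_smul,
      ← Nat.cast_smul_eq_nsmul ℝ, smul_smul]
    congr 1
    push_cast
    field_simp
  · have : (pker τ : Rn n → ℝ) = fun x => 0 := by
      ext x
      exact pker_of_nonpos hτ x
    have h0 : kgrad τ x = 0 := by
      rw [kgrad, pker_of_nonpos hτ]
      simp
    rw [this, h0]
    exact hasFDerivAt_const 0 x

lemma norm_kgrad (τ : ℝ) (x : Rn n) :
    ‖kgrad τ x‖ = ((n : ℝ) + 1) * pker τ x / (τ ^ 2 + ‖x‖ ^ 2) * ‖x‖ := by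
  have := pker_nonneg τ x
  rw [kgrad, norm_smul, innerSL_apply_norm, norm_neg, Real.norm_of_nonneg (by positivity)]

lemma norm_kgrad_le {τ : ℝ} (hτ : 0 < τ) (x : Rn n) :
    ‖kgrad τ x‖ ≤ ((n : ℝ) + 1) / τ * pker τ x := by
  rw [norm_kgrad, div_mul_eq_mul_div, div_mul_eq_mul_div, div_le_div_iff₀ (by positivity) hτ]
  have h1 : ‖x‖ * τ ≤ τ ^ 2 + ‖x‖ ^ 2 := by nlinarith [sq_nonneg (‖x‖ - τ), sq_nonneg (‖x‖ + τ)]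
  have := pker_nonneg τ x
  calc ((n : ℝ) + 1) * pker τ x * ‖x‖ * τ = ((n : ℝ) + 1) * pker τ x * (‖x‖ * τ) := by ring
    _ ≤ _ := by gcongr

lemma norm_kgrad_le_div_norm (τ : ℝ) {x : Rn n} (hx : x ≠ 0) :
    ‖kgrad τ x‖ ≤ ((n : ℝ) + 1) / ‖x‖ * pker τ x := by
  have hx' : 0 < ‖x‖ := norm_pos_iff.2 hx
  rw [norm_kgrad, div_mul_eq_mul_div, div_mul_eq_mul_div, div_le_div_iff₀ (by positivity) hx']
  have h1 : ‖x‖ * ‖x‖ ≤ τ ^ 2 + ‖x‖ ^ 2 := by nlinarith [sq_nonneg τ]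
  have := pker_nonneg τ x
  calc ((n : ℝ) + 1) * pker τ x * ‖x‖ * ‖x‖ = ((n : ℝ) + 1) * pker τ x * (‖x‖ * ‖x‖) := by ring
    _ ≤ _ := by gcongr

lemma continuous_kgrad {τ : ℝ} (hτ : 0 < τ) : Continuous (kgrad τ : Rn n → _) := by
  have h1 : ∀ x : Rn n, τ ^ 2 + ‖x‖ ^ 2 ≠ 0 := fun x => by positivity
  have h2 : Continuous fun x : Rn n => -(((n : ℝ) + 1) * pker τ x / (τ ^ 2 + ‖x‖ ^ 2)) :=
    ((continuous_const.mul (continuous_pker τ)).div (by fun_prop) h1).neg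
  exact h2.smul (innerSL ℝ (E := Rn n)).continuous

/-- Lipschitz bound for the Poisson kernel relative to its own size. -/
lemma abs_pker_sub_pker_le {τ : ℝ} (hτ : 0 < τ) {x y : Rn n} (h : ‖x - y‖ ≤ τ) :
    |pker τ x - pker τ y| ≤
      ((n : ℝ) + 1) * 3 ^ (((n : ℝ) + 1) / 2) * (‖x - y‖ / τ) * pker τ x := by
  have hconv : Convex ℝ (Metric.closedBall x ‖x - y‖) := convex_closedBall _ _
  have hb : ∀ z ∈ Metric.closedBall x ‖x - y‖, ‖kgrad τ z‖ ≤
      ((n : ℝ) + 1) / τ * (3 ^ (((n : ℝ) + 1) / 2) * pker τ x) := by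
    intro z hz
    refine (norm_kgrad_le hτ z).trans ?_
    have : pker τ z ≤ 3 ^ (((n : ℝ) + 1) / 2) * pker τ x := by
      refine pker_le_of_dist_le ?_
      rw [← dist_eq_norm]
      exact (Metric.mem_closedBall.1 hz).trans h
    gcongr
  have h1 := hconv.norm_image_sub_le_of_norm_hasFDerivWithin_le
    (fun z _ => (hasFDerivAt_pker τ z).hasFDerivWithinAt) hb
    (Metric.mem_closedBall.2 (by rw [dist_eq_norm, norm_sub_rev]) : y ∈ _)
    (Metric.mem_closedBall_self (norm_nonneg _))
  rw [Real.norm_eq_abs] at h1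
  refine h1.trans (le_of_eq ?_)
  ring

/-- Away from the diagonal, at distances `≳ R`, the Poisson kernel of any time `τ ≤ R` is `R⁻¹`
times the one of time `R` in Lipschitz norm. -/
lemma abs_pker_sub_pker_le_of_far {τ R : ℝ} (hτ : 0 < τ) (hτR : τ ≤ R) {x y z : Rn n}
    (hx : R ≤ ‖x‖) (hxy : ‖x - y‖ ≤ R / 4) (hz : ‖z - x‖ ≤ 4 * R) :
    |pker τ x - pker τ y| ≤
      2 * ((n : ℝ) + 1) * 100 ^ (((n : ℝ) + 1) / 2) * (‖x - y‖ / R) * pker R z := by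
  have hR : 0 < R := hτ.trans_le hτR
  have hconv : Convex ℝ (Metric.closedBall x (R / 4)) := convex_closedBall _ _
  have hb : ∀ ξ ∈ Metric.closedBall x (R / 4), ‖kgrad τ ξ‖ ≤
      ((n : ℝ) + 1) / (R / 2) * (100 ^ (((n : ℝ) + 1) / 2) * pker R z) := by
    intro ξ hξ
    have hd : ‖ξ - x‖ ≤ R / 4 := by
      rw [← dist_eq_norm]
      exact Metric.mem_closedBall.1 hξ
    have h1 : ‖x‖ ≤ ‖ξ‖ + R / 4 := by
      have := norm_sub_norm_le x ξ
      rw [norm_sub_rev] at this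
      linarith
    have h2 : R / 2 ≤ ‖ξ‖ := by linarith
    have h3 : ‖z‖ ≤ ‖x‖ + 4 * R := by
      have := norm_sub_norm_le z x
      linarith
    have hξ0 : ξ ≠ 0 := by
      rintro rfl
      rw [norm_zero] at h2
      linarith
    refine (norm_kgrad_le_div_norm τ hξ0).trans ?_
    have h4 : pker τ ξ ≤ 100 ^ (((n : ℝ) + 1) / 2) * pker R z := by
      refine pker_le_of_sq_le' hτ hτR (by norm_num) ?_
      have h5 : ‖z‖ ≤ ‖ξ‖ + 17 / 4 * R := by linarith
      nlinarith [norm_nonneg z, norm_nonneg ξ, sq_nonneg τ]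
    have := pker_nonneg τ ξ
    gcongr
  have h1 := hconv.norm_image_sub_le_of_norm_hasFDerivWithin_le
    (fun z _ => (hasFDerivAt_pker τ z).hasFDerivWithinAt) hb
    (Metric.mem_closedBall.2 (by rwa [dist_eq_norm, norm_sub_rev]) : y ∈ _)
    (Metric.mem_closedBall_self (by positivity))
  rw [Real.norm_eq_abs] at h1
  refine h1.trans (le_of_eq ?_)
  field_simp

/-- The constant in the `L¹`-modulus of continuity of the Poisson kernel. -/
def lipConst (n : ℕ) : ℝ := ((n : ℝ) + 1) * 3 ^ (((n : ℝ) + 1) / 2) + 2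

lemma lipConst_ge_two (n : ℕ) : 2 ≤ lipConst n := by
  unfold lipConst
  have : 0 ≤ ((n : ℝ) + 1) * 3 ^ (((n : ℝ) + 1) / 2) := by positivity
  linarith

/-- The `L¹`-modulus of continuity of the Poisson kernel. -/
lemma lintegral_enorm_pker_sub_le {τ : ℝ} (hτ : 0 < τ) (x y : Rn n) :
    ∫⁻ z, ‖pker τ (x - z) - pker τ (y - z)‖ₑ ≤
      ENNReal.ofReal (lipConst n * min 1 (‖x - y‖ / τ)) := by
  rcases le_total ‖x - y‖ τ with h | h
  · have h1 : ∀ z, ‖pker τ (x - z) - pker τ (y - z)‖ₑ ≤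
        ENNReal.ofReal (lipConst n * (‖x - y‖ / τ)) * epker τ (x - z) := by
      intro z
      rw [Real.enorm_eq_ofReal_abs, epker, ← ENNReal.ofReal_mul (by
        have := lipConst_ge_two n; positivity)]
      apply ENNReal.ofReal_le_ofReal
      have h2 : (x - z) - (y - z) = x - y := by abel
      have h3 := abs_pker_sub_pker_le hτ (x := x - z) (y := y - z) (by rwa [h2])
      rw [h2] at h3
      refine h3.trans ?_
      have := pker_nonneg τ (x - z)
      have : ((n : ℝ) + 1) * 3 ^ (((n : ℝ) + 1) / 2) ≤ lipConst n := by
        unfold lipConst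
        linarith
      gcongr
    refine (lintegral_mono h1).trans ?_
    rw [lintegral_const_mul _ (by fun_prop), lintegral_epker_sub hτ, mul_one,
      min_eq_right ((div_le_one hτ).2 h)]
  · have h1 : ∀ z, ‖pker τ (x - z) - pker τ (y - z)‖ₑ ≤ epker τ (x - z) + epker τ (y - z) := by
      intro z
      rw [← enorm_pker, ← enorm_pker]
      exact enorm_sub_le
    refine (lintegral_mono h1).trans ?_
    rw [lintegral_add_left (by fun_prop), lintegral_epker_sub hτ, lintegral_epker_sub hτ,
      min_eq_left ((one_le_div hτ).2 h), mul_one, one_add_one_eq_two,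
      ← ENNReal.ofReal_ofNat 2]
    exact ENNReal.ofReal_le_ofReal (lipConst_ge_two n)

/-! ### Carleson averages and the Poisson kernel -/

lemma boxMean_eq {g : Rn n → ℝ → ℝ≥0∞} (hg : Measurable (Function.uncurry g)) (x : Rn n) (t : ℝ) :
    boxMean g x t =
      (∫⁻ y in Metric.ball x t, ∫⁻ s in Ioo 0 t, g y s) * (volume (Metric.ball x t))⁻¹ := by
  unfold boxMean
  simp only [setLAverage_eq, ENNReal.div_eq_inv_mul]
  rw [lintegral_const_mul, mul_comm, lintegral_lintegral_swap]
  · exact (hg.comp measurable_swap).aemeasurable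
  · exact hg.lintegral_prod_left

/-- If all averages over boxes of size `R` are at most `K`, then so are, up to a constant, the
integrals against the Poisson kernel of time `R`. -/
lemma lintegral_epker_mul_le_of_boxMean_le {g : Rn n → ℝ → ℝ≥0∞}
    (hg : Measurable (Function.uncurry g)) {R : ℝ} (hR : 0 < R) {K : ℝ≥0∞}
    (h : ∀ᵐ z, boxMean g z R ≤ K) (x : Rn n) :
    ∫⁻ y, epker R (x - y) * ∫⁻ s in Ioo 0 R, g y s ≤
      ENNReal.ofReal (3 ^ (((n : ℝ) + 1) / 2)) * K := by
  set Φ : Rn n → ℝ≥0∞ := fun y => ∫⁻ s in Ioo 0 R, g y s with hΦ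
  have hΦm : Measurable Φ := hg.lintegral_prod_right
  set C : ℝ≥0∞ := ENNReal.ofReal (3 ^ (((n : ℝ) + 1) / 2)) with hC
  set V : ℝ≥0∞ := volume (Metric.ball (0 : Rn n) R) with hV
  have hVz : ∀ z : Rn n, volume (Metric.ball z R) = V := fun z => by
    rw [hV, Measure.addHaar_ball_center]
  have hV0 : V ≠ 0 := (Metric.measure_ball_pos _ _ hR).ne'
  have hVt : V ≠ ⊤ := measure_ball_lt_top.ne
  have hball : ∀ y z : Rn n, (Metric.ball y R).indicator (fun _ => (1 : ℝ≥0∞)) z =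
      (Metric.ball z R).indicator (fun _ => (1 : ℝ≥0∞)) y := by
    intro y z
    simp only [indicator, Metric.mem_ball, dist_comm]
  have hind : Measurable fun p : Rn n × Rn n =>
      (Metric.ball p.1 R).indicator (fun _ => (1 : ℝ≥0∞)) p.2 := by
    have : (fun p : Rn n × Rn n => (Metric.ball p.1 R).indicator (fun _ => (1 : ℝ≥0∞)) p.2) =
        {p : Rn n × Rn n | dist p.2 p.1 < R}.indicator fun _ => 1 := by
      ext p
      simp only [indicator, Metric.mem_ball, mem_ofPred_eq]
    rw [this]
    exact measurable_const.indicator (measurableSet_lt (by fun_prop) measurable_const)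
  have h1 : ∀ y, epker R (x - y) ≤
      V⁻¹ * (C * ∫⁻ z, (Metric.ball y R).indicator (fun _ => (1 : ℝ≥0∞)) z * epker R (x - z)) := by
    intro y
    have h2 : epker R (x - y) * V = ∫⁻ z, (Metric.ball y R).indicator (fun _ => (1 : ℝ≥0∞)) z *
        epker R (x - y) := by
      rw [lintegral_mul_const _ (measurable_const.indicator Metric.isOpen_ball.measurableSet),
        lintegral_indicator Metric.isOpen_ball.measurableSet, setLIntegral_one, hVz, mul_comm]
    have h3 : epker R (x - y) * V ≤
        C * ∫⁻ z, (Metric.ball y R).indicator (fun _ => (1 : ℝ≥0∞)) z * epker R (x - z) := by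
      rw [h2, ← lintegral_const_mul' _ _ ENNReal.ofReal_ne_top]
      refine lintegral_mono fun z => ?_
      by_cases hz : z ∈ Metric.ball y R
      · simp only [indicator_of_mem hz, one_mul]
        rw [epker, epker, ← ENNReal.ofReal_mul (by positivity)]
        apply ENNReal.ofReal_le_ofReal
        refine pker_le_of_dist_le ?_
        have : (x - y) - (x - z) = z - y := by abel
        rw [this, ← dist_eq_norm]
        exact (Metric.mem_ball.1 hz).le
      · simp [indicator_of_notMem hz]
    calc epker R (x - y) = V⁻¹ * (epker R (x - y) * V) := by
          rw [mul_comm, mul_assoc, ENNReal.mul_inv_cancel hV0 hVt, mul_one]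
      _ ≤ _ := by gcongr
  calc ∫⁻ y, epker R (x - y) * Φ y
      ≤ ∫⁻ y, V⁻¹ * (C * ∫⁻ z, (Metric.ball y R).indicator (fun _ => (1 : ℝ≥0∞)) z *
          epker R (x - z)) * Φ y := lintegral_mono fun y => by gcongr; exact h1 y
    _ = ∫⁻ y, ∫⁻ z, V⁻¹ * C * ((Metric.ball y R).indicator (fun _ => (1 : ℝ≥0∞)) z *
          epker R (x - z) * Φ y) := by
        refine lintegral_congr fun y => ?_
        have hmy : Measurable fun z => (Metric.ball y R).indicator (fun _ => (1 : ℝ≥0∞)) z *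
            epker R (x - z) :=
          (measurable_const.indicator Metric.isOpen_ball.measurableSet).mul (by fun_prop)
        rw [lintegral_const_mul _ (hmy.mul_const _), lintegral_mul_const _ hmy]
        ring
    _ = ∫⁻ z, ∫⁻ y, V⁻¹ * C * ((Metric.ball y R).indicator (fun _ => (1 : ℝ≥0∞)) z *
          epker R (x - z) * Φ y) := by
        refine lintegral_lintegral_swap (Measurable.aemeasurable ?_)
        exact ((hind.mul (by fun_prop)).mul (hΦm.comp measurable_fst)).const_mul _
    _ = ∫⁻ z, C * epker R (x - z) * boxMean g z R := by
        refine lintegral_congr fun z => ?_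
        simp only [hball _ z]
        rw [boxMean_eq hg, hVz, ← lintegral_indicator Metric.isOpen_ball.measurableSet]
        have : ∀ y, V⁻¹ * C * ((Metric.ball z R).indicator (fun _ => (1 : ℝ≥0∞)) y *
            epker R (x - z) * Φ y) = V⁻¹ * C * epker R (x - z) *
              (Metric.ball z R).indicator Φ y := by
          intro y
          by_cases hy : y ∈ Metric.ball z R
          · simp only [indicator_of_mem hy]
            ring
          · simp [indicator_of_notMem hy]
        simp only [this]
        rw [lintegral_const_mul _ (hΦm.indicator Metric.isOpen_ball.measurableSet)]
        ring
    _ ≤ ∫⁻ z, C * K * epker R (x - z) := by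
        refine lintegral_mono_ae ?_
        filter_upwards [h] with z hz
        calc C * epker R (x - z) * boxMean g z R ≤ C * epker R (x - z) * K := by gcongr
          _ = _ := by ring
    _ = C * K := by
        rw [lintegral_const_mul _ (by fun_prop), lintegral_epker_sub hR, mul_one]

/-! ### The modulus of the half-order difference quotient -/

section FracEnergy
variable {F : Type*} [NormedAddCommGroup F] [NormedSpace ℝ F]

lemma odSq_fracGrad (v : Rn n → F) (x : Rn n) :
    odSq (fracGrad v) x =
      ENNReal.ofReal (gammaConst n / 2) * ∫⁻ y, ‖v x - v y‖ₑ ^ 2 / ‖x - y‖ₑ ^ (n + 1) := by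
  unfold odSq
  rw [← lintegral_const_mul' _ _ ENNReal.ofReal_ne_top]
  refine lintegral_congr fun y => ?_
  by_cases hxy : x = y
  · subst hxy
    simp [fracGrad]
  · have hd : 0 < ‖x - y‖ := norm_pos_iff.2 (sub_ne_zero.2 hxy)
    have hγ : 0 ≤ gammaConst n / 2 := by
      have := gammaConst_pos n
      positivity
    have hd0 : ‖x - y‖ₑ ≠ 0 := by simpa [sub_eq_zero] using hxy
    have h1 : ‖Real.sqrt (gammaConst n / 2) / Real.sqrt ‖x - y‖‖ₑ ^ 2 =
        ENNReal.ofReal (gammaConst n / 2) / ‖x - y‖ₑ := by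
      rw [Real.enorm_eq_ofReal (by positivity), ← ENNReal.ofReal_pow (by positivity), div_pow,
        Real.sq_sqrt hγ, Real.sq_sqrt hd.le, ENNReal.ofReal_div_of_pos hd, ofReal_norm]
    rw [fracGrad, enorm_smul, mul_pow, h1, pow_succ' ‖x - y‖ₑ n, ENNReal.div_eq_inv_mul,
      ENNReal.div_eq_inv_mul, ENNReal.div_eq_inv_mul,
      ENNReal.mul_inv (Or.inl hd0) (Or.inl enorm_ne_top)]
    ring

omit [NormedSpace ℝ F] in
lemma measurable_fracGrad_integrand {α : Type*} [MeasurableSpace α] {w : α → Rn n → F}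
    (hw : StronglyMeasurable (Function.uncurry w)) : Measurable fun p : (α × Rn n) × Rn n =>
      ‖w p.1.1 p.1.2 - w p.1.1 p.2‖ₑ ^ 2 / ‖p.1.2 - p.2‖ₑ ^ (n + 1) := by
  have h1 : StronglyMeasurable fun p : (α × Rn n) × Rn n => w p.1.1 p.1.2 :=
    hw.comp_measurable (g := fun p : (α × Rn n) × Rn n => (p.1.1, p.1.2)) (by fun_prop)
  have h2 : StronglyMeasurable fun p : (α × Rn n) × Rn n => w p.1.1 p.2 :=
    hw.comp_measurable (g := fun p : (α × Rn n) × Rn n => (p.1.1, p.2)) (by fun_prop)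
  exact ((h1.sub h2).enorm.pow_const 2).div (by fun_prop)

lemma measurable_odSq_fracGrad {α : Type*} [MeasurableSpace α] {w : α → Rn n → F}
    (hw : StronglyMeasurable (Function.uncurry w)) :
    Measurable fun p : α × Rn n => odSq (fracGrad (w p.1)) p.2 := by
  simp only [odSq_fracGrad]
  exact ((measurable_fracGrad_integrand hw).lintegral_prod_right').const_mul _

/-- The radial profile `min(1, ρ^(3/2)) ρ^(-n-1)` that dominates the integrand of `|d_{1/2} v|²` for
bounded `v` with Hölder exponent `3/4`. -/
def holderProfile (n : ℕ) (ρ : ℝ) : ℝ := min 1 (ρ ^ (3 / 2 : ℝ)) / ρ ^ (n + 1)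

lemma integrable_holderProfile (hn : 1 ≤ n) :
    Integrable fun h : Rn n => holderProfile n ‖h‖ := by
  have : Nonempty (Fin n) := ⟨⟨0, hn⟩⟩
  rw [integrable_fun_norm_addHaar, finrank_euclideanSpace, Fintype.card_fin]
  have hm : Measurable fun y : ℝ => y ^ (n - 1) • holderProfile n y := by
    unfold holderProfile
    fun_prop
  have hpow : ∀ y : ℝ, 0 < y → y ^ (n - 1) • holderProfile n y = min 1 (y ^ (3 / 2 : ℝ)) / y ^ 2 := by
    intro y hy
    have : y ^ (n + 1) = y ^ (n - 1) * y ^ 2 := by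
      rw [← pow_add]
      congr 1
      omega
    rw [holderProfile, this, smul_eq_mul]
    field_simp
  rw [← Ioc_union_Ioi_eq_Ioi (zero_le_one' ℝ), integrableOn_union]
  constructor
  · have h1 : IntegrableOn (fun y : ℝ => y ^ (-(1 / 2) : ℝ)) (Ioc 0 1) := by
      rw [← intervalIntegrable_iff_integrableOn_Ioc_of_le zero_le_one]
      exact intervalIntegral.intervalIntegrable_rpow' (by norm_num)
    refine Integrable.mono' h1 hm.aestronglyMeasurable ?_
    refine (ae_restrict_iff' measurableSet_Ioc).2 (ae_of_all _ fun y hy => ?_)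
    have hy0 : 0 < y := hy.1
    rw [hpow y hy0, Real.norm_of_nonneg (by positivity), div_le_iff₀ (by positivity),
      ← Real.rpow_natCast, ← Real.rpow_add hy0]
    refine (min_le_right _ _).trans (le_of_eq ?_)
    congr 1
    norm_num
  · have h1 : IntegrableOn (fun y : ℝ => y ^ (-2 : ℝ)) (Ioi 1) :=
      integrableOn_Ioi_rpow_of_lt (by norm_num) one_pos
    refine Integrable.mono' h1 hm.aestronglyMeasurable ?_
    refine (ae_restrict_iff' measurableSet_Ioi).2 (ae_of_all _ fun y hy => ?_)
    have hy0 : 0 < y := zero_lt_one.trans hy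
    rw [hpow y hy0, Real.norm_of_nonneg (by positivity), div_le_iff₀ (by positivity),
      ← Real.rpow_natCast, ← Real.rpow_add hy0]
    refine (min_le_left _ _).trans (le_of_eq ?_)
    norm_num

/-- The constant of `odSq_fracGrad_le_of_holder`. -/
def holderConst (n : ℕ) : ℝ := gammaConst n / 2 * ∫ h : Rn n, holderProfile n ‖h‖

lemma holderProfile_nonneg {ρ : ℝ} (hρ : 0 ≤ ρ) : 0 ≤ holderProfile n ρ := by
  unfold holderProfile
  positivity

lemma holderConst_nonneg (n : ℕ) : 0 ≤ holderConst n := by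
  unfold holderConst
  have := gammaConst_pos n
  have : 0 ≤ ∫ h : Rn n, holderProfile n ‖h‖ :=
    integral_nonneg fun h => holderProfile_nonneg (norm_nonneg h)
  positivity

/-- A bounded function with a Hölder modulus at scale `r` at the point `x` has
`|d_{1/2} v|²(x) ≲ M² / r`. -/
lemma odSq_fracGrad_le_of_holder (hn : 1 ≤ n) {v : Rn n → F} {x : Rn n} {M r : ℝ} (hr : 0 < r)
    (h : ∀ y, ‖v x - v y‖ ≤ M * min 1 ((‖x - y‖ / r) ^ (3 / 4 : ℝ))) :
    odSq (fracGrad v) x ≤ ENNReal.ofReal (holderConst n * (M ^ 2 / r)) := by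
  have hγ := gammaConst_pos n
  set I : ℝ := ∫ h : Rn n, holderProfile n ‖h‖ with hI
  have hI0 : 0 ≤ I := integral_nonneg fun h => holderProfile_nonneg (norm_nonneg h)
  have hscale : ∀ h : Rn n, holderProfile n (‖h‖ / r) = holderProfile n ‖r⁻¹ • h‖ := by
    intro h
    rw [norm_smul, norm_inv, Real.norm_of_nonneg hr.le, div_eq_inv_mul]
  have hint : Integrable fun h : Rn n => holderProfile n (‖h‖ / r) := by
    simp only [hscale]
    exact (integrable_comp_smul_iff volume _ (inv_ne_zero hr.ne')).2 (integrable_holderProfile hn)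
  have hval : ∫ h : Rn n, holderProfile n (‖h‖ / r) = r ^ n * I := by
    simp only [hscale]
    rw [Measure.integral_comp_smul volume (fun h : Rn n => holderProfile n ‖h‖) r⁻¹,
      finrank_euclideanSpace, Fintype.card_fin, inv_pow, inv_inv, abs_of_pos (by positivity),
      smul_eq_mul]
  have hpt : ∀ y, ‖v x - v y‖ₑ ^ 2 / ‖x - y‖ₑ ^ (n + 1) ≤
      ENNReal.ofReal (M ^ 2 / r ^ (n + 1) * holderProfile n (‖x - y‖ / r)) := by
    intro y
    by_cases hxy : x = y
    · subst hxy
      simp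
    · have hd : 0 < ‖x - y‖ := norm_pos_iff.2 (sub_ne_zero.2 hxy)
      rw [← ofReal_norm, ← ofReal_norm, ← ENNReal.ofReal_pow (norm_nonneg _),
        ← ENNReal.ofReal_pow (norm_nonneg _), ← ENNReal.ofReal_div_of_pos (by positivity)]
      apply ENNReal.ofReal_le_ofReal
      have h1 : ‖v x - v y‖ ^ 2 ≤ (M * min 1 ((‖x - y‖ / r) ^ (3 / 4 : ℝ))) ^ 2 := by
        gcongr
        exact h y
      have h2 : (min 1 ((‖x - y‖ / r) ^ (3 / 4 : ℝ))) ^ 2 = min 1 ((‖x - y‖ / r) ^ (3 / 2 : ℝ)) := by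
        have h3 : (‖x - y‖ / r) ^ (3 / 2 : ℝ) = ((‖x - y‖ / r) ^ (3 / 4 : ℝ)) ^ 2 := by
          rw [← Real.rpow_natCast, ← Real.rpow_mul (by positivity)]
          norm_num
        rw [h3]
        have h4 : 0 ≤ (‖x - y‖ / r) ^ (3 / 4 : ℝ) := by positivity
        rcases le_total 1 ((‖x - y‖ / r) ^ (3 / 4 : ℝ)) with h5 | h5
        · rw [min_eq_left h5, min_eq_left (one_le_pow₀ h5), one_pow]
        · rw [min_eq_right h5, min_eq_right (pow_le_one₀ h4 h5)]
      rw [mul_pow, h2] at h1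
      calc ‖v x - v y‖ ^ 2 / ‖x - y‖ ^ (n + 1)
          ≤ M ^ 2 * min 1 ((‖x - y‖ / r) ^ (3 / 2 : ℝ)) / ‖x - y‖ ^ (n + 1) := by gcongr
        _ = _ := by
          rw [holderProfile, div_pow]
          field_simp
  rw [odSq_fracGrad]
  calc ENNReal.ofReal (gammaConst n / 2) * ∫⁻ y, ‖v x - v y‖ₑ ^ 2 / ‖x - y‖ₑ ^ (n + 1)
      ≤ ENNReal.ofReal (gammaConst n / 2) * ∫⁻ y, ENNReal.ofReal
        (M ^ 2 / r ^ (n + 1) * holderProfile n (‖x - y‖ / r)) := by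
        gcongr
        exact hpt _
    _ = ENNReal.ofReal (gammaConst n / 2) * ENNReal.ofReal (M ^ 2 / r ^ (n + 1) * (r ^ n * I)) := by
        rw [lintegral_sub_left_eq_self (fun y : Rn n => ENNReal.ofReal
          (M ^ 2 / r ^ (n + 1) * holderProfile n (‖y‖ / r))) x,
          ← ofReal_integral_eq_lintegral_ofReal (hint.const_mul _)
            (ae_of_all _ fun y => mul_nonneg (by positivity) (holderProfile_nonneg (by positivity))),
          integral_const_mul, hval]
    _ = _ := by
        rw [← ENNReal.ofReal_mul (by positivity), holderConst]
        congr 1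
        rw [← hI]
        field_simp
        ring

lemma sq_lintegral_mul_le {α : Type*} [MeasurableSpace α] {μ : Measure α} {κ a : α → ℝ≥0∞}
    (hκ : Measurable κ) (ha : Measurable a) :
    (∫⁻ h, κ h * a h ∂μ) ^ 2 ≤ (∫⁻ h, κ h ∂μ) * ∫⁻ h, κ h * a h ^ 2 ∂μ := by
  have h1 := ENNReal.lintegral_mul_le_Lp_mul_Lq (μ.withDensity κ) Real.HolderConjugate.two_two
    (f := fun _ => 1) (g := a) aemeasurable_const ha.aemeasurable
  simp only [Pi.mul_apply, one_mul, ENNReal.one_rpow, lintegral_const, one_div] at h1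
  rw [lintegral_withDensity_eq_lintegral_mul _ hκ ha,
    lintegral_withDensity_eq_lintegral_mul _ hκ (by fun_prop), withDensity_apply _ MeasurableSet.univ,
    Measure.restrict_univ] at h1
  simp only [Pi.mul_apply, ENNReal.rpow_ofNat] at h1
  calc (∫⁻ h, κ h * a h ∂μ) ^ 2
      ≤ ((∫⁻ h, κ h ∂μ) ^ (2 : ℝ)⁻¹ * (∫⁻ h, κ h * a h ^ 2 ∂μ) ^ (2 : ℝ)⁻¹) ^ 2 := by gcongr
    _ = _ := by
      rw [mul_pow, ← ENNReal.rpow_mul_natCast, ← ENNReal.rpow_mul_natCast]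
      norm_num

variable {G : Type*} [NormedAddCommGroup G] [NormedSpace ℝ G]

/-- The modulus `|d_{1/2} ·|²` of a function whose increments are dominated by a convolution of the
increments of `b`: Cauchy–Schwarz with respect to the measure with density `κ`. -/
lemma odSq_fracGrad_le_of_convolution {κ : Rn n → ℝ≥0∞} (hκ : Measurable κ) {b : Rn n → F}
    (hb : StronglyMeasurable b) {Q : Rn n → G}
    (h : ∀ x y, ‖Q x - Q y‖ₑ ≤ ∫⁻ h, κ h * ‖b (x - h) - b (y - h)‖ₑ) (x : Rn n) :
    odSq (fracGrad Q) x ≤ (∫⁻ h, κ h) * ∫⁻ h, κ h * odSq (fracGrad b) (x - h) := by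
  have hbxy : Measurable fun p : Rn n × Rn n => ‖b (x - p.2) - b (p.1 - p.2)‖ₑ := by
    have h1 : StronglyMeasurable fun p : Rn n × Rn n => b (x - p.2) :=
      hb.comp_measurable (by fun_prop)
    have h2 : StronglyMeasurable fun p : Rn n × Rn n => b (p.1 - p.2) :=
      hb.comp_measurable (by fun_prop)
    exact (h1.sub h2).enorm
  have hm : Measurable fun p : Rn n × Rn n =>
      κ p.2 * ‖b (x - p.2) - b (p.1 - p.2)‖ₑ ^ 2 / ‖x - p.1‖ₑ ^ (n + 1) :=
    ((hκ.comp measurable_snd).mul (hbxy.pow_const 2)).div (by fun_prop)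
  simp only [odSq_fracGrad]
  have h1 : ∫⁻ y, ‖Q x - Q y‖ₑ ^ 2 / ‖x - y‖ₑ ^ (n + 1) ≤
      (∫⁻ h, κ h) * ∫⁻ h, κ h * ∫⁻ y, ‖b (x - h) - b y‖ₑ ^ 2 / ‖(x - h) - y‖ₑ ^ (n + 1) := by
    calc ∫⁻ y, ‖Q x - Q y‖ₑ ^ 2 / ‖x - y‖ₑ ^ (n + 1)
        ≤ ∫⁻ y, (∫⁻ h, κ h) * ∫⁻ h, κ h * ‖b (x - h) - b (y - h)‖ₑ ^ 2 / ‖x - y‖ₑ ^ (n + 1) := by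
          refine lintegral_mono fun y => ?_
          have hy : Measurable fun h => ‖b (x - h) - b (y - h)‖ₑ :=
            hbxy.comp (g := fun p : Rn n × Rn n => ‖b (x - p.2) - b (p.1 - p.2)‖ₑ)
              (measurable_const.prodMk measurable_id : Measurable fun h => (y, h))
          have h2 : (∫⁻ h, κ h * ‖b (x - h) - b (y - h)‖ₑ ^ 2 / ‖x - y‖ₑ ^ (n + 1)) =
              (∫⁻ h, κ h * ‖b (x - h) - b (y - h)‖ₑ ^ 2) / ‖x - y‖ₑ ^ (n + 1) := by
            have hy2 : Measurable fun h => κ h * ‖b (x - h) - b (y - h)‖ₑ ^ 2 :=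
              hκ.mul (hy.pow_const 2)
            simp only [div_eq_mul_inv]
            rw [lintegral_mul_const _ hy2]
          rw [h2, ← mul_div_assoc]
          gcongr
          refine le_trans ?_ (sq_lintegral_mul_le hκ hy)
          gcongr
          exact h x y
      _ = (∫⁻ h, κ h) * ∫⁻ y, ∫⁻ h, κ h * ‖b (x - h) - b (y - h)‖ₑ ^ 2 / ‖x - y‖ₑ ^ (n + 1) :=
          lintegral_const_mul _ hm.lintegral_prod_right
      _ = (∫⁻ h, κ h) * ∫⁻ h, ∫⁻ y, κ h * ‖b (x - h) - b (y - h)‖ₑ ^ 2 / ‖x - y‖ₑ ^ (n + 1) := by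
          rw [lintegral_lintegral_swap hm.aemeasurable]
      _ = _ := by
          congr 1
          refine lintegral_congr fun h => ?_
          have hbh : Measurable fun y => ‖b (x - h) - b y‖ₑ :=
            (stronglyMeasurable_const.sub hb).enorm
          have hbh2 : Measurable fun y => ‖b (x - h) - b y‖ₑ ^ 2 / ‖(x - h) - y‖ₑ ^ (n + 1) :=
            (hbh.pow_const 2).div (by fun_prop)
          rw [← lintegral_const_mul _ hbh2,
            ← lintegral_sub_right_eq_self (fun y => κ h * (‖b (x - h) - b y‖ₑ ^ 2 /
              ‖(x - h) - y‖ₑ ^ (n + 1))) h]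
          refine lintegral_congr fun y => ?_
          rw [mul_div_assoc, sub_sub_sub_cancel_right]
  have hm2 : Measurable fun h =>
      κ h * ∫⁻ y, ‖b (x - h) - b y‖ₑ ^ 2 / ‖(x - h) - y‖ₑ ^ (n + 1) := by
    refine hκ.mul (Measurable.lintegral_prod_right ?_)
    have h1 : StronglyMeasurable fun p : Rn n × Rn n => b (x - p.1) :=
      hb.comp_measurable (by fun_prop)
    have h2 : StronglyMeasurable fun p : Rn n × Rn n => b p.2 :=
      hb.comp_measurable (by fun_prop)
    exact ((h1.sub h2).enorm.pow_const 2).div (by fun_prop)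
  calc ENNReal.ofReal (gammaConst n / 2) * ∫⁻ y, ‖Q x - Q y‖ₑ ^ 2 / ‖x - y‖ₑ ^ (n + 1)
      ≤ ENNReal.ofReal (gammaConst n / 2) * ((∫⁻ h, κ h) * ∫⁻ h, κ h *
          ∫⁻ y, ‖b (x - h) - b y‖ₑ ^ 2 / ‖(x - h) - y‖ₑ ^ (n + 1)) := by gcongr
    _ = _ := by
      have : ∀ h, κ h * (ENNReal.ofReal (gammaConst n / 2) *
          ∫⁻ y, ‖b (x - h) - b y‖ₑ ^ 2 / ‖(x - h) - y‖ₑ ^ (n + 1)) =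
          ENNReal.ofReal (gammaConst n / 2) * (κ h *
          ∫⁻ y, ‖b (x - h) - b y‖ₑ ^ 2 / ‖(x - h) - y‖ₑ ^ (n + 1)) := fun h => by ring
      simp only [this]
      rw [lintegral_const_mul _ hm2]
      ring

lemma odSq_fracGrad_add_le (v w : Rn n → F) (hv : StronglyMeasurable v) (x : Rn n) :
    odSq (fracGrad (v + w)) x ≤ 2 * odSq (fracGrad v) x + 2 * odSq (fracGrad w) x := by
  simp only [odSq_fracGrad]
  have hvm : Measurable fun y => 2 * (‖v x - v y‖ₑ ^ 2 / ‖x - y‖ₑ ^ (n + 1)) :=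
    (((stronglyMeasurable_const.sub hv).enorm.pow_const 2).div (by fun_prop)).const_mul 2
  have h1 : ∀ y, ‖(v + w) x - (v + w) y‖ₑ ^ 2 / ‖x - y‖ₑ ^ (n + 1) ≤
      2 * (‖v x - v y‖ₑ ^ 2 / ‖x - y‖ₑ ^ (n + 1)) +
        2 * (‖w x - w y‖ₑ ^ 2 / ‖x - y‖ₑ ^ (n + 1)) := by
    intro y
    rw [← mul_div_assoc, ← mul_div_assoc, ← ENNReal.add_div]
    gcongr
    have h2 : (v + w) x - (v + w) y = (v x - v y) + (w x - w y) := by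
      simp only [Pi.add_apply]
      abel
    rw [h2, ← mul_add]
    calc ‖(v x - v y) + (w x - w y)‖ₑ ^ 2 ≤ (‖v x - v y‖ₑ + ‖w x - w y‖ₑ) ^ 2 := by
          gcongr
          exact enorm_add_le _ _
      _ ≤ _ := by
          have := ENNReal.rpow_add_le_mul_rpow_add_rpow ‖v x - v y‖ₑ ‖w x - w y‖ₑ (p := 2)
            (by norm_num)
          norm_num at this
          exact this
  calc _ ≤ ENNReal.ofReal (gammaConst n / 2) * ∫⁻ y,
        (2 * (‖v x - v y‖ₑ ^ 2 / ‖x - y‖ₑ ^ (n + 1)) +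
        2 * (‖w x - w y‖ₑ ^ 2 / ‖x - y‖ₑ ^ (n + 1))) := by
        gcongr
        exact h1 _
    _ = _ := by
        rw [lintegral_add_left hvm, lintegral_const_mul' _ _ ENNReal.ofNat_ne_top,
          lintegral_const_mul' _ _ ENNReal.ofNat_ne_top]
        ring

end FracEnergy

/-! ### Duhamel potentials -/

section Potential
variable {E : Type*} [NormedAddCommGroup E] [NormedSpace ℝ E]

/-- The Duhamel integral `∬ p_{t-s}(x - y) g(y,s) dy ds` over all of space-time; the kernel vanishes
for `s ≥ t`. -/
def dPot (g : Rn n × ℝ → E) (x : Rn n) (t : ℝ) : E := ∫ w, pker (t - w.2) (x - w.1) • g w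

/-- The Duhamel integral of a function with values in `[0,∞]`. -/
def eDPot (φ : Rn n × ℝ → ℝ≥0∞) (x : Rn n) (t : ℝ) : ℝ≥0∞ :=
  ∫⁻ w, epker (t - w.2) (x - w.1) * φ w

lemma stronglyMeasurable_dPot {g : Rn n × ℝ → E} (hg : StronglyMeasurable g) :
    StronglyMeasurable fun z : Rn n × ℝ => dPot g z.1 z.2 := by
  unfold dPot
  apply StronglyMeasurable.integral_prod_right
  refine StronglyMeasurable.smul (Measurable.stronglyMeasurable (by fun_prop))
    (hg.comp_measurable measurable_snd)

lemma stronglyMeasurable_dPot_left {g : Rn n × ℝ → E} (hg : StronglyMeasurable g) (t : ℝ) :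
    StronglyMeasurable fun x : Rn n => dPot g x t :=
  (stronglyMeasurable_dPot hg).comp_measurable (measurable_id.prodMk measurable_const)

lemma enorm_dPot_integrand (g : Rn n × ℝ → E) (x : Rn n) (t : ℝ) (w : Rn n × ℝ) :
    ‖pker (t - w.2) (x - w.1) • g w‖ₑ = epker (t - w.2) (x - w.1) * ‖g w‖ₑ := by
  rw [enorm_smul, enorm_pker]

lemma enorm_dPot_le (g : Rn n × ℝ → E) (x : Rn n) (t : ℝ) :
    ‖dPot g x t‖ₑ ≤ eDPot (fun w => ‖g w‖ₑ) x t := by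
  refine (enorm_integral_le_lintegral_enorm _).trans (le_of_eq ?_)
  exact lintegral_congr fun w => enorm_dPot_integrand g x t w

lemma integrable_dPot {g : Rn n × ℝ → E} (hg : StronglyMeasurable g) {x : Rn n} {t : ℝ}
    (h : eDPot (fun w => ‖g w‖ₑ) x t < ⊤) :
    Integrable fun w : Rn n × ℝ => pker (t - w.2) (x - w.1) • g w := by
  refine ⟨(StronglyMeasurable.smul (Measurable.stronglyMeasurable (by fun_prop))
    hg).aestronglyMeasurable, ?_⟩
  rw [HasFiniteIntegral]
  simp only [enorm_dPot_integrand]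
  exact h

lemma eDPot_mono {φ ψ : Rn n × ℝ → ℝ≥0∞} {x : Rn n} {t : ℝ}
    (h : ∀ w : Rn n × ℝ, w.2 < t → φ w ≤ ψ w) : eDPot φ x t ≤ eDPot ψ x t := by
  refine lintegral_mono fun w => ?_
  rcases lt_or_ge w.2 t with hw | hw
  · have := h w hw
    gcongr
  · simp only [epker_of_nonpos (sub_nonpos.2 hw), zero_mul, le_refl]

lemma dPot_congr {g g' : Rn n × ℝ → E} {x : Rn n} {t : ℝ}
    (h : ∀ w : Rn n × ℝ, w.2 < t → g w = g' w) : dPot g x t = dPot g' x t := by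
  refine integral_congr_ae (ae_of_all _ fun w => ?_)
  rcases lt_or_ge w.2 t with hw | hw
  · simp only [h w hw]
  · simp only [pker_of_nonpos (sub_nonpos.2 hw), zero_smul]

lemma eDPot_eq_lintegral {φ : Rn n × ℝ → ℝ≥0∞} (hφ : Measurable φ) (x : Rn n) (t : ℝ) :
    eDPot φ x t = ∫⁻ s, ∫⁻ y, epker (t - s) (x - y) * φ (y, s) := by
  have hm : Measurable fun w : Rn n × ℝ => epker (t - w.2) (x - w.1) * φ w :=
    Measurable.mul (by fun_prop) hφ
  rw [eDPot, Measure.volume_eq_prod, lintegral_prod_symm' _ hm]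

/-- `g` cut off to times in `S`. -/
def timeCut {Z : Type*} [Zero Z] (S : Set ℝ) (g : Rn n × ℝ → Z) : Rn n × ℝ → Z :=
  (Prod.snd ⁻¹' S).indicator g

lemma timeCut_of_mem {Z : Type*} [Zero Z] {S : Set ℝ} {g : Rn n × ℝ → Z} {w : Rn n × ℝ}
    (h : w.2 ∈ S) : timeCut S g w = g w := indicator_of_mem (s := Prod.snd ⁻¹' S) h g

lemma timeCut_of_notMem {Z : Type*} [Zero Z] {S : Set ℝ} {g : Rn n × ℝ → Z} {w : Rn n × ℝ}
    (h : w.2 ∉ S) : timeCut S g w = 0 := indicator_of_notMem (s := Prod.snd ⁻¹' S) h g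

omit [NormedSpace ℝ E] in
lemma enorm_timeCut (S : Set ℝ) (g : Rn n × ℝ → E) (w : Rn n × ℝ) :
    ‖timeCut S g w‖ₑ = timeCut S (fun w => ‖g w‖ₑ) w := by
  by_cases h : w.2 ∈ S
  · rw [timeCut_of_mem h, timeCut_of_mem h]
  · rw [timeCut_of_notMem h, timeCut_of_notMem h, enorm_zero]

lemma timeCut_le (S : Set ℝ) (φ : Rn n × ℝ → ℝ≥0∞) (w : Rn n × ℝ) : timeCut S φ w ≤ φ w :=
  indicator_le_self _ _ w

lemma measurable_timeCut {S : Set ℝ} (hS : MeasurableSet S) {φ : Rn n × ℝ → ℝ≥0∞}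
    (hφ : Measurable φ) : Measurable (timeCut S φ) := hφ.indicator (measurable_snd hS)

omit [NormedSpace ℝ E] in
lemma stronglyMeasurable_timeCut {S : Set ℝ} (hS : MeasurableSet S) {g : Rn n × ℝ → E}
    (hg : StronglyMeasurable g) : StronglyMeasurable (timeCut S g) :=
  hg.indicator (measurable_snd hS)

/-- Splitting off the sources after the time `a`. -/
lemma dPot_eq_add {g : Rn n × ℝ → E} (hg : StronglyMeasurable g) {x : Rn n} {t : ℝ}
    (h : eDPot (fun w => ‖g w‖ₑ) x t < ⊤) (a : ℝ) :
    dPot g x t = dPot (timeCut (Iio a) g) x t + dPot (timeCut (Ici a) g) x t := by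
  have hlt : ∀ S : Set ℝ, eDPot (fun w => ‖timeCut S g w‖ₑ) x t < ⊤ := by
    intro S
    refine lt_of_le_of_lt (eDPot_mono fun w _ => ?_) h
    rw [enorm_timeCut]
    exact timeCut_le _ _ _
  unfold dPot
  rw [← integral_add (integrable_dPot (stronglyMeasurable_timeCut measurableSet_Iio hg) (hlt _))
    (integrable_dPot (stronglyMeasurable_timeCut measurableSet_Ici hg) (hlt _))]
  refine integral_congr_ae (ae_of_all _ fun w => ?_)
  simp only
  rw [← smul_add]
  congr 1
  rcases lt_or_ge w.2 a with hw | hw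
  · rw [timeCut_of_mem (S := Iio a) hw, timeCut_of_notMem (S := Ici a) (not_le.2 hw), add_zero]
  · rw [timeCut_of_notMem (S := Iio a) (not_lt.2 hw), timeCut_of_mem (S := Ici a) hw, zero_add]

lemma ae_lintegral_epker_mul_epker {δ σ : ℝ} (hδ : 0 < δ) (hσ : 0 < σ) (x : Rn n) :
    ∀ᵐ y : Rn n, ∫⁻ z, epker δ (x - z) * epker σ (z - y) = epker (δ + σ) (x - y) := by
  have h := (quasiMeasurePreserving_sub_left volume x).ae
    (lintegral_epker_mul_epker (n := n) hδ hσ)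
  filter_upwards [h] with y hy
  rw [← hy, ← lintegral_sub_right_eq_self (fun z => epker δ (x - y - z) * epker σ z) y]
  refine lintegral_congr fun z => ?_
  rw [sub_sub_sub_cancel_right]

/-- The semigroup law for the sources before time `t`. -/
lemma ae_lintegral_epker_mul_epker_prod {δ : ℝ} (hδ : 0 < δ) (x : Rn n) (t : ℝ) :
    ∀ᵐ w : Rn n × ℝ, ∫⁻ z, epker δ (x - z) * epker (t - w.2) (z - w.1) =
      timeCut (Iio t) (fun w => epker (t + δ - w.2) (x - w.1)) w := by
  have hm : Measurable fun w : Rn n × ℝ => ∫⁻ z, epker δ (x - z) * epker (t - w.2) (z - w.1) := by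
    apply Measurable.lintegral_prod_right
    fun_prop
  have hm2 : Measurable (timeCut (Iio t) fun w : Rn n × ℝ => epker (t + δ - w.2) (x - w.1)) :=
    measurable_timeCut measurableSet_Iio (by fun_prop)
  rw [Measure.volume_eq_prod, ← Measure.prod_swap]
  refine (ae_map_iff measurable_swap.aemeasurable (measurableSet_eq_fun hm hm2)).2 ?_
  refine Measure.ae_prod_iff_ae_ae ?_ |>.2 (ae_of_all _ fun s => ?_)
  · exact measurableSet_eq_fun (hm.comp measurable_swap) (hm2.comp measurable_swap)
  · rcases lt_or_ge s t with hs | hs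
    · filter_upwards [ae_lintegral_epker_mul_epker hδ (sub_pos.2 hs) x] with y hy
      simp only [Prod.swap_prod_mk]
      rw [hy, timeCut_of_mem (w := (y, s)) (show s ∈ Iio t from hs)]
      congr 1
      ring
    · refine ae_of_all _ fun y => ?_
      simp only [Prod.swap_prod_mk]
      rw [timeCut_of_notMem (w := (y, s)) (show s ∉ Iio t from not_lt.2 hs)]
      simp only [epker_of_nonpos (sub_nonpos.2 hs), mul_zero, lintegral_zero]

/-- The scalar form of the semigroup law: averaging a potential against the kernel of time `δ` lets the
sources before time `t` evolve until time `t + δ`. -/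
lemma lintegral_epker_mul_eDPot {φ : Rn n × ℝ → ℝ≥0∞} (hφ : Measurable φ) {δ : ℝ} (hδ : 0 < δ)
    (x : Rn n) (t : ℝ) :
    ∫⁻ z, epker δ (x - z) * eDPot φ z t = eDPot (timeCut (Iio t) φ) x (t + δ) := by
  unfold eDPot
  have h1 : ∀ z, epker δ (x - z) * ∫⁻ w, epker (t - w.2) (z - w.1) * φ w =
      ∫⁻ w, epker δ (x - z) * (epker (t - w.2) (z - w.1) * φ w) := fun z =>
    (lintegral_const_mul _ (Measurable.mul (by fun_prop) hφ)).symm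
  simp only [h1]
  rw [lintegral_lintegral_swap]
  · refine lintegral_congr_ae ?_
    filter_upwards [ae_lintegral_epker_mul_epker_prod hδ x t] with w hw
    simp only [← mul_assoc]
    rw [lintegral_mul_const _ (by fun_prop), hw]
    by_cases hwt : w.2 ∈ Iio t
    · rw [timeCut_of_mem hwt, timeCut_of_mem hwt]
    · rw [timeCut_of_notMem hwt, timeCut_of_notMem hwt, zero_mul, mul_zero]
  · refine Measurable.aemeasurable (Measurable.mul (by fun_prop) (Measurable.mul (by fun_prop) ?_))
    exact hφ.comp measurable_snd

lemma lintegral_eDPot {φ : Rn n × ℝ → ℝ≥0∞} (hφ : Measurable φ) (t : ℝ) :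
    ∫⁻ x, eDPot φ x t = ∫⁻ w, timeCut (Iio t) φ w := by
  unfold eDPot
  rw [lintegral_lintegral_swap]
  · refine lintegral_congr fun w => ?_
    rw [lintegral_mul_const _ (by fun_prop)]
    rcases lt_or_ge w.2 t with hw | hw
    · rw [timeCut_of_mem (S := Iio t) hw,
        lintegral_sub_right_eq_self (fun x => epker (t - w.2) x) w.1,
        lintegral_epker (sub_pos.2 hw), one_mul]
    · rw [timeCut_of_notMem (S := Iio t) (not_lt.2 hw)]
      simp only [epker_of_nonpos (sub_nonpos.2 hw), lintegral_zero, zero_mul]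
  · refine Measurable.aemeasurable (Measurable.mul (by fun_prop) ?_)
    exact hφ.comp measurable_snd

/-- The Poisson semigroup on functions with values in a normed space. -/
def pconv (τ : ℝ) (b : Rn n → E) (x : Rn n) : E := ∫ z, pker τ (x - z) • b z

lemma integrable_pconv {τ : ℝ} {b : Rn n → E} (hb : StronglyMeasurable b) {x : Rn n}
    (h : ∫⁻ z, epker τ (x - z) * ‖b z‖ₑ < ⊤) : Integrable fun z => pker τ (x - z) • b z := by
  refine ⟨(StronglyMeasurable.smul (Measurable.stronglyMeasurable (by fun_prop))
    hb).aestronglyMeasurable, ?_⟩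
  rw [HasFiniteIntegral]
  simpa only [enorm_smul, enorm_pker] using h

/-- `p_δ * u(t)` is the part of `u(t + δ)` that comes from the sources before time `t`. -/
lemma pconv_dPot [CompleteSpace E] {g : Rn n × ℝ → E} (hg : StronglyMeasurable g) {δ : ℝ} (hδ : 0 < δ) (x : Rn n)
    (t : ℝ) (h : eDPot (fun w => ‖g w‖ₑ) x (t + δ) < ⊤) :
    pconv δ (fun z => dPot g z t) x = dPot (timeCut (Iio t) g) x (t + δ) := by
  unfold pconv dPot
  have hgm : Measurable fun w => ‖g w‖ₑ := hg.enorm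
  have hsm : StronglyMeasurable fun p : Rn n × (Rn n × ℝ) =>
      pker δ (x - p.1) • (pker (t - p.2.2) (p.1 - p.2.1) • g p.2) :=
    (Measurable.stronglyMeasurable (by fun_prop)).smul ((Measurable.stronglyMeasurable
      (by fun_prop)).smul (hg.comp_measurable measurable_snd))
  have hint : Integrable (fun p : Rn n × (Rn n × ℝ) =>
      pker δ (x - p.1) • (pker (t - p.2.2) (p.1 - p.2.1) • g p.2))
      ((volume : Measure (Rn n)).prod (volume : Measure (Rn n × ℝ))) := by
    refine ⟨hsm.aestronglyMeasurable, ?_⟩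
    rw [HasFiniteIntegral, lintegral_prod _ hsm.enorm.aemeasurable]
    simp only [enorm_smul, enorm_pker]
    have : ∀ z, (∫⁻ w : Rn n × ℝ, epker δ (x - z) * (epker (t - w.2) (z - w.1) * ‖g w‖ₑ)) =
        epker δ (x - z) * eDPot (fun w => ‖g w‖ₑ) z t := fun z =>
      lintegral_const_mul _ (Measurable.mul (by fun_prop) hgm)
    simp only [this]
    rw [lintegral_epker_mul_eDPot hgm hδ]
    exact lt_of_le_of_lt (eDPot_mono fun w _ => timeCut_le _ _ _) h
  have h1 : ∀ z, pker δ (x - z) • ∫ w : Rn n × ℝ, pker (t - w.2) (z - w.1) • g w =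
      ∫ w : Rn n × ℝ, pker δ (x - z) • (pker (t - w.2) (z - w.1) • g w) := fun z =>
    (integral_smul _ _).symm
  simp only [h1]
  rw [integral_integral_swap hint]
  refine integral_congr_ae ?_
  filter_upwards [ae_lintegral_epker_mul_epker_prod hδ x t] with w hw
  simp only [smul_smul]
  rw [integral_smul_const]
  have h2 : ∫ z, pker δ (x - z) * pker (t - w.2) (z - w.1) =
      (timeCut (Iio t) (fun w => epker (t + δ - w.2) (x - w.1)) w).toReal := by
    rw [← hw, integral_eq_lintegral_of_nonneg_ae
      (ae_of_all _ fun z => mul_nonneg (pker_nonneg _ _) (pker_nonneg _ _))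
      (Measurable.aestronglyMeasurable (by fun_prop))]
    congr 1
    refine lintegral_congr fun z => ?_
    rw [ENNReal.ofReal_mul (pker_nonneg _ _)]
    rfl
  rw [h2]
  by_cases hwt : w.2 ∈ Iio t
  · rw [timeCut_of_mem hwt, timeCut_of_mem hwt, epker, ENNReal.toReal_ofReal (pker_nonneg _ _)]
  · rw [timeCut_of_notMem hwt, timeCut_of_notMem hwt]
    simp

/-- The mild formulation: restarting the evolution at time `a`. -/
lemma dPot_eq_pconv_add [CompleteSpace E] {g : Rn n × ℝ → E} (hg : StronglyMeasurable g) {x : Rn n} {t a : ℝ}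
    (hat : a < t) (h : eDPot (fun w => ‖g w‖ₑ) x t < ⊤) :
    dPot g x t = pconv (t - a) (fun z => dPot g z a) x + dPot (timeCut (Ici a) g) x t := by
  have h1 : a + (t - a) = t := by ring
  rw [pconv_dPot hg (sub_pos.2 hat) x a (by rwa [h1]), h1]
  exact dPot_eq_add hg h a

end Potential

/-! ### The energy inequality -/

section Energy
variable {E : Type*} [NormedAddCommGroup E] [InnerProductSpace ℝ E] [CompleteSpace E]

/-- The variance identity for a probability measure. -/
lemma lintegral_lintegral_enorm_sub_sq {α : Type*} [MeasurableSpace α] (μ : Measure α)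
    [IsProbabilityMeasure μ] {b : α → E} (hb : StronglyMeasurable b) {M : ℝ}
    (hM : ∀ z, ‖b z‖ ≤ M) :
    ∫⁻ z, ∫⁻ z', ‖b z - b z'‖ₑ ^ 2 ∂μ ∂μ + 2 * ‖∫ z, b z ∂μ‖ₑ ^ 2 = 2 * ∫⁻ z, ‖b z‖ₑ ^ 2 ∂μ := by
  have hi : Integrable b μ := Integrable.of_bound hb.aestronglyMeasurable M (ae_of_all _ hM)
  have hsq : Integrable (fun z => ‖b z‖ ^ 2) μ := by
    refine Integrable.of_bound (hb.norm.pow 2).aestronglyMeasurable (M ^ 2) (ae_of_all _ fun z => ?_)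
    rw [Real.norm_of_nonneg (by positivity)]
    gcongr
    exact hM z
  set m := ∫ z, b z ∂μ with hm
  set B := ∫ z, ‖b z‖ ^ 2 ∂μ with hB
  have hin : ∀ z, ∫ z', ‖b z - b z'‖ ^ 2 ∂μ = ‖b z‖ ^ 2 - 2 * inner ℝ (b z) m + B := by
    intro z
    have h1 : ∀ z', ‖b z - b z'‖ ^ 2 = (‖b z‖ ^ 2 - 2 * inner ℝ (b z) (b z')) + ‖b z'‖ ^ 2 :=
      fun z' => norm_sub_sq_real _ _
    simp only [h1]
    have h2 : Integrable (fun z' => 2 * inner ℝ (b z) (b z')) μ := (hi.const_inner (b z)).const_mul 2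
    have h3 : Integrable (fun z' => ‖b z‖ ^ 2 - 2 * inner ℝ (b z) (b z')) μ :=
      (integrable_const _).sub h2
    rw [integral_add h3 hsq, integral_sub (integrable_const _) h2,
      integral_const_mul, integral_inner hi, integral_const]
    simp [hm, hB]
  have hbound : ∀ z z', ‖b z - b z'‖ ^ 2 ≤ (2 * M) ^ 2 := by
    intro z z'
    have : ‖b z - b z'‖ ≤ 2 * M := by
      have := norm_sub_le (b z) (b z')
      have := hM z
      have := hM z'
      linarith
    gcongr
  have hl : ∀ z, ∫⁻ z', ‖b z - b z'‖ₑ ^ 2 ∂μ = ENNReal.ofReal (∫ z', ‖b z - b z'‖ ^ 2 ∂μ) := by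
    intro z
    rw [ofReal_integral_eq_lintegral_ofReal _ (ae_of_all _ fun z' => by positivity)]
    · refine lintegral_congr fun z' => ?_
      rw [ENNReal.ofReal_pow (norm_nonneg _), ofReal_norm]
    · refine Integrable.of_bound (((stronglyMeasurable_const.sub hb).norm.pow
        2).aestronglyMeasurable) ((2 * M) ^ 2) (ae_of_all _ fun z' => ?_)
      rw [Real.norm_of_nonneg (by positivity)]
      exact hbound z z'
  have hout : ∫ z, (‖b z‖ ^ 2 - 2 * inner ℝ (b z) m + B) ∂μ = 2 * B - 2 * ‖m‖ ^ 2 := by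
    have h2 : Integrable (fun z => 2 * inner ℝ (b z) m) μ := (hi.inner_const m).const_mul 2
    have h3 : ∫ z, inner ℝ (b z) m ∂μ = ‖m‖ ^ 2 := by
      simp only [real_inner_comm m]
      rw [integral_inner hi, ← hm, real_inner_self_eq_norm_sq]
    have h4 : Integrable (fun z => ‖b z‖ ^ 2 - 2 * inner ℝ (b z) m) μ := hsq.sub h2
    rw [integral_add h4 (integrable_const _), integral_sub hsq h2, integral_const_mul, h3,
      integral_const]
    simp only [probReal_univ, smul_eq_mul, one_mul]
    ring
  have hnn : ∀ z, 0 ≤ ‖b z‖ ^ 2 - 2 * inner ℝ (b z) m + B := by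
    intro z
    rw [← hin]
    exact integral_nonneg fun z' => by positivity
  simp only [hl, hin]
  have hint : Integrable (fun z => ‖b z‖ ^ 2 - 2 * inner ℝ (b z) m + B) μ :=
    (hsq.sub ((hi.inner_const m).const_mul 2)).add (integrable_const _)
  rw [← ofReal_integral_eq_lintegral_ofReal hint (ae_of_all _ hnn), hout]
  have hBl : ∫⁻ z, ‖b z‖ₑ ^ 2 ∂μ = ENNReal.ofReal B := by
    rw [hB, ofReal_integral_eq_lintegral_ofReal hsq (ae_of_all _ fun z' => by positivity)]
    refine lintegral_congr fun z' => ?_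
    rw [ENNReal.ofReal_pow (norm_nonneg _), ofReal_norm]
  have h0 : 0 ≤ 2 * B - 2 * ‖m‖ ^ 2 := by
    rw [← hout]
    exact integral_nonneg hnn
  rw [hBl, ← ofReal_norm, ← ENNReal.ofReal_pow (norm_nonneg _), ← ENNReal.ofReal_ofNat 2,
    ← ENNReal.ofReal_mul zero_le_two, ← ENNReal.ofReal_mul zero_le_two,
    ← ENNReal.ofReal_add h0 (by positivity)]
  congr 1
  ring

/-- The energy identity for one step of the Poisson semigroup. -/
lemma lintegral_pconv_sq_add {b : Rn n → E} (hb : StronglyMeasurable b) {M : ℝ}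
    (hM : ∀ z, ‖b z‖ ≤ M) {δ : ℝ} (hδ : 0 < δ) :
    (∫⁻ z, ∫⁻ z', epker (2 * δ) (z - z') * ‖b z - b z'‖ₑ ^ 2) + 2 * ∫⁻ x, ‖pconv δ b x‖ₑ ^ 2 =
      2 * ∫⁻ x, ‖b x‖ₑ ^ 2 := by
  have hbm : Measurable fun z => ‖b z‖ₑ := hb.enorm
  have hbb : Measurable fun p : Rn n × Rn n => ‖b p.1 - b p.2‖ₑ :=
    ((hb.comp_measurable measurable_fst).sub (hb.comp_measurable measurable_snd)).enorm
  have hpm : Measurable fun x => ‖pconv δ b x‖ₑ := by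
    refine StronglyMeasurable.enorm ?_
    unfold pconv
    apply StronglyMeasurable.integral_prod_right
    exact (Measurable.stronglyMeasurable (by fun_prop)).smul (hb.comp_measurable measurable_snd)
  have hpt : ∀ x, (∫⁻ z, epker δ (x - z) * ∫⁻ z', epker δ (x - z') * ‖b z - b z'‖ₑ ^ 2) +
      2 * ‖pconv δ b x‖ₑ ^ 2 = 2 * ∫⁻ z, epker δ (x - z) * ‖b z‖ₑ ^ 2 := by
    intro x
    have hk : Measurable fun z => epker δ (x - z) := by fun_prop
    have hprob : IsProbabilityMeasure (volume.withDensity fun z => epker δ (x - z)) := by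
      refine ⟨?_⟩
      rw [withDensity_apply _ MeasurableSet.univ, Measure.restrict_univ, lintegral_epker_sub hδ]
    have h := lintegral_lintegral_enorm_sub_sq (volume.withDensity fun z => epker δ (x - z)) hb hM
    have hin : ∀ z, ∫⁻ z', ‖b z - b z'‖ₑ ^ 2 ∂(volume.withDensity fun z => epker δ (x - z)) =
        ∫⁻ z', epker δ (x - z') * ‖b z - b z'‖ₑ ^ 2 := by
      intro z
      have hbz : Measurable fun z' => ‖b z - b z'‖ₑ ^ 2 :=
        (stronglyMeasurable_const.sub hb).enorm.pow_const 2
      rw [lintegral_withDensity_eq_lintegral_mul _ hk hbz]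
      rfl
    have hinm : Measurable fun z => ∫⁻ z', epker δ (x - z') * ‖b z - b z'‖ₑ ^ 2 := by
      apply Measurable.lintegral_prod_right
      exact Measurable.mul (by fun_prop) (hbb.pow_const 2)
    simp only [hin] at h
    rw [lintegral_withDensity_eq_lintegral_mul _ hk hinm,
      lintegral_withDensity_eq_lintegral_mul _ hk (hbm.pow_const 2),
      integral_withDensity_eq_integral_toReal_smul hk
        (ae_of_all _ fun z => epker_lt_top _ _)] at h
    have hp : pconv δ b x = ∫ z, (epker δ (x - z)).toReal • b z := by
      unfold pconv
      refine integral_congr_ae (ae_of_all _ fun z => ?_)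
      simp only [epker, ENNReal.toReal_ofReal (pker_nonneg _ _)]
    rw [hp]
    exact h
  have hK : Measurable fun p : (Rn n × Rn n) × Rn n =>
      epker δ (p.1.1 - p.1.2) * (epker δ (p.1.1 - p.2) * ‖b p.1.2 - b p.2‖ₑ ^ 2) := by
    have : Measurable fun p : (Rn n × Rn n) × Rn n => ‖b p.1.2 - b p.2‖ₑ :=
      hbb.comp (g := fun p : Rn n × Rn n => ‖b p.1 - b p.2‖ₑ)
        (by fun_prop : Measurable fun p : (Rn n × Rn n) × Rn n => (p.1.2, p.2))
    exact Measurable.mul (by fun_prop) (Measurable.mul (by fun_prop) (this.pow_const 2))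
  have hsum := lintegral_congr (μ := (volume : Measure (Rn n))) hpt
  rw [lintegral_add_right _ ((hpm.pow_const 2).const_mul 2), lintegral_const_mul _ (hpm.pow_const 2),
    lintegral_const_mul'] at hsum
  swap
  · exact ENNReal.ofNat_ne_top
  have hR : ∫⁻ x, ∫⁻ z, epker δ (x - z) * ‖b z‖ₑ ^ 2 = ∫⁻ z, ‖b z‖ₑ ^ 2 := by
    rw [lintegral_lintegral_swap]
    · refine lintegral_congr fun z => ?_
      rw [lintegral_mul_const _ (by fun_prop), lintegral_sub_right_eq_self (fun x => epker δ x) z,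
        lintegral_epker hδ, one_mul]
    · exact Measurable.aemeasurable (Measurable.mul (by fun_prop)
        ((hbm.comp measurable_snd).pow_const 2))
  have hL : ∫⁻ x, ∫⁻ z, epker δ (x - z) * ∫⁻ z', epker δ (x - z') * ‖b z - b z'‖ₑ ^ 2 =
      ∫⁻ z, ∫⁻ z', epker (2 * δ) (z - z') * ‖b z - b z'‖ₑ ^ 2 := by
    have h1 : ∀ x z, epker δ (x - z) * ∫⁻ z', epker δ (x - z') * ‖b z - b z'‖ₑ ^ 2 =
        ∫⁻ z', epker δ (x - z) * (epker δ (x - z') * ‖b z - b z'‖ₑ ^ 2) := by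
      intro x z
      rw [lintegral_const_mul']
      exact (epker_lt_top _ _).ne
    simp only [h1]
    rw [lintegral_lintegral_swap hK.lintegral_prod_right'.aemeasurable]
    refine lintegral_congr fun z => ?_
    rw [lintegral_lintegral_swap]
    · refine lintegral_congr_ae ?_
      filter_upwards [ae_lintegral_epker_mul_epker hδ hδ z] with z' hz'
      have h2 : ∀ x, epker δ (x - z) * (epker δ (x - z') * ‖b z - b z'‖ₑ ^ 2) =
          (epker δ (z - x) * epker δ (x - z')) * ‖b z - b z'‖ₑ ^ 2 := by
        intro x
        rw [epker_sub_comm δ x z, mul_assoc]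
      simp only [h2]
      rw [lintegral_mul_const _ (by fun_prop), hz', two_mul]
    · exact (hK.comp (by fun_prop : Measurable fun p : Rn n × Rn n => ((p.1, z), p.2))).aemeasurable
  rw [hL, hR] at hsum
  exact hsum

/-- As `ε → 0`, the rescaled kernels `p_ε / ε` converge off the origin to the kernel of `|d_{1/2} ·|²`. -/
lemma epker_div_tendsto {h : Rn n} (hh : h ≠ 0) :
    Filter.Tendsto (fun ε : ℝ => pker ε h / ε) (nhdsWithin 0 (Ioi 0))
      (nhds (gammaConst n / ‖h‖ ^ (n + 1))) := by
  have hpos : 0 < ‖h‖ := norm_pos_iff.2 hh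
  have h1 : Filter.Tendsto (fun ε : ℝ => gammaConst n / (ε ^ 2 + ‖h‖ ^ 2) ^ (((n : ℝ) + 1) / 2))
      (nhdsWithin 0 (Ioi 0))
      (nhds (gammaConst n / ((0 : ℝ) ^ 2 + ‖h‖ ^ 2) ^ (((n : ℝ) + 1) / 2))) := by
    refine tendsto_nhdsWithin_of_tendsto_nhds (ContinuousAt.tendsto ?_)
    refine continuousAt_const.div ?_ (by positivity)
    exact ContinuousAt.rpow_const (by fun_prop) (Or.inl (by positivity))
  have h2 : ((0 : ℝ) ^ 2 + ‖h‖ ^ 2) ^ (((n : ℝ) + 1) / 2) = ‖h‖ ^ (n + 1) := by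
    rw [zero_pow two_ne_zero, zero_add, ← Real.rpow_natCast ‖h‖ 2, ← Real.rpow_mul hpos.le,
      ← Real.rpow_natCast]
    congr 1
    push_cast
    ring
  rw [h2] at h1
  refine h1.congr' ?_
  filter_upwards [self_mem_nhdsWithin] with ε hε
  rw [pker_of_pos hε]
  have : ε ≠ 0 := ne_of_gt hε
  field_simp

omit [CompleteSpace E] in
lemma enorm_sq_add_le {p r : E} : ‖p + r‖ₑ ^ 2 ≤ ‖p‖ₑ ^ 2 + 2 * (‖p + r‖ₑ * ‖r‖ₑ) := by
  have h : ‖p + r‖ ^ 2 ≤ ‖p‖ ^ 2 + 2 * (‖p + r‖ * ‖r‖) := by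
    have h1 : ‖p‖ ^ 2 = ‖p + r‖ ^ 2 - 2 * inner ℝ (p + r) r + ‖r‖ ^ 2 := by
      rw [← norm_sub_sq_real, add_sub_cancel_right]
    have h2 := real_inner_le_norm (p + r) r
    nlinarith [sq_nonneg ‖r‖]
  simp only [← ofReal_norm]
  rw [← ENNReal.ofReal_pow (norm_nonneg _), ← ENNReal.ofReal_pow (norm_nonneg _),
    ← ENNReal.ofReal_mul (norm_nonneg _), ← ENNReal.ofReal_ofNat 2,
    ← ENNReal.ofReal_mul zero_le_two, ← ENNReal.ofReal_add (by positivity) (by positivity)]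
  exact ENNReal.ofReal_le_ofReal h

/-- One step of the energy balance for `u = dPot g`: dissipation against work done by the sources
in `[t, t + δ)`. -/
lemma energy_step {g : Rn n × ℝ → E} (hg : StronglyMeasurable g) {M : ℝ}
    (hM : ∀ x t, eDPot (fun w => ‖g w‖ₑ) x t ≤ ENNReal.ofReal M) {δ : ℝ} (hδ : 0 < δ) (t : ℝ) :
    (∫⁻ z, ∫⁻ z', epker (2 * δ) (z - z') * ‖dPot g z t - dPot g z' t‖ₑ ^ 2) +
        2 * ∫⁻ x, ‖dPot g x (t + δ)‖ₑ ^ 2 ≤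
      2 * (∫⁻ x, ‖dPot g x t‖ₑ ^ 2) +
        4 * ENNReal.ofReal M * ∫⁻ w, timeCut (Ico t (t + δ)) (fun w => ‖g w‖ₑ) w := by
  have hgm : Measurable fun w => ‖g w‖ₑ := hg.enorm
  have hM' : ∀ x t, ‖dPot g x t‖ₑ ≤ ENNReal.ofReal M := fun x t =>
    (enorm_dPot_le g x t).trans (hM x t)
  have hM0 : ∀ x t, ‖dPot g x t‖ ≤ max M 0 := by
    intro x t
    have := hM' x t
    rw [← ofReal_norm] at this
    rwa [ENNReal.ofReal_le_ofReal_iff', ← le_max_iff] at this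
  have hlt : ∀ x t, eDPot (fun w => ‖g w‖ₑ) x t < ⊤ := fun x t =>
    (hM x t).trans_lt ENNReal.ofReal_lt_top
  have hid := lintegral_pconv_sq_add (stronglyMeasurable_dPot_left hg t) (fun x => hM0 x t) hδ
  set p : Rn n → E := pconv δ fun z => dPot g z t with hp
  set r : Rn n → E := fun x => dPot (timeCut (Ici t) g) x (t + δ) with hr
  have hsplit : ∀ x, dPot g x (t + δ) = p x + r x := by
    intro x
    have h1 := dPot_eq_pconv_add hg (lt_add_of_pos_right t hδ) (hlt x (t + δ))
    rwa [add_sub_cancel_left] at h1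
  have hrm : StronglyMeasurable r :=
    stronglyMeasurable_dPot_left (stronglyMeasurable_timeCut measurableSet_Ici hg) _
  have hpm : StronglyMeasurable p := by
    have : p = fun x => dPot g x (t + δ) - r x := by
      ext x
      rw [hsplit]
      simp
    rw [this]
    exact (stronglyMeasurable_dPot_left hg _).sub hrm
  have hrint : ∫⁻ x, ‖r x‖ₑ ≤ ∫⁻ w, timeCut (Ico t (t + δ)) (fun w => ‖g w‖ₑ) w := by
    calc ∫⁻ x, ‖r x‖ₑ ≤ ∫⁻ x, eDPot (fun w => ‖timeCut (Ici t) g w‖ₑ) x (t + δ) :=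
          lintegral_mono fun x => enorm_dPot_le _ _ _
      _ = ∫⁻ w, timeCut (Iio (t + δ)) (fun w => ‖timeCut (Ici t) g w‖ₑ) w :=
          lintegral_eDPot (stronglyMeasurable_timeCut measurableSet_Ici hg).enorm _
      _ ≤ _ := by
          refine lintegral_mono fun w => ?_
          by_cases h1 : w.2 ∈ Ici t
          · by_cases h2 : w.2 ∈ Iio (t + δ)
            · rw [timeCut_of_mem h2, timeCut_of_mem h1, timeCut_of_mem (S := Ico _ _) ⟨h1, h2⟩]
            · rw [timeCut_of_notMem h2]
              exact zero_le
          · refine (timeCut_le _ _ _).trans ?_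
            rw [timeCut_of_notMem h1, enorm_zero]
            exact zero_le
  have hnext : ∫⁻ x, ‖dPot g x (t + δ)‖ₑ ^ 2 ≤ (∫⁻ x, ‖p x‖ₑ ^ 2) +
      2 * ENNReal.ofReal M * ∫⁻ w, timeCut (Ico t (t + δ)) (fun w => ‖g w‖ₑ) w := by
    calc ∫⁻ x, ‖dPot g x (t + δ)‖ₑ ^ 2
        ≤ ∫⁻ x, (‖p x‖ₑ ^ 2 + 2 * ENNReal.ofReal M * ‖r x‖ₑ) := by
          refine lintegral_mono fun x => ?_
          have h1 := enorm_sq_add_le (p := p x) (r := r x)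
          rw [← hsplit] at h1
          refine h1.trans ?_
          rw [mul_assoc]
          have := hM' x (t + δ)
          gcongr
      _ = (∫⁻ x, ‖p x‖ₑ ^ 2) + 2 * ENNReal.ofReal M * ∫⁻ x, ‖r x‖ₑ := by
          rw [lintegral_add_left (hpm.enorm.pow_const 2), lintegral_const_mul _ hrm.enorm]
      _ ≤ _ := by gcongr
  calc _ ≤ (∫⁻ z, ∫⁻ z', epker (2 * δ) (z - z') * ‖dPot g z t - dPot g z' t‖ₑ ^ 2) +
        2 * ((∫⁻ x, ‖p x‖ₑ ^ 2) +
      2 * ENNReal.ofReal M * ∫⁻ w, timeCut (Ico t (t + δ)) (fun w => ‖g w‖ₑ) w) := by gcongr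
    _ = ((∫⁻ z, ∫⁻ z', epker (2 * δ) (z - z') * ‖dPot g z t - dPot g z' t‖ₑ ^ 2) +
        2 * ∫⁻ x, ‖p x‖ₑ ^ 2) +
      4 * ENNReal.ofReal M * ∫⁻ w, timeCut (Ico t (t + δ)) (fun w => ‖g w‖ₑ) w := by ring
    _ = _ := by rw [hid]

/-- The approximate dissipation at scale `δ`, integrated over time. -/
lemma lintegral_dissipation_le {g : Rn n × ℝ → E} (hg : StronglyMeasurable g)
    (hg0 : ∀ w : Rn n × ℝ, w.2 ≤ 0 → g w = 0) {M : ℝ}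
    (hM : ∀ x t, eDPot (fun w => ‖g w‖ₑ) x t ≤ ENNReal.ofReal M)
    (hA : ∫⁻ w, ‖g w‖ₑ < ⊤) {δ R : ℝ} (hδ : 0 < δ) :
    ∫⁻ t in Ioo 0 R, ∫⁻ z, ∫⁻ z', epker (2 * δ) (z - z') * ‖dPot g z t - dPot g z' t‖ₑ ^ 2 ≤
      6 * ENNReal.ofReal δ * (ENNReal.ofReal M * ∫⁻ w, ‖g w‖ₑ) := by
  set A := ∫⁻ w, ‖g w‖ₑ with hAdef
  have hgm : Measurable fun w => ‖g w‖ₑ := hg.enorm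
  have hum : Measurable fun z : Rn n × ℝ => ‖dPot g z.1 z.2‖ₑ := (stronglyMeasurable_dPot hg).enorm
  set S : ℝ → ℝ≥0∞ := fun t => ∫⁻ x, ‖dPot g x t‖ₑ ^ 2 with hS
  have hSm : Measurable S := Measurable.lintegral_prod_left (f := fun x t =>
    ‖dPot g x t‖ₑ ^ 2) (hum.pow_const 2)
  have hSle : ∀ t, S t ≤ ENNReal.ofReal M * A := by
    intro t
    calc S t ≤ ∫⁻ x, ENNReal.ofReal M * eDPot (fun w => ‖g w‖ₑ) x t := by
          refine lintegral_mono fun x => ?_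
          rw [sq]
          exact mul_le_mul' ((enorm_dPot_le g x t).trans (hM x t)) (enorm_dPot_le g x t)
      _ = ENNReal.ofReal M * ∫⁻ w, timeCut (Iio t) (fun w => ‖g w‖ₑ) w := by
          rw [lintegral_const_mul' _ _ ENNReal.ofReal_ne_top, lintegral_eDPot hgm]
      _ ≤ _ := by
          gcongr
          exact lintegral_mono fun w => timeCut_le _ _ _
  have hstep := fun t => energy_step hg hM hδ t
  set a : ℝ → ℝ≥0∞ := fun t => ∫⁻ w, timeCut (Ico t (t + δ)) (fun w => ‖g w‖ₑ) w with ha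
  have hcutm : Measurable fun p : ℝ × (Rn n × ℝ) =>
      timeCut (Ico p.1 (p.1 + δ)) (fun w => ‖g w‖ₑ) p.2 := by
    have : (fun p : ℝ × (Rn n × ℝ) => timeCut (Ico p.1 (p.1 + δ)) (fun w => ‖g w‖ₑ) p.2) =
        {p : ℝ × (Rn n × ℝ) | p.1 ≤ p.2.2 ∧ p.2.2 < p.1 + δ}.indicator fun p => ‖g p.2‖ₑ := by
      ext p
      simp only [timeCut, indicator, mem_preimage, mem_Ico, mem_ofPred_eq]
    rw [this]
    refine Measurable.indicator (hgm.comp measurable_snd) ?_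
    have h1 : Measurable fun p : ℝ × (Rn n × ℝ) => p.1 := measurable_fst
    have h2 : Measurable fun p : ℝ × (Rn n × ℝ) => p.2.2 := by fun_prop
    exact (measurableSet_le h1 h2).inter (measurableSet_lt h2 (h1.add_const δ))
  have ham : Measurable a := hcutm.lintegral_prod_right'
  have haint : ∫⁻ t in Ioo 0 R, a t ≤ ENNReal.ofReal δ * A := by
    calc ∫⁻ t in Ioo 0 R, a t ≤ ∫⁻ t, a t := setLIntegral_le_lintegral _ _
      _ = ∫⁻ w, ∫⁻ t, timeCut (Ico t (t + δ)) (fun w => ‖g w‖ₑ) w :=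
          lintegral_lintegral_swap hcutm.aemeasurable
      _ = ∫⁻ w, ENNReal.ofReal δ * ‖g w‖ₑ := by
          refine lintegral_congr fun w => ?_
          have : ∀ t, timeCut (Ico t (t + δ)) (fun w => ‖g w‖ₑ) w =
              (Ioc (w.2 - δ) w.2).indicator (fun _ => ‖g w‖ₑ) t := by
            intro t
            simp only [timeCut, indicator, mem_preimage, mem_Ico, mem_Ioc]
            congr 1
            apply propext
            constructor <;> rintro ⟨h1, h2⟩ <;> constructor <;> linarith
          simp only [this]
          rw [lintegral_indicator_const measurableSet_Ioc, Real.volume_Ioc, mul_comm]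
          congr 2
          ring
      _ = _ := lintegral_const_mul _ hgm
  have hS0 : ∀ t ≤ 0, S t = 0 := by
    intro t ht
    have : ∀ x, dPot g x t = 0 := by
      intro x
      have h1 : dPot g x t = dPot (fun _ => (0 : E)) x t :=
        dPot_congr fun w hw => hg0 w (hw.le.trans ht)
      rw [h1]
      simp [dPot]
    simp [hS, this]
  have hfin : ∀ u v : ℝ, ∫⁻ t in Ioo u v, S t < ⊤ := by
    intro u v
    refine (setLIntegral_mono measurable_const fun t _ => hSle t).trans_lt ?_
    rw [setLIntegral_const, Real.volume_Ioo]
    exact ENNReal.mul_lt_top (ENNReal.mul_lt_top ENNReal.ofReal_lt_top hA) ENNReal.ofReal_lt_top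
  have hshift : ∫⁻ t in Ioo 0 R, S (t + δ) = ∫⁻ t in Ioo δ (R + δ), S t := by
    rw [← lintegral_indicator measurableSet_Ioo, ← lintegral_indicator measurableSet_Ioo,
      ← lintegral_add_right_eq_self ((Ioo δ (R + δ)).indicator fun t => S t) δ]
    refine lintegral_congr fun t => ?_
    simp only [indicator, mem_Ioo]
    congr 1
    apply propext
    constructor <;> rintro ⟨h1, h2⟩ <;> constructor <;> linarith
  have hover : ∫⁻ t in Ioo 0 R, S t ≤
      ENNReal.ofReal δ * (ENNReal.ofReal M * A) + ∫⁻ t in Ioo δ (R + δ), S t := by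
    calc ∫⁻ t in Ioo 0 R, S t ≤ ∫⁻ t in Ioc 0 δ ∪ Ioo δ (R + δ), S t := by
          refine lintegral_mono_set fun t ht => ?_
          rcases le_or_gt t δ with h | h
          · exact Or.inl ⟨ht.1, h⟩
          · exact Or.inr ⟨h, by linarith [ht.2]⟩
      _ ≤ (∫⁻ t in Ioc 0 δ, S t) + ∫⁻ t in Ioo δ (R + δ), S t := lintegral_union_le _ _ _
      _ ≤ _ := by
          gcongr
          refine (setLIntegral_mono measurable_const fun t _ => hSle t).trans (le_of_eq ?_)
          rw [setLIntegral_const, Real.volume_Ioc, sub_zero, mul_comm]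
  set D : ℝ → ℝ≥0∞ := fun t =>
    ∫⁻ z, ∫⁻ z', epker (2 * δ) (z - z') * ‖dPot g z t - dPot g z' t‖ₑ ^ 2 with hD
  have hSm2 : Measurable fun t => 2 * S (t + δ) := (hSm.comp (by fun_prop)).const_mul 2
  have htot : (∫⁻ t in Ioo 0 R, D t) + 2 * ∫⁻ t in Ioo δ (R + δ), S t ≤
      2 * (∫⁻ t in Ioo 0 R, S t) + 4 * ENNReal.ofReal M * ∫⁻ t in Ioo 0 R, a t := by
    have hSm1 : Measurable fun t => S (t + δ) := hSm.comp (by fun_prop)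
    rw [← hshift, ← lintegral_const_mul _ hSm1,
      ← lintegral_const_mul _ hSm, ← lintegral_const_mul _ ham,
      ← lintegral_add_right _ hSm2, ← lintegral_add_right _ (ham.const_mul _)]
    exact lintegral_mono fun t => hstep t
  have hcancel : (∫⁻ t in Ioo 0 R, D t) + 2 * ∫⁻ t in Ioo δ (R + δ), S t ≤
      6 * ENNReal.ofReal δ * (ENNReal.ofReal M * A) + 2 * ∫⁻ t in Ioo δ (R + δ), S t := by
    calc _ ≤ 2 * (ENNReal.ofReal δ * (ENNReal.ofReal M * A) + ∫⁻ t in Ioo δ (R + δ), S t) +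
          4 * ENNReal.ofReal M * (ENNReal.ofReal δ * A) := htot.trans (by gcongr)
      _ = _ := by ring
  exact (ENNReal.add_le_add_iff_right
    (ENNReal.mul_lt_top ENNReal.ofNat_lt_top (hfin _ _)).ne).1 hcancel

/-- The energy inequality: a Duhamel potential with integrable sources that is bounded has its
dissipation `∬ |d_{1/2} u|²` controlled by `sup |u|` times the total mass of the sources. -/
lemma lintegral_odSq_fracGrad_dPot_le {g : Rn n × ℝ → E} (hg : StronglyMeasurable g)
    (hg0 : ∀ w : Rn n × ℝ, w.2 ≤ 0 → g w = 0) {M : ℝ}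
    (hM : ∀ x t, eDPot (fun w => ‖g w‖ₑ) x t ≤ ENNReal.ofReal M) (R : ℝ) :
    ∫⁻ t in Ioo 0 R, ∫⁻ x, odSq (fracGrad fun y => dPot g y t) x ≤
      2 * (ENNReal.ofReal M * ∫⁻ w, ‖g w‖ₑ) := by
  rcases eq_or_ne (∫⁻ w, ‖g w‖ₑ) ⊤ with hA | hA
  · rcases eq_or_ne (ENNReal.ofReal M) 0 with hM0 | hM0
    · have : ∀ x t, dPot g x t = 0 := by
        intro x t
        have h1 := (enorm_dPot_le g x t).trans (hM x t)
        rw [hM0] at h1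
        simpa using h1
      simp [odSq_fracGrad, this]
    · rw [hA, ENNReal.mul_top hM0]
      simp
  have hA' : ∫⁻ w, ‖g w‖ₑ < ⊤ := hA.lt_top
  set ε : ℕ → ℝ := fun k => 1 / ((k : ℝ) + 1) with hε
  have hεpos : ∀ k, 0 < ε k := fun k => by positivity
  have hεlim : Filter.Tendsto ε Filter.atTop (nhdsWithin 0 (Ioi 0)) :=
    tendsto_nhdsWithin_iff.2 ⟨tendsto_one_div_add_atTop_nhds_zero_nat,
      Filter.Eventually.of_forall hεpos⟩
  have hdm : Measurable fun p : (ℝ × Rn n) × Rn n =>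
      ‖dPot g p.1.2 p.1.1 - dPot g p.2 p.1.1‖ₑ ^ 2 := by
    have h1 : StronglyMeasurable fun p : (ℝ × Rn n) × Rn n => dPot g p.1.2 p.1.1 :=
      (stronglyMeasurable_dPot hg).comp_measurable
        (g := fun p : (ℝ × Rn n) × Rn n => (p.1.2, p.1.1)) (by fun_prop)
    have h2 : StronglyMeasurable fun p : (ℝ × Rn n) × Rn n => dPot g p.2 p.1.1 :=
      (stronglyMeasurable_dPot hg).comp_measurable
        (g := fun p : (ℝ × Rn n) × Rn n => (p.2, p.1.1)) (by fun_prop)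
    exact (h1.sub h2).enorm.pow_const 2
  set Φ : ℕ → (ℝ × Rn n) × Rn n → ℝ≥0∞ := fun k p =>
    ENNReal.ofReal (pker (ε k) (p.1.2 - p.2) / ε k / 2) *
      ‖dPot g p.1.2 p.1.1 - dPot g p.2 p.1.1‖ₑ ^ 2 with hΦ
  have hΦm : ∀ k, Measurable (Φ k) := fun k => Measurable.mul (by fun_prop) hdm
  set Ψ : (ℝ × Rn n) × Rn n → ℝ≥0∞ := fun p => ENNReal.ofReal (gammaConst n / 2) *
    (‖dPot g p.1.2 p.1.1 - dPot g p.2 p.1.1‖ₑ ^ 2 / ‖p.1.2 - p.2‖ₑ ^ (n + 1)) with hΨ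
  -- `Ψ` integrates to the dissipation; by `epker_div_tendsto` it is the limit of the approximate
  -- dissipations `Φ k`, to which Fatou's lemma is applied
  have hlim : ∀ p, Ψ p ≤ Filter.liminf (fun k => Φ k p) Filter.atTop := by
    intro p
    by_cases hp : p.1.2 = p.2
    · have : Ψ p = 0 := by simp [hΨ, hp]
      rw [this]
      exact zero_le
    · have hne : p.1.2 - p.2 ≠ 0 := sub_ne_zero.2 hp
      have hpos : 0 < ‖p.1.2 - p.2‖ := norm_pos_iff.2 hne
      have h1 := ((epker_div_tendsto hne).comp hεlim).div_const 2
      have h2 := ENNReal.Tendsto.mul_const (b := ‖dPot g p.1.2 p.1.1 - dPot g p.2 p.1.1‖ₑ ^ 2)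
        (ENNReal.tendsto_ofReal h1) (Or.inr (ENNReal.pow_ne_top enorm_ne_top))
      have h3 : Filter.Tendsto (fun k => Φ k p) Filter.atTop (nhds (Ψ p)) := by
        convert! h2 using 2
        rw [hΨ]
        simp only
        have h4 : gammaConst n / ‖p.1.2 - p.2‖ ^ (n + 1) / 2 =
            gammaConst n / 2 / ‖p.1.2 - p.2‖ ^ (n + 1) := by ring
        rw [h4, ENNReal.ofReal_div_of_pos (pow_pos hpos _), ENNReal.ofReal_pow (norm_nonneg _),
          ofReal_norm, ENNReal.div_eq_inv_mul, ENNReal.div_eq_inv_mul]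
        ring
      rw [h3.liminf_eq]
  have hk : ∀ k, ∫⁻ t in Ioo 0 R, ∫⁻ x, ∫⁻ y, Φ k ((t, x), y) ≤
      2 * (ENNReal.ofReal M * ∫⁻ w, ‖g w‖ₑ) := by
    intro k
    have hd := lintegral_dissipation_le hg hg0 hM hA' (half_pos (hεpos k)) (R := R)
    have h2 : 2 * (ε k / 2) = ε k := by ring
    rw [h2] at hd
    have hc : ∀ t x y, Φ k ((t, x), y) = ENNReal.ofReal (1 / ε k / 2) *
        (epker (ε k) (x - y) * ‖dPot g x t - dPot g y t‖ₑ ^ 2) := by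
      intro t x y
      have h3 : pker (ε k) (x - y) / ε k / 2 = 1 / ε k / 2 * pker (ε k) (x - y) := by ring
      rw [← mul_assoc, epker, ← ENNReal.ofReal_mul (by have := hεpos k; positivity), ← h3]
    simp only [hc]
    have hc2 : ENNReal.ofReal (1 / ε k / 2) ≠ ⊤ := ENNReal.ofReal_ne_top
    simp only [lintegral_const_mul' _ _ hc2]
    calc _ ≤ ENNReal.ofReal (1 / ε k / 2) *
          (6 * ENNReal.ofReal (ε k / 2) * (ENNReal.ofReal M * ∫⁻ w, ‖g w‖ₑ)) := by gcongr
      _ = ENNReal.ofReal (1 / ε k / 2) * (6 * ENNReal.ofReal (ε k / 2)) *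
          (ENNReal.ofReal M * ∫⁻ w, ‖g w‖ₑ) := by rw [← mul_assoc]
      _ ≤ _ := by
        gcongr
        have := hεpos k
        rw [← ENNReal.ofReal_ofNat 6, ← ENNReal.ofReal_mul (by norm_num),
          ← ENNReal.ofReal_mul (by positivity), ← ENNReal.ofReal_ofNat 2]
        apply ENNReal.ofReal_le_ofReal
        have : 1 / ε k / 2 * (6 * (ε k / 2)) = 3 / 2 := by
          field_simp
          norm_num
        rw [this]
        norm_num
  set ν : Measure ((ℝ × Rn n) × Rn n) :=
    ((volume.restrict (Ioo 0 R)).prod volume).prod volume with hν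
  have hprod : ∀ f : (ℝ × Rn n) × Rn n → ℝ≥0∞, Measurable f →
      ∫⁻ p, f p ∂ν = ∫⁻ t in Ioo 0 R, ∫⁻ x, ∫⁻ y, f ((t, x), y) := by
    intro f hf
    rw [hν, lintegral_prod _ hf.aemeasurable, lintegral_prod _ hf.lintegral_prod_right'.aemeasurable]
  have hΨm : Measurable Ψ := (hdm.div (by fun_prop)).const_mul _
  have hgoal : ∫⁻ t in Ioo 0 R, ∫⁻ x, odSq (fracGrad fun y => dPot g y t) x = ∫⁻ p, Ψ p ∂ν := by
    rw [hprod _ hΨm]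
    simp only [odSq_fracGrad, hΨ]
    refine lintegral_congr fun t => lintegral_congr fun x => ?_
    rw [lintegral_const_mul' _ _ ENNReal.ofReal_ne_top]
  rw [hgoal]
  calc ∫⁻ p, Ψ p ∂ν ≤ ∫⁻ p, Filter.liminf (fun k => Φ k p) Filter.atTop ∂ν := lintegral_mono hlim
    _ ≤ Filter.liminf (fun k => ∫⁻ p, Φ k p ∂ν) Filter.atTop := lintegral_liminf_le hΦm
    _ ≤ Filter.liminf (fun _ : ℕ => 2 * (ENNReal.ofReal M * ∫⁻ w, ‖g w‖ₑ)) Filter.atTop := by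
        refine Filter.liminf_le_liminf (Filter.Eventually.of_forall fun k => ?_)
        rw [hprod _ (hΦm k)]
        exact hk k
    _ = _ := Filter.liminf_const _

end Energy

/-! ### Size and regularity of Duhamel potentials -/

section Regularity
variable {E : Type*} [NormedAddCommGroup E] [NormedSpace ℝ E]

lemma lintegral_epker_sub_le (τ : ℝ) (x : Rn n) : ∫⁻ y : Rn n, epker τ (x - y) ≤ 1 := by
  rcases lt_or_ge 0 τ with h | h
  · rw [lintegral_epker_sub h]
  · simp [epker_of_nonpos h]

lemma eDPot_le_of_le_time {φ : Rn n × ℝ → ℝ≥0∞} {ψ : ℝ → ℝ≥0∞} (hψ : Measurable ψ)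
    (h : ∀ w, φ w ≤ ψ w.2) (x : Rn n) (t : ℝ) : eDPot φ x t ≤ ∫⁻ s in Iio t, ψ s := by
  calc eDPot φ x t ≤ eDPot (fun w => ψ w.2) x t := eDPot_mono fun w _ => h w
    _ = ∫⁻ s, ∫⁻ y, epker (t - s) (x - y) * ψ s :=
        eDPot_eq_lintegral (hψ.comp measurable_snd) x t
    _ ≤ ∫⁻ s, (Iio t).indicator ψ s := by
        refine lintegral_mono fun s => ?_
        rw [lintegral_mul_const _ (by fun_prop)]
        by_cases hs : s ∈ Iio t
        · rw [indicator_of_mem hs]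
          exact mul_le_of_le_one_left zero_le (lintegral_epker_sub_le _ _)
        · have : t - s ≤ 0 := sub_nonpos.2 (not_lt.1 hs)
          simp [epker_of_nonpos this]
    _ = _ := lintegral_indicator measurableSet_Iio _

/-- A potential bounded up to the last time at which its source acts is bounded forever. -/
lemma eDPot_le_of_le_upTo {φ : Rn n × ℝ → ℝ≥0∞} (hφ : Measurable φ) {R : ℝ} {M : ℝ≥0∞}
    (hR : ∀ w : Rn n × ℝ, R ≤ w.2 → φ w = 0) (h : ∀ x, ∀ t ≤ R, eDPot φ x t ≤ M) (x : Rn n) (t : ℝ) :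
    eDPot φ x t ≤ M := by
  rcases le_or_gt t R with ht | ht
  · exact h x t ht
  · have h1 := lintegral_epker_mul_eDPot hφ (sub_pos.2 ht) x R
    have h2 : timeCut (Iio R) φ = φ := by
      ext w
      by_cases hw : w.2 ∈ Iio R
      · rw [timeCut_of_mem hw]
      · rw [timeCut_of_notMem hw, hR w (not_lt.1 hw)]
    rw [h2, add_sub_cancel] at h1
    rw [← h1]
    calc ∫⁻ z, epker (t - R) (x - z) * eDPot φ z R ≤ ∫⁻ z, epker (t - R) (x - z) * M := by
          refine lintegral_mono fun z => ?_
          have := h z R le_rfl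
          gcongr
      _ ≤ M := by
          rw [lintegral_mul_const _ (by fun_prop)]
          exact mul_le_of_le_one_left zero_le (lintegral_epker_sub_le _ _)

lemma eDPot_le_of_bounded {φ : Rn n × ℝ → ℝ≥0∞} {c B : ℝ}
    (hc : ∀ w : Rn n × ℝ, w.2 < c → φ w = 0) (h : ∀ w, φ w ≤ ENNReal.ofReal B) (x : Rn n) (t : ℝ) :
    eDPot φ x t ≤ ENNReal.ofReal (B * max 0 (t - c)) := by
  refine (eDPot_le_of_le_time (ψ := (Ici c).indicator fun _ => ENNReal.ofReal B)
    (measurable_const.indicator measurableSet_Ici) (fun w => ?_) x t).trans ?_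
  · by_cases hw : w.2 ∈ Ici c
    · rw [indicator_of_mem hw]
      exact h w
    · rw [hc w (not_le.1 hw)]
      exact zero_le
  · rw [lintegral_indicator_const measurableSet_Ici, Measure.restrict_apply measurableSet_Ici,
      Ici_inter_Iio, Real.volume_Ico, ENNReal.ofReal_mul' (le_max_left _ _)]
    gcongr
    exact le_max_right _ _

lemma lintegral_rpow_neg_three_quarters {L : ℝ} (hL : 0 ≤ L) :
    ∫⁻ τ in Ioc 0 L, ENNReal.ofReal (τ ^ (-(3 / 4) : ℝ)) = ENNReal.ofReal (4 * L ^ (1 / 4 : ℝ)) := by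
  have h1 : IntervalIntegrable (fun τ : ℝ => τ ^ (-(3 / 4) : ℝ)) volume 0 L :=
    intervalIntegral.intervalIntegrable_rpow' (by norm_num)
  rw [← ofReal_integral_eq_lintegral_ofReal
    ((intervalIntegrable_iff_integrableOn_Ioc_of_le hL).1 h1)
    ((ae_restrict_iff' measurableSet_Ioc).2 (ae_of_all _ fun τ hτ => Real.rpow_nonneg hτ.1.le _)),
    ← intervalIntegral.integral_of_le hL, integral_rpow (Or.inl (by norm_num))]
  congr 1
  norm_num
  ring

/-- Hölder continuity in space, with exponent `3/4`, of the potential of a bounded source acting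
from time `c` on. -/
lemma norm_dPot_sub_le_of_bounded {g : Rn n × ℝ → E} (hg : StronglyMeasurable g) {c B : ℝ} (hB : 0 ≤ B)
    (hc : ∀ w : Rn n × ℝ, w.2 < c → g w = 0) (h : ∀ w, ‖g w‖ ≤ B) (x y : Rn n) {t : ℝ}
    (ht : c ≤ t) :
    ‖dPot g x t - dPot g y t‖ ≤
      4 * lipConst n * B * (‖x - y‖ ^ (3 / 4 : ℝ) * (t - c) ^ (1 / 4 : ℝ)) := by
  have hge : ∀ w, ‖g w‖ₑ ≤ ENNReal.ofReal B := fun w => by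
    rw [← ofReal_norm]
    exact ENNReal.ofReal_le_ofReal (h w)
  have hlt : ∀ x, eDPot (fun w => ‖g w‖ₑ) x t < ⊤ := fun x =>
    (eDPot_le_of_bounded (fun w hw => by rw [hc w hw, enorm_zero]) hge x t).trans_lt
      ENNReal.ofReal_lt_top
  have hlip := lipConst_ge_two n
  have hnn : 0 ≤ 4 * lipConst n * B * (‖x - y‖ ^ (3 / 4 : ℝ) * (t - c) ^ (1 / 4 : ℝ)) := by
    have : 0 ≤ t - c := sub_nonneg.2 ht
    positivity
  rw [← ENNReal.ofReal_le_ofReal_iff hnn, ofReal_norm]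
  unfold dPot
  rw [← integral_sub (integrable_dPot hg (hlt x)) (integrable_dPot hg (hlt y))]
  calc ‖∫ w : Rn n × ℝ, (pker (t - w.2) (x - w.1) • g w - pker (t - w.2) (y - w.1) • g w)‖ₑ
      ≤ ∫⁻ w : Rn n × ℝ, ‖pker (t - w.2) (x - w.1) - pker (t - w.2) (y - w.1)‖ₑ * ‖g w‖ₑ := by
        refine (enorm_integral_le_lintegral_enorm _).trans (le_of_eq ?_)
        refine lintegral_congr fun w => ?_
        rw [← sub_smul, enorm_smul]
    _ = ∫⁻ s, ∫⁻ z, ‖pker (t - s) (x - z) - pker (t - s) (y - z)‖ₑ * ‖g (z, s)‖ₑ := by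
        have hm : Measurable fun w : Rn n × ℝ =>
            ‖pker (t - w.2) (x - w.1) - pker (t - w.2) (y - w.1)‖ₑ * ‖g w‖ₑ :=
          Measurable.mul (by fun_prop) hg.enorm
        rw [Measure.volume_eq_prod, lintegral_prod_symm' _ hm]
    _ ≤ ∫⁻ s, (Ico c t).indicator (fun s => ENNReal.ofReal
          (lipConst n * B * ‖x - y‖ ^ (3 / 4 : ℝ)) * ENNReal.ofReal ((t - s) ^ (-(3 / 4) : ℝ))) s := by
        refine lintegral_mono fun s => ?_
        by_cases hs : s ∈ Ico c t
        · have hts : 0 < t - s := sub_pos.2 hs.2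
          rw [indicator_of_mem hs]
          calc ∫⁻ z, ‖pker (t - s) (x - z) - pker (t - s) (y - z)‖ₑ * ‖g (z, s)‖ₑ
              ≤ ∫⁻ z, ‖pker (t - s) (x - z) - pker (t - s) (y - z)‖ₑ * ENNReal.ofReal B := by
                refine lintegral_mono fun z => ?_
                have := hge (z, s)
                gcongr
            _ ≤ ENNReal.ofReal (lipConst n * min 1 (‖x - y‖ / (t - s))) * ENNReal.ofReal B := by
                rw [lintegral_mul_const _ (by fun_prop)]
                gcongr
                exact lintegral_enorm_pker_sub_le hts x y
            _ ≤ _ := by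
                rw [← ENNReal.ofReal_mul (by positivity), ← ENNReal.ofReal_mul (by positivity)]
                apply ENNReal.ofReal_le_ofReal
                have h1 : min 1 (‖x - y‖ / (t - s)) ≤ (‖x - y‖ / (t - s)) ^ (3 / 4 : ℝ) := by
                  have h0 : 0 ≤ ‖x - y‖ / (t - s) := by positivity
                  rcases le_total 1 (‖x - y‖ / (t - s)) with h1 | h1
                  · exact (min_le_left _ _).trans (Real.one_le_rpow h1 (by norm_num))
                  · refine (min_le_right _ _).trans ?_
                    exact Real.self_le_rpow_of_le_one h0 h1 (by norm_num)
                have h2 : (‖x - y‖ / (t - s)) ^ (3 / 4 : ℝ) =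
                    ‖x - y‖ ^ (3 / 4 : ℝ) * (t - s) ^ (-(3 / 4) : ℝ) := by
                  rw [Real.div_rpow (norm_nonneg _) hts.le, Real.rpow_neg hts.le]
                  rfl
                calc lipConst n * min 1 (‖x - y‖ / (t - s)) * B
                    ≤ lipConst n * (‖x - y‖ / (t - s)) ^ (3 / 4 : ℝ) * B := by gcongr
                  _ = _ := by
                    rw [h2]
                    ring
        · rw [indicator_of_notMem hs]
          rcases lt_or_ge s c with h1 | h1
          · have : ∀ z, g (z, s) = 0 := fun z => hc (z, s) h1
            simp [this]
          · have : t - s ≤ 0 := by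
              by_contra h2
              exact hs ⟨h1, by linarith⟩
            simp [pker_of_nonpos this]
    _ = ENNReal.ofReal (lipConst n * B * ‖x - y‖ ^ (3 / 4 : ℝ)) *
          ∫⁻ τ in Ioc 0 (t - c), ENNReal.ofReal (τ ^ (-(3 / 4) : ℝ)) := by
        rw [← lintegral_const_mul' _ _ ENNReal.ofReal_ne_top,
          ← lintegral_indicator measurableSet_Ioc, ← lintegral_sub_left_eq_self _ t]
        refine lintegral_congr fun s => ?_
        simp only [indicator, mem_Ico, mem_Ioc]
        rw [sub_sub_cancel]
        congr 1
        apply propext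
        constructor <;> rintro ⟨h1, h2⟩ <;> constructor <;> linarith
    _ = _ := by
        rw [lintegral_rpow_neg_three_quarters (sub_nonneg.2 ht), ← ENNReal.ofReal_mul (by positivity)]
        congr 1
        ring

lemma norm_pconv_sub_le {b : Rn n → E} {M : ℝ} (hM : ∀ z, ‖b z‖ ≤ M)
    (hb : StronglyMeasurable b) {τ : ℝ} (hτ : 0 < τ) (x y : Rn n) :
    ‖pconv τ b x - pconv τ b y‖ ≤ lipConst n * M * min 1 (‖x - y‖ / τ) := by
  have hM0 : 0 ≤ M := (norm_nonneg _).trans (hM 0)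
  have hbe : ∀ z, ‖b z‖ₑ ≤ ENNReal.ofReal M := fun z => by
    rw [← ofReal_norm]
    exact ENNReal.ofReal_le_ofReal (hM z)
  have hlt : ∀ x, ∫⁻ z, epker τ (x - z) * ‖b z‖ₑ < ⊤ := fun x => by
    calc ∫⁻ z, epker τ (x - z) * ‖b z‖ₑ ≤ ∫⁻ z, epker τ (x - z) * ENNReal.ofReal M := by
          refine lintegral_mono fun z => ?_
          have := hbe z
          gcongr
      _ = ENNReal.ofReal M := by
          rw [lintegral_mul_const _ (by fun_prop), lintegral_epker_sub hτ, one_mul]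
      _ < ⊤ := ENNReal.ofReal_lt_top
  have hlip := lipConst_ge_two n
  rw [← ENNReal.ofReal_le_ofReal_iff (by positivity), ofReal_norm]
  unfold pconv
  rw [← integral_sub (integrable_pconv hb (hlt x)) (integrable_pconv hb (hlt y))]
  calc ‖∫ z, (pker τ (x - z) • b z - pker τ (y - z) • b z)‖ₑ
      ≤ ∫⁻ z, ‖pker τ (x - z) - pker τ (y - z)‖ₑ * ‖b z‖ₑ := by
        refine (enorm_integral_le_lintegral_enorm _).trans (le_of_eq ?_)
        refine lintegral_congr fun z => ?_
        rw [← sub_smul, enorm_smul]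
    _ ≤ ∫⁻ z, ‖pker τ (x - z) - pker τ (y - z)‖ₑ * ENNReal.ofReal M := by
        refine lintegral_mono fun z => ?_
        have := hbe z
        gcongr
    _ ≤ ENNReal.ofReal (lipConst n * min 1 (‖x - y‖ / τ)) * ENNReal.ofReal M := by
        rw [lintegral_mul_const _ (by fun_prop)]
        gcongr
        exact lintegral_enorm_pker_sub_le hτ x y
    _ = _ := by
        rw [← ENNReal.ofReal_mul (by positivity)]
        congr 1
        ring

/-- The space derivative of `p_τ * b`, with the derivative on the kernel. -/
lemma hasFDerivAt_pconv {b : Rn n → E} (hb : StronglyMeasurable b) {M : ℝ} (hM : ∀ z, ‖b z‖ ≤ M)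
    {τ : ℝ} (hτ : 0 < τ) (x : Rn n) :
    HasFDerivAt (pconv τ b) (∫ z, (kgrad τ (x - z)).smulRight (b z)) x := by
  have hM0 : 0 ≤ M := (norm_nonneg _).trans (hM 0)
  have hkm : ∀ x : Rn n, AEStronglyMeasurable (fun z => (kgrad τ (x - z)).smulRight (b z)) volume := by
    intro x
    have h1 : StronglyMeasurable fun z => kgrad τ (x - z) :=
      ((continuous_kgrad hτ).comp (by fun_prop : Continuous fun z => x - z)).stronglyMeasurable
    exact ((ContinuousLinearMap.smulRightL ℝ (Rn n) E).aestronglyMeasurable_comp₂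
      h1.aestronglyMeasurable hb.aestronglyMeasurable)
  unfold pconv
  refine hasFDerivAt_integral_of_dominated_of_fderiv_le (s := Metric.ball x τ)
    (F := fun x z => pker τ (x - z) • b z) (F' := fun x z => (kgrad τ (x - z)).smulRight (b z))
    (bound := fun z => ((n : ℝ) + 1) / τ * 3 ^ (((n : ℝ) + 1) / 2) * M * pker τ (x - z))
    (Metric.ball_mem_nhds x hτ) ?_ ?_ (hkm x) ?_ ?_ ?_
  · refine Filter.Eventually.of_forall fun y => ?_
    exact (StronglyMeasurable.smul (Measurable.stronglyMeasurable (by fun_prop))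
      hb).aestronglyMeasurable
  · have hi : Integrable fun z => pker τ (x - z) := (integrable_pker τ).comp_sub_left x
    refine (hi.mul_const M).mono' ((StronglyMeasurable.smul (Measurable.stronglyMeasurable
      (by fun_prop)) hb).aestronglyMeasurable) (ae_of_all _ fun z => ?_)
    rw [norm_smul, Real.norm_of_nonneg (pker_nonneg _ _)]
    have := pker_nonneg τ (x - z)
    have := hM z
    gcongr
  · refine ae_of_all _ fun z y hy => ?_
    rw [ContinuousLinearMap.norm_smulRight_apply]
    have h1 := norm_kgrad_le hτ (y - z)
    have h2 : pker τ (y - z) ≤ 3 ^ (((n : ℝ) + 1) / 2) * pker τ (x - z) := by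
      refine pker_le_of_dist_le ?_
      rw [sub_sub_sub_cancel_right, ← dist_eq_norm]
      exact (Metric.mem_ball.1 hy).le
    have h3 := pker_nonneg τ (x - z)
    calc ‖kgrad τ (y - z)‖ * ‖b z‖
        ≤ ((n : ℝ) + 1) / τ * (3 ^ (((n : ℝ) + 1) / 2) * pker τ (x - z)) * M := by
          have := hM z
          gcongr
          exact h1.trans (by gcongr)
      _ = _ := by ring
  · exact ((integrable_pker τ).comp_sub_left x).const_mul _
  · refine ae_of_all _ fun z y _ => ?_
    have h1 : HasFDerivAt (fun y => pker τ (y - z)) (kgrad τ (y - z)) y := by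
      have := (hasFDerivAt_pker τ (y - z)).comp y ((hasFDerivAt_id y).sub_const z)
      simpa [Function.comp_def] using this
    exact h1.smul_const (b z)

/-- The derivative of `p_τ * b` at two points, in terms of the increments of `b`. -/
lemma enorm_fderiv_pconv_sub_le {b : Rn n → E} (hb : StronglyMeasurable b) {M : ℝ}
    (hM : ∀ z, ‖b z‖ ≤ M) {τ : ℝ} (hτ : 0 < τ) (x y : Rn n) :
    ‖(∫ z, (kgrad τ (x - z)).smulRight (b z)) - ∫ z, (kgrad τ (y - z)).smulRight (b z)‖ₑ ≤
      ∫⁻ h, ENNReal.ofReal (((n : ℝ) + 1) / τ) * epker τ h * ‖b (x - h) - b (y - h)‖ₑ := by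
  have hM0 : 0 ≤ M := (norm_nonneg _).trans (hM 0)
  have hswap : ∀ x : Rn n, ∫ z, (kgrad τ (x - z)).smulRight (b z) =
      ∫ h, (kgrad τ h).smulRight (b (x - h)) := by
    intro x
    rw [← integral_sub_left_eq_self _ _ x]
    simp only [sub_sub_cancel]
  have hbnd : ∀ h : Rn n, ‖kgrad τ h‖ ≤ ((n : ℝ) + 1) / τ * pker τ h := norm_kgrad_le hτ
  have hi : ∀ x : Rn n, Integrable fun h => (kgrad τ h).smulRight (b (x - h)) := by
    intro x
    have hm : AEStronglyMeasurable (fun h => (kgrad τ h).smulRight (b (x - h))) volume :=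
      ((ContinuousLinearMap.smulRightL ℝ (Rn n) E).aestronglyMeasurable_comp₂
        (continuous_kgrad hτ).aestronglyMeasurable
        (hb.comp_measurable (by fun_prop : Measurable fun h => x - h)).aestronglyMeasurable)
    refine (((integrable_pker τ).const_mul (((n : ℝ) + 1) / τ)).mul_const M).mono' hm
      (ae_of_all _ fun h => ?_)
    rw [ContinuousLinearMap.norm_smulRight_apply]
    have := hM (x - h)
    have := hbnd h
    have := pker_nonneg τ h
    gcongr
  rw [hswap, hswap, ← integral_sub (hi x) (hi y)]
  refine (enorm_integral_le_lintegral_enorm _).trans (lintegral_mono fun h => ?_)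
  have h1 : (kgrad τ h).smulRight (b (x - h)) - (kgrad τ h).smulRight (b (y - h)) =
      (kgrad τ h).smulRight (b (x - h) - b (y - h)) := by
    ext e
    simp [smul_sub]
  rw [h1, ← ofReal_norm, ContinuousLinearMap.norm_smulRight_apply,
    ENNReal.ofReal_mul (norm_nonneg _), ofReal_norm (b (x - h) - b (y - h))]
  gcongr
  rw [epker, ← ENNReal.ofReal_mul (by positivity)]
  exact ENNReal.ofReal_le_ofReal (hbnd h)

/-- The space derivative of `p_τ * b`, with the derivative on `b`. -/
lemma hasFDerivAt_pconv_of_hasFDerivAt {b : Rn n → E} (hb : StronglyMeasurable b) {M : ℝ}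
    (hM : ∀ z, ‖b z‖ ≤ M) {b' : Rn n → Rn n →L[ℝ] E} (hb' : ∀ z, HasFDerivAt b (b' z) z)
    (hb'm : StronglyMeasurable b') {M' : ℝ} (hM' : ∀ z, ‖b' z‖ ≤ M') (τ : ℝ) (x : Rn n) :
    HasFDerivAt (pconv τ b) (pconv τ b' x) x := by
  have hswap : ∀ {F : Type _} [NormedAddCommGroup F] [NormedSpace ℝ F] (b : Rn n → F),
      pconv τ b = fun x => ∫ h, pker τ h • b (x - h) := by
    intro F _ _ b
    ext x
    unfold pconv
    rw [← integral_sub_left_eq_self _ _ x]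
    simp only [sub_sub_cancel]
  rw [hswap b, hswap b']
  have hmeas : ∀ {F : Type _} [NormedAddCommGroup F] [NormedSpace ℝ F] {b : Rn n → F},
      StronglyMeasurable b → ∀ x, AEStronglyMeasurable (fun h => pker τ h • b (x - h)) volume := by
    intro F _ _ b hb x
    exact (StronglyMeasurable.smul (Measurable.stronglyMeasurable (by fun_prop))
      (hb.comp_measurable (by fun_prop))).aestronglyMeasurable
  refine hasFDerivAt_integral_of_dominated_of_fderiv_le (s := univ)
    (F := fun x h => pker τ h • b (x - h)) (F' := fun x h => pker τ h • b' (x - h))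
    (bound := fun h => pker τ h * M') Filter.univ_mem
    (Filter.Eventually.of_forall fun y => hmeas hb y) ?_ (hmeas hb'm x) ?_
    ((integrable_pker τ).mul_const _) ?_
  · refine ((integrable_pker τ).mul_const M).mono' (hmeas hb x) (ae_of_all _ fun h => ?_)
    rw [norm_smul, Real.norm_of_nonneg (pker_nonneg _ _)]
    have := pker_nonneg τ h
    have := hM (x - h)
    gcongr
  · refine ae_of_all _ fun h y _ => ?_
    rw [norm_smul, Real.norm_of_nonneg (pker_nonneg _ _)]
    have := pker_nonneg τ h
    have := hM' (y - h)
    gcongr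
  · refine ae_of_all _ fun h y _ => ?_
    have h1 : HasFDerivAt (fun y => b (y - h)) (b' (y - h)) y := by
      have := (hb' (y - h)).comp y ((hasFDerivAt_id y).sub_const h)
      simpa [Function.comp_def] using this
    exact h1.const_smul (pker τ h)

end Regularity

/-! ### Weak gradients of sources and classical gradients of their potentials -/

section Gradient
variable {m : ℕ}

instance instIsAddHaarMeasureSpaceTime : (volume : Measure (Rn n × ℝ)).IsAddHaarMeasure :=
  Measure.prod.instIsAddHaarMeasure volume volume

/-- The linear map `h ↦ ∑ⱼ hⱼ Vⱼ` with the partial derivatives `V`. -/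
def gradMap : GradVal n m →L[ℝ] Rn n →L[ℝ] Rn m :=
  ∑ j : Fin n, (ContinuousLinearMap.smulRightL ℝ (Rn n) (Rn m) (EuclideanSpace.proj j)).comp
    (PiLp.proj 2 (fun _ : Fin n => Rn m) j)

lemma gradMap_apply (V : GradVal n m) (h : Rn n) : gradMap V h = ∑ j, h j • V j := by
  simp [gradMap]

/-- The partial derivatives of a linear map. -/
def gradOf (L : Rn n →L[ℝ] Rn m) : GradVal n m :=
  WithLp.toLp 2 fun j => L (EuclideanSpace.single j 1)

lemma gradOf_apply (L : Rn n →L[ℝ] Rn m) (j : Fin n) :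
    gradOf L j = L (EuclideanSpace.single j 1) := rfl

lemma gradOf_gradMap (V : GradVal n m) : gradOf (gradMap V) = V := by
  ext1 j
  rw [gradOf_apply, gradMap_apply, Finset.sum_eq_single j]
  · simp
  · intro i _ hij
    simp [hij]
  · simp

lemma sum_smul_single (h : Rn n) : ∑ j, h j • (EuclideanSpace.single j 1 : Rn n) = h := by
  ext i
  simp [Pi.single_apply]

lemma gradMap_gradOf (L : Rn n →L[ℝ] Rn m) : gradMap (gradOf L) = L := by
  ext1 h
  rw [gradMap_apply]
  simp only [gradOf_apply, ← map_smul, ← map_sum]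
  congr 1
  exact sum_smul_single h

lemma gradOf_add (L L' : Rn n →L[ℝ] Rn m) : gradOf (L + L') = gradOf L + gradOf L' := rfl

lemma gradOf_sub (L L' : Rn n →L[ℝ] Rn m) : gradOf (L - L') = gradOf L - gradOf L' := rfl

lemma norm_gradOf_le (L : Rn n →L[ℝ] Rn m) : ‖gradOf L‖ ≤ Real.sqrt n * ‖L‖ := by
  rw [PiLp.norm_eq_of_L2]
  have h : ∀ j : Fin n, ‖gradOf L j‖ ^ 2 ≤ ‖L‖ ^ 2 := by
    intro j
    have h1 := L.le_opNorm (EuclideanSpace.single j 1)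
    rw [PiLp.norm_single, norm_one, mul_one] at h1
    rw [gradOf_apply]
    gcongr
  calc Real.sqrt (∑ j, ‖gradOf L j‖ ^ 2) ≤ Real.sqrt (n * ‖L‖ ^ 2) := by
        apply Real.sqrt_le_sqrt
        refine (Finset.sum_le_sum fun j _ => h j).trans (le_of_eq ?_)
        simp
    _ = _ := by rw [Real.sqrt_mul (by positivity), Real.sqrt_sq (norm_nonneg _)]

lemma isOpen_slab (n : ℕ) (T : ℝ≥0∞) : IsOpen (slab n T) := by
  refine (isOpen_lt continuous_const continuous_snd).inter ?_
  exact isOpen_lt (ENNReal.continuous_ofReal.comp continuous_snd) continuous_const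

lemma add_mem_slab_iff {T : ℝ≥0∞} (w : Rn n × ℝ) (h : Rn n) :
    w + (h, 0) ∈ slab n T ↔ w ∈ slab n T := by
  simp [slab]

/-- The standing hypotheses on a source `f` with weak gradient `v`, after changing both on null sets
so that the size bounds hold everywhere and extending them by `0`: the scale invariant size bounds
and the Carleson bounds, the latter in terms of averages against Poisson kernels. -/
structure IsSource (T : ℝ≥0∞) (K : ℝ) (f : Rn n × ℝ → Rn m) (v : Rn n × ℝ → GradVal n m) :
    Prop where
  pos : 0 < K
  sm : StronglyMeasurable f
  sm_grad : StronglyMeasurable v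
  off : ∀ w ∉ slab n T, f w = 0
  off_grad : ∀ w ∉ slab n T, v w = 0
  size : ∀ w ∈ slab n T, ‖f w‖ ≤ K / w.2
  size_grad : ∀ w ∈ slab n T, ‖v w‖ ≤ K / w.2 ^ 2
  avg : ∀ (x : Rn n) (t : ℝ), 0 < t → ENNReal.ofReal t < T →
    ∫⁻ y, epker t (x - y) * ∫⁻ s in Ioo 0 t, ‖f (y, s)‖ₑ ≤ ENNReal.ofReal K
  avg_grad : ∀ (x : Rn n) (t : ℝ), 0 < t → ENNReal.ofReal t < T →
    ∫⁻ y, epker t (x - y) * ∫⁻ s in Ioo 0 t, ENNReal.ofReal s * ‖v (y, s)‖ₑ ≤ ENNReal.ofReal K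
  grad : IsWeakGrad T f v

variable {T : ℝ≥0∞} {K : ℝ} {f : Rn n × ℝ → Rn m} {v : Rn n × ℝ → GradVal n m}

lemma IsSource.norm_le (hS : IsSource T K f v) {c : ℝ} (hc : 0 < c) {w : Rn n × ℝ} (hw : c ≤ w.2) :
    ‖f w‖ ≤ K / c := by
  by_cases h : w ∈ slab n T
  · have := hS.pos
    exact (hS.size w h).trans (by gcongr)
  · rw [hS.off w h, norm_zero]
    exact (div_pos hS.pos hc).le

lemma IsSource.norm_grad_le (hS : IsSource T K f v) {c : ℝ} (hc : 0 < c) {w : Rn n × ℝ}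
    (hw : c ≤ w.2) : ‖v w‖ ≤ K / c ^ 2 := by
  by_cases h : w ∈ slab n T
  · have := hS.pos
    exact (hS.size_grad w h).trans (by gcongr)
  · rw [hS.off_grad w h, norm_zero]
    have := hS.pos
    positivity

lemma IsSource.eq_zero (hS : IsSource T K f v) {w : Rn n × ℝ} (hw : w.2 ≤ 0) : f w = 0 :=
  hS.off w fun h => (not_lt.2 hw) h.1

section Loc
variable {E : Type*} [NormedAddCommGroup E] [NormedSpace ℝ E]

omit [NormedSpace ℝ E] in
lemma locallyIntegrableOn_slab {g : Rn n × ℝ → E}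
    (hg : AEStronglyMeasurable g (volume.restrict (slab n T)))
    (hB : ∀ c > 0, ∃ B, ∀ w ∈ slab n T, c ≤ w.2 → ‖g w‖ ≤ B) :
    LocallyIntegrableOn g (slab n T) := by
  intro w hw
  have hw0 : 0 < w.2 := hw.1
  obtain ⟨B, hB⟩ := hB (w.2 / 2) (half_pos hw0)
  refine ⟨slab n T ∩ (Metric.ball w 1 ∩ {z | w.2 / 2 < z.2}), ?_, ?_⟩
  · refine Filter.inter_mem self_mem_nhdsWithin (mem_nhdsWithin_of_mem_nhds ?_)
    refine Filter.inter_mem (Metric.ball_mem_nhds w one_pos) ?_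
    exact (isOpen_lt continuous_const continuous_snd).mem_nhds (half_lt_self hw0)
  · have hms : MeasurableSet (slab n T ∩ (Metric.ball w 1 ∩ {z : Rn n × ℝ | w.2 / 2 < z.2})) :=
      ((isOpen_slab n T).inter (Metric.isOpen_ball.inter
        (isOpen_lt continuous_const continuous_snd))).measurableSet
    have hfin : volume (slab n T ∩ (Metric.ball w 1 ∩ {z : Rn n × ℝ | w.2 / 2 < z.2})) < ⊤ :=
      (measure_mono fun z hz => hz.2.1).trans_lt (measure_ball_lt_top (x := w) (r := 1))
    have : IsFiniteMeasure (volume.restrict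
        (slab n T ∩ (Metric.ball w 1 ∩ {z : Rn n × ℝ | w.2 / 2 < z.2}))) :=
      ⟨by rwa [Measure.restrict_apply_univ]⟩
    refine Integrable.of_bound (hg.mono_measure (Measure.restrict_mono inter_subset_left le_rfl))
      B ?_
    · refine (ae_restrict_iff' hms).2 (ae_of_all _ fun z hz => ?_)
      exact hB z hz.1 hz.2.2.le

/-- A compactly supported function in the slab is supported at times bounded below. -/
lemma exists_pos_le_of_tsupport_subset {φ : Rn n × ℝ → ℝ} (hc : HasCompactSupport φ)
    (hs : tsupport φ ⊆ slab n T) : ∃ c > 0, ∀ w ∈ tsupport φ, c ≤ w.2 := by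
  rcases (tsupport φ).eq_empty_or_nonempty with h | h
  · exact ⟨1, one_pos, fun w hw => by rw [h] at hw; exact absurd hw (notMem_empty w)⟩
  · obtain ⟨w, hw, hmin⟩ := hc.isCompact.exists_isMinOn h continuous_snd.continuousOn
    exact ⟨w.2, (hs hw).1, fun z hz => hmin hz⟩

lemma integrable_smul_of_tsupport {φ : Rn n × ℝ → ℝ} (hφ : Continuous φ) (hc : HasCompactSupport φ)
    {c B : ℝ} (hcs : ∀ w ∈ tsupport φ, c ≤ w.2) {g : Rn n × ℝ → E} (hg : StronglyMeasurable g)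
    (hB : ∀ w : Rn n × ℝ, c ≤ w.2 → ‖g w‖ ≤ B) : Integrable fun w => φ w • g w := by
  refine (((hφ.integrable_of_hasCompactSupport hc).norm).mul_const B).mono'
    (hφ.aestronglyMeasurable.smul hg.aestronglyMeasurable) (ae_of_all _ fun w => ?_)
  rw [norm_smul]
  by_cases hw : w ∈ tsupport φ
  · have := hB w (hcs w hw)
    gcongr
  · rw [image_eq_zero_of_notMem_tsupport hw]
    simp

end Loc

lemma fderiv_apply_eq_sum (L : Rn n × ℝ →L[ℝ] ℝ) (h : Rn n) :
    L (h, 0) = ∑ j, h j * L (EuclideanSpace.single j 1, 0) := by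
  have h1 : ((h, 0) : Rn n × ℝ) = ∑ j, h j • ((EuclideanSpace.single j 1 : Rn n), (0 : ℝ)) := by
    refine Prod.ext ?_ ?_
    · rw [Prod.fst_sum]
      exact (sum_smul_single h).symm
    · rw [Prod.snd_sum]
      simp
  rw [h1, map_sum]
  exact Finset.sum_congr rfl fun j _ => by rw [map_smul, smul_eq_mul]

/-- The weak gradient tested in a fixed direction `h`. -/
lemma IsSource.integral_fderiv_smul (hS : IsSource T K f v) {φ : Rn n × ℝ → ℝ}
    (hφ : ContDiff ℝ ∞ φ) (hc : HasCompactSupport φ) (hs : tsupport φ ⊆ slab n T) (h : Rn n) :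
    ∫ w, (fderiv ℝ φ w (h, 0)) • f w = -∫ w, φ w • gradMap (v w) h := by
  obtain ⟨c, hc0, hcs⟩ := exists_pos_le_of_tsupport_subset hc hs
  have hpart : ∀ j, ∫ w, (fderiv ℝ φ w (EuclideanSpace.single j 1, 0)) • f w =
      -∫ w, φ w • v w j := by
    intro j
    have h1 := hS.grad.2.2 φ hφ hc hs j
    rwa [setIntegral_eq_integral_of_forall_compl_eq_zero
        (fun w hw => by rw [hS.off w hw, smul_zero]),
      setIntegral_eq_integral_of_forall_compl_eq_zero
        (fun w hw => by rw [hS.off_grad w hw, PiLp.zero_apply, smul_zero])] at h1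
  have hdc : ∀ e : Rn n × ℝ, Continuous fun w => fderiv ℝ φ w e := fun e =>
    (hφ.continuous_fderiv (by simp)).clm_apply continuous_const
  have hdsup : ∀ e : Rn n × ℝ, tsupport (fun w => fderiv ℝ φ w e) ⊆ tsupport φ := fun e =>
    tsupport_fderiv_apply_subset ℝ e
  have hi1 : ∀ e : Rn n × ℝ, Integrable fun w => (fderiv ℝ φ w e) • f w := fun e =>
    integrable_smul_of_tsupport (hdc e) (hc.mono' ((subset_tsupport _).trans (hdsup e)))
      (fun w hw => hcs w (hdsup e hw)) hS.sm fun w hw => hS.norm_le hc0 hw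
  have hi2 : ∀ j, Integrable fun w => φ w • v w j := fun j =>
    integrable_smul_of_tsupport hφ.continuous hc hcs
      ((PiLp.proj 2 (fun _ : Fin n => Rn m) j : GradVal n m →L[ℝ] Rn m).continuous.comp_stronglyMeasurable
        hS.sm_grad)
      fun w hw => (PiLp.norm_apply_le (v w) j).trans (hS.norm_grad_le hc0 hw)
  simp only [fderiv_apply_eq_sum _ h, gradMap_apply, Finset.sum_smul, Finset.smul_sum, mul_smul]
  have hj1 : ∀ j ∈ Finset.univ, Integrable fun w =>
      h j • (fderiv ℝ φ w (EuclideanSpace.single j 1, 0)) • f w := fun j _ => (hi1 _).smul (h j)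
  have hj2 : ∀ j ∈ Finset.univ, Integrable fun w => φ w • h j • v w j := fun j _ => by
    simp only [smul_comm (φ _) (h j)]
    exact (hi2 j).smul (h j)
  rw [integral_finsetSum _ hj1, integral_finsetSum _ hj2, ← Finset.sum_neg_distrib]
  refine Finset.sum_congr rfl fun j _ => ?_
  simp only [smul_comm (φ _) (h j)]
  rw [integral_smul, integral_smul, hpart, smul_neg]

/-- Increments of a source are integrals of its weak gradient: the difference of the two sides is
orthogonal to all test functions, as one sees by moving the translations onto the test function. -/
lemma IsSource.ae_increment (hS : IsSource T K f v) (h : Rn n) :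
    ∀ᵐ w : Rn n × ℝ, f (w + (h, 0)) - f w =
      ∫ θ in (0 : ℝ)..1, gradMap (v (w + (θ • h, 0))) h := by
  have hvsh : StronglyMeasurable fun p : (Rn n × ℝ) × ℝ => gradMap (v (p.1 + (p.2 • h, 0))) h := by
    have h1 : StronglyMeasurable fun p : (Rn n × ℝ) × ℝ => v (p.1 + (p.2 • h, 0)) :=
      hS.sm_grad.comp_measurable (by fun_prop)
    exact ((ContinuousLinearMap.apply ℝ (Rn m) h).comp gradMap).continuous.comp_stronglyMeasurable h1
  have hvint : StronglyMeasurable fun w : Rn n × ℝ =>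
      ∫ θ in (0 : ℝ)..1, gradMap (v (w + (θ • h, 0))) h := by
    simp only [intervalIntegral.integral_of_le zero_le_one]
    exact hvsh.integral_prod_right'
  have hfsh : StronglyMeasurable fun w : Rn n × ℝ => f (w + (h, 0)) :=
    hS.sm.comp_measurable (by fun_prop)
  set A := ‖(gradMap : GradVal n m →L[ℝ] Rn n →L[ℝ] Rn m)‖ with hA
  have hgrad : ∀ V : GradVal n m, ‖gradMap V h‖ ≤ A * ‖V‖ * ‖h‖ := fun V =>
    ((gradMap V).le_opNorm h).trans (by gcongr; exact gradMap.le_opNorm V)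
  have hvb : ∀ {c : ℝ}, 0 < c → ∀ (w : Rn n × ℝ) (θ : ℝ), c ≤ w.2 →
      ‖gradMap (v (w + (θ • h, 0))) h‖ ≤ A * (K / c ^ 2) * ‖h‖ := by
    intro c hc w θ hw
    refine (hgrad _).trans ?_
    have : ‖v (w + (θ • h, 0))‖ ≤ K / c ^ 2 := hS.norm_grad_le hc (by simpa using hw)
    gcongr
  have hvib : ∀ {c : ℝ}, 0 < c → ∀ w : Rn n × ℝ, c ≤ w.2 →
      ‖∫ θ in (0 : ℝ)..1, gradMap (v (w + (θ • h, 0))) h‖ ≤ A * (K / c ^ 2) * ‖h‖ := by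
    intro c hc w hw
    have := intervalIntegral.norm_integral_le_of_norm_le_const (a := 0) (b := 1)
      (f := fun θ => gradMap (v (w + (θ • h, 0))) h) (C := A * (K / c ^ 2) * ‖h‖)
      fun θ _ => hvb hc w θ hw
    simpa using this
  set G : Rn n × ℝ → Rn m := fun w => f (w + (h, 0)) - f w -
    ∫ θ in (0 : ℝ)..1, gradMap (v (w + (θ • h, 0))) h with hG
  have hGm : StronglyMeasurable G := (hfsh.sub hS.sm).sub hvint
  have hloc : LocallyIntegrableOn G (slab n T) := by
    refine locallyIntegrableOn_slab hGm.aestronglyMeasurable fun c hc => ?_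
    refine ⟨K / c + K / c + A * (K / c ^ 2) * ‖h‖, fun w _ hw => ?_⟩
    refine (norm_sub_le _ _).trans (add_le_add ((norm_sub_le _ _).trans (add_le_add ?_ ?_)) ?_)
    · exact hS.norm_le hc (by simpa using hw)
    · exact hS.norm_le hc hw
    · exact hvib hc w hw
  have hzero : ∀ φ : Rn n × ℝ → ℝ, ContDiff ℝ ∞ φ → HasCompactSupport φ → tsupport φ ⊆ slab n T →
      ∫ w, φ w • G w = 0 := by
    intro φ hφ hc hs
    obtain ⟨c, hc0, hcs⟩ := exists_pos_le_of_tsupport_subset hc hs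
    have hi1 : Integrable fun w => φ w • f (w + (h, 0)) :=
      integrable_smul_of_tsupport hφ.continuous hc hcs hfsh
        fun w hw => hS.norm_le hc0 (by simpa using hw)
    have hi2 : Integrable fun w => φ w • f w :=
      integrable_smul_of_tsupport hφ.continuous hc hcs hS.sm fun w hw => hS.norm_le hc0 hw
    have hi3 : Integrable fun w => φ w • ∫ θ in (0 : ℝ)..1, gradMap (v (w + (θ • h, 0))) h :=
      integrable_smul_of_tsupport hφ.continuous hc hcs hvint fun w hw => hvib hc0 w hw
    -- the translated test functions
    set φs : ℝ → Rn n × ℝ → ℝ := fun θ w => φ (w - (θ • h, 0)) with hφs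
    have hφsc : ∀ θ, ContDiff ℝ ∞ (φs θ) := fun θ => hφ.comp (contDiff_id.sub contDiff_const)
    have hsub : ∀ θ w, w ∈ tsupport (φs θ) → w - (θ • h, 0) ∈ tsupport φ := by
      intro θ w hw
      exact tsupport_comp_subset_preimage φ (continuous_id.sub continuous_const) hw
    have hφscs : ∀ θ, HasCompactSupport (φs θ) := fun θ =>
      hc.comp_homeomorph (Homeomorph.subRight ((θ • h, 0) : Rn n × ℝ))
    have hφss : ∀ θ, tsupport (φs θ) ⊆ slab n T := by
      intro θ w hw
      have h1 := hs (hsub θ w hw)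
      have h2 := (add_mem_slab_iff (T := T) (w - (θ • h, 0)) (θ • h)).2 h1
      rwa [sub_add_cancel] at h2
    have hfd : ∀ (θ : ℝ) w, fderiv ℝ (φs θ) w = fderiv ℝ φ (w - (θ • h, 0)) := by
      intro θ w
      have h1 := ((hφ.differentiable (by simp)) (w - (θ • h, 0))).hasFDerivAt.comp w
        ((hasFDerivAt_id w).sub_const ((θ • h, 0) : Rn n × ℝ))
      exact h1.fderiv
    have hθ : ∀ θ : ℝ, ∫ w, φ w • gradMap (v (w + (θ • h, 0))) h =
        -∫ w, (fderiv ℝ φ (w - (θ • h, 0)) (h, 0)) • f w := by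
      intro θ
      have h1 := hS.integral_fderiv_smul (hφsc θ) (hφscs θ) (hφss θ) h
      simp only [hfd] at h1
      rw [h1, neg_neg, ← integral_add_right_eq_self (fun w => φs θ w • gradMap (v w) h) (θ • h, 0)]
      simp only [hφs, add_sub_cancel_right]
    -- Fubini, twice
    have hF1 : ∫ w, φ w • ∫ θ in (0 : ℝ)..1, gradMap (v (w + (θ • h, 0))) h =
        ∫ θ in (0 : ℝ)..1, ∫ w, φ w • gradMap (v (w + (θ • h, 0))) h := by
      simp only [intervalIntegral.integral_of_le zero_le_one, ← integral_smul]
      refine integral_integral_swap ?_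
      have hdom : Integrable (fun p : (Rn n × ℝ) × ℝ => ‖φ p.1‖ * (A * (K / c ^ 2) * ‖h‖))
          ((volume : Measure (Rn n × ℝ)).prod (volume.restrict (Ioc 0 1))) :=
        ((hφ.continuous.integrable_of_hasCompactSupport hc).norm).mul_prod (integrable_const _)
      refine hdom.mono' ?_ (ae_of_all _ fun p => ?_)
      · exact ((hφ.continuous.comp continuous_fst).stronglyMeasurable.smul hvsh).aestronglyMeasurable
      · simp only [Function.uncurry]
        rw [norm_smul]
        by_cases hp : p.1 ∈ tsupport φ
        · have := hvb hc0 p.1 p.2 (hcs _ hp)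
          gcongr
        · rw [image_eq_zero_of_notMem_tsupport hp]
          simp
    have hdc : Continuous fun w => fderiv ℝ φ w (h, 0) :=
      (hφ.continuous_fderiv (by simp)).clm_apply continuous_const
    have hdcs : HasCompactSupport fun w => fderiv ℝ φ w (h, 0) :=
      hc.mono' ((subset_tsupport _).trans (tsupport_fderiv_apply_subset ℝ _))
    obtain ⟨D, hD⟩ := hdc.bounded_above_of_compact_support hdcs
    obtain ⟨ρ, hρ⟩ := hc.isCompact.isBounded.subset_closedBall (0 : Rn n × ℝ)
    have hF2 : ∫ θ in (0 : ℝ)..1, ∫ w, (fderiv ℝ φ (w - (θ • h, 0)) (h, 0)) • f w =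
        ∫ w, ∫ θ in (0 : ℝ)..1, (fderiv ℝ φ (w - (θ • h, 0)) (h, 0)) • f w := by
      simp only [intervalIntegral.integral_of_le zero_le_one]
      refine integral_integral_swap ?_
      have hsm : StronglyMeasurable fun p : ℝ × (Rn n × ℝ) =>
          (fderiv ℝ φ (p.2 - (p.1 • h, 0)) (h, 0)) • f p.2 :=
        (hdc.comp (by fun_prop : Continuous fun p : ℝ × (Rn n × ℝ) =>
          p.2 - (p.1 • h, 0))).stronglyMeasurable.smul (hS.sm.comp_measurable measurable_snd)
      have hdom : Integrable (fun p : ℝ × (Rn n × ℝ) =>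
          (1 : ℝ) * (Metric.closedBall (0 : Rn n × ℝ) (ρ + ‖h‖)).indicator
            (fun _ => D * (K / c)) p.2)
          ((volume.restrict (Ioc 0 1)).prod (volume : Measure (Rn n × ℝ))) := by
        refine Integrable.mul_prod (f := fun _ : ℝ => (1 : ℝ)) (integrable_const _) ?_
        refine (integrable_indicator_iff Metric.isClosed_closedBall.measurableSet).2 ?_
        exact integrableOn_const measure_closedBall_lt_top.ne
      refine hdom.mono' hsm.aestronglyMeasurable ?_
      have hmem : ∀ᵐ p : ℝ × (Rn n × ℝ) ∂((volume.restrict (Ioc 0 1)).prod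
          (volume : Measure (Rn n × ℝ))), p.1 ∈ Ioc (0 : ℝ) 1 :=
        Measure.quasiMeasurePreserving_fst.ae (ae_restrict_mem measurableSet_Ioc)
      filter_upwards [hmem] with p hp
      simp only [Function.uncurry, one_mul]
      rw [norm_smul]
      by_cases hz : fderiv ℝ φ (p.2 - (p.1 • h, 0)) (h, 0) = 0
      · rw [hz, norm_zero, zero_mul]
        have hD0 : 0 ≤ D := (norm_nonneg _).trans (hD 0)
        have := hS.pos
        exact indicator_nonneg (fun _ _ => by positivity) _
      · have hts : p.2 - (p.1 • h, 0) ∈ tsupport φ :=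
          tsupport_fderiv_apply_subset ℝ _ (subset_tsupport _ hz)
        have hcp : c ≤ p.2.2 := by simpa using hcs _ hts
        have hb : p.2 ∈ Metric.closedBall (0 : Rn n × ℝ) (ρ + ‖h‖) := by
          have h1 : ‖p.2 - (p.1 • h, 0)‖ ≤ ρ := by simpa using hρ hts
          have h2 : ‖((p.1 • h, 0) : Rn n × ℝ)‖ ≤ ‖h‖ := by
            rw [Prod.norm_mk, norm_zero, max_eq_left (norm_nonneg _), norm_smul,
              Real.norm_of_nonneg hp.1.le]
            exact mul_le_of_le_one_left (norm_nonneg _) hp.2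
          rw [mem_closedBall_zero_iff]
          calc ‖p.2‖ = ‖(p.2 - (p.1 • h, 0)) + (p.1 • h, 0)‖ := by rw [sub_add_cancel]
            _ ≤ _ := (norm_add_le _ _).trans (add_le_add h1 h2)
        rw [indicator_of_mem hb]
        exact mul_le_mul (hD _) (hS.norm_le hc0 hcp) (norm_nonneg _) ((norm_nonneg _).trans (hD 0))
    have hFTC : ∀ w : Rn n × ℝ, ∫ θ in (0 : ℝ)..1, fderiv ℝ φ (w - (θ • h, 0)) (h, 0) =
        φ w - φ (w - (h, 0)) := by
      intro w
      have hder : ∀ θ ∈ uIcc (0 : ℝ) 1, HasDerivAt (fun θ : ℝ => -φ (w - (θ • h, 0)))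
          (fderiv ℝ φ (w - (θ • h, 0)) (h, 0)) θ := by
        intro θ _
        have h1 : HasDerivAt (fun θ : ℝ => w - ((θ • h, 0) : Rn n × ℝ)) (-(h, 0)) θ := by
          have h2 : HasDerivAt (fun θ : ℝ => θ • ((h, 0) : Rn n × ℝ)) ((1 : ℝ) • (h, 0)) θ :=
            (hasDerivAt_id θ).smul_const _
          have h3 := h2.const_sub w
          simpa using h3
        have h4 := ((hφ.differentiable (by simp)).differentiableAt
          (x := w - (θ • h, 0))).hasFDerivAt.comp_hasDerivAt θ h1
        have h5 := h4.neg
        rw [map_neg, neg_neg] at h5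
        exact h5
      rw [intervalIntegral.integral_eq_sub_of_hasDerivAt hder]
      · simp only [one_smul, zero_smul]
        rw [← Prod.zero_eq_mk, sub_zero]
        ring
      · exact (hdc.comp (by fun_prop)).intervalIntegrable _ _
    have hsm : ∀ w, ∫ θ in (0 : ℝ)..1, (fderiv ℝ φ (w - (θ • h, 0)) (h, 0)) • f w =
        φ w • f w - φ (w - (h, 0)) • f w := by
      intro w
      rw [intervalIntegral.integral_smul_const, hFTC, sub_smul]
    have hi4 : Integrable fun w => φ (w - (h, 0)) • f w := by
      have h1 := hi1.comp_sub_right ((h, 0) : Rn n × ℝ)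
      simpa using h1
    have hval : ∫ w, φ w • ∫ θ in (0 : ℝ)..1, gradMap (v (w + (θ • h, 0))) h =
        (∫ w, φ w • f (w + (h, 0))) - ∫ w, φ w • f w := by
      rw [hF1]
      simp only [hθ]
      rw [intervalIntegral.integral_neg, hF2]
      simp only [hsm]
      rw [integral_sub hi2 hi4, neg_sub]
      congr 1
      rw [← integral_add_right_eq_self (fun w => φ (w - (h, 0)) • f w) ((h, 0) : Rn n × ℝ)]
      simp only [add_sub_cancel_right]
    simp only [hG, smul_sub]
    have hi12 : Integrable fun w => φ w • f (w + (h, 0)) - φ w • f w := hi1.sub hi2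
    rw [integral_sub hi12 hi3, integral_sub hi1 hi2, hval, sub_self]
  have hae := (isOpen_slab n T).ae_eq_zero_of_integral_contDiff_smul_eq_zero hloc hzero
  filter_upwards [hae] with w hw
  by_cases hws : w ∈ slab n T
  · exact sub_eq_zero.1 (hw hws)
  · have hz : ∀ θ : ℝ, v (w + (θ • h, 0)) = 0 := fun θ =>
      hS.off_grad _ (mt (add_mem_slab_iff w _).1 hws)
    rw [hS.off _ (mt (add_mem_slab_iff w h).1 hws), hS.off _ hws]
    simp [hz]

end Gradient

/-! ### The gradient of a potential -/

section PotentialGradient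
variable {m : ℕ} {T : ℝ≥0∞} {K : ℝ} {f : Rn n × ℝ → Rn m} {v : Rn n × ℝ → GradVal n m}

/-- A function whose increments are line integrals of a continuous field has that field as its
derivative. -/
lemma hasFDerivAt_of_increment {F : Rn n → Rn m} {L : Rn n → Rn n →L[ℝ] Rn m} (hL : Continuous L)
    (h : ∀ x h, F (x + h) - F x = ∫ θ in (0 : ℝ)..1, L (x + θ • h) h) (x : Rn n) :
    HasFDerivAt F (L x) x := by
  rw [hasFDerivAt_iff_isLittleO_nhds_zero, Asymptotics.isLittleO_iff]
  intro ε hε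
  obtain ⟨δ, hδ, hδε⟩ := Metric.continuous_iff.1 hL x ε hε
  filter_upwards [Metric.ball_mem_nhds (0 : Rn n) hδ] with y hy
  have hc : Continuous fun θ : ℝ => L (x + θ • y) y :=
    (hL.comp (by fun_prop : Continuous fun θ : ℝ => x + θ • y)).clm_apply continuous_const
  have h1 : F (x + y) - F x - L x y = ∫ θ in (0 : ℝ)..1, (L (x + θ • y) y - L x y) := by
    rw [intervalIntegral.integral_sub (hc.intervalIntegrable _ _)
      (continuous_const.intervalIntegrable _ _), h]
    simp
  rw [h1]
  refine (intervalIntegral.norm_integral_le_of_norm_le_const (C := ε * ‖y‖)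
    fun θ hθ => ?_).trans (le_of_eq (by simp))
  rw [uIoc_of_le zero_le_one] at hθ
  rw [← sub_apply]
  refine ((L (x + θ • y) - L x).le_opNorm y).trans ?_
  have h2 := (hδε (x + θ • y) (by
    rw [dist_eq_norm, add_sub_cancel_left, norm_smul, Real.norm_of_nonneg hθ.1.le]
    rw [mem_ball_zero_iff] at hy
    exact (mul_le_of_le_one_left (norm_nonneg _) hθ.2).trans_lt hy)).le
  rw [dist_eq_norm] at h2
  gcongr

section Aux
variable {E : Type*} [NormedAddCommGroup E] [NormedSpace ℝ E]

omit [NormedSpace ℝ E] in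
lemma eDPot_enorm_le_of_bounded {g : Rn n × ℝ → E} {c B : ℝ}
    (hc : ∀ w : Rn n × ℝ, w.2 < c → g w = 0) (h : ∀ w, ‖g w‖ ≤ B) (x : Rn n) (t : ℝ) :
    eDPot (fun w => ‖g w‖ₑ) x t ≤ ENNReal.ofReal (B * max 0 (t - c)) := by
  refine eDPot_le_of_bounded (fun w hw => by rw [hc w hw, enorm_zero]) (fun w => ?_) x t
  rw [← ofReal_norm]
  exact ENNReal.ofReal_le_ofReal (h w)

lemma continuous_dPot_of_bounded {g : Rn n × ℝ → E} (hg : StronglyMeasurable g) {c B : ℝ}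
    (hB : 0 ≤ B) (hc : ∀ w : Rn n × ℝ, w.2 < c → g w = 0) (h : ∀ w, ‖g w‖ ≤ B) (t : ℝ) :
    Continuous fun x => dPot g x t := by
  rcases lt_or_ge t c with ht | ht
  · have h0 : (fun x => dPot g x t) = fun _ => 0 := by
      ext x
      rw [dPot_congr (g' := fun _ => 0) fun w hw => hc w (hw.trans ht)]
      simp [dPot]
    rw [h0]
    exact continuous_const
  · rw [Metric.continuous_iff']
    intro x ε hε
    have hlim : Filter.Tendsto (fun y : Rn n =>
        4 * lipConst n * B * (‖y - x‖ ^ (3 / 4 : ℝ) * (t - c) ^ (1 / 4 : ℝ))) (nhds x) (nhds 0) := by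
      have h1 : Continuous fun y : Rn n =>
          4 * lipConst n * B * (‖y - x‖ ^ (3 / 4 : ℝ) * (t - c) ^ (1 / 4 : ℝ)) :=
        continuous_const.mul (((continuous_id.sub continuous_const).norm.rpow_const
          fun _ => Or.inr (by norm_num)).mul continuous_const)
      have h2 := h1.tendsto x
      rwa [sub_self, norm_zero, Real.zero_rpow (by norm_num), zero_mul, mul_zero] at h2
    filter_upwards [hlim.eventually (gt_mem_nhds hε)] with y hy
    rw [dist_eq_norm]
    exact (norm_dPot_sub_le_of_bounded hg hB hc h y x ht).trans_lt hy

lemma dPot_add_left (g : Rn n × ℝ → E) (x h : Rn n) (t : ℝ) :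
    dPot g (x + h) t = ∫ w : Rn n × ℝ, pker (t - w.2) (x - w.1) • g (w + (h, 0)) := by
  unfold dPot
  rw [← integral_add_right_eq_self _ ((h, 0) : Rn n × ℝ)]
  refine integral_congr_ae (ae_of_all _ fun w => ?_)
  simp only [Prod.snd_add, Prod.fst_add, add_zero, add_sub_add_right_eq_sub]

end Aux

lemma timeCut_Ici_eq_zero (c : ℝ) {Z : Type*} [Zero Z] (g : Rn n × ℝ → Z) (w : Rn n × ℝ)
    (hw : w.2 < c) : timeCut (Ici c) g w = 0 := timeCut_of_notMem (not_le.2 hw)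

lemma IsSource.norm_cut_le (hS : IsSource T K f v) {c : ℝ} (hc : 0 < c) (w : Rn n × ℝ) :
    ‖timeCut (Ici c) f w‖ ≤ K / c := by
  by_cases h : w.2 ∈ Ici c
  · rw [timeCut_of_mem h]
    exact hS.norm_le hc h
  · rw [timeCut_of_notMem h, norm_zero]
    exact (div_pos hS.pos hc).le

lemma IsSource.norm_cut_grad_le (hS : IsSource T K f v) {c : ℝ} (hc : 0 < c) (w : Rn n × ℝ) :
    ‖timeCut (Ici c) v w‖ ≤ K / c ^ 2 := by
  by_cases h : w.2 ∈ Ici c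
  · rw [timeCut_of_mem h]
    exact hS.norm_grad_le hc h
  · rw [timeCut_of_notMem h, norm_zero]
    have := hS.pos
    positivity

/-- The integrated form of `∇(dPot f) = dPot (∇f)`: translate the source in `dPot`, then apply
`IsSource.ae_increment` and Fubini. -/
lemma IsSource.dPot_increment (hS : IsSource T K f v) {c : ℝ} (hc : 0 < c) (x h : Rn n) (t : ℝ) :
    dPot (timeCut (Ici c) f) (x + h) t - dPot (timeCut (Ici c) f) x t =
      ∫ θ in (0 : ℝ)..1, gradMap (dPot (timeCut (Ici c) v) (x + θ • h) t) h := by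
  have hfm : StronglyMeasurable (timeCut (Ici c) f) := stronglyMeasurable_timeCut measurableSet_Ici hS.sm
  have hvm : StronglyMeasurable (timeCut (Ici c) v) :=
    stronglyMeasurable_timeCut measurableSet_Ici hS.sm_grad
  have hfi : ∀ x, Integrable fun w : Rn n × ℝ => pker (t - w.2) (x - w.1) • timeCut (Ici c) f w :=
    fun x => integrable_dPot hfm ((eDPot_enorm_le_of_bounded (timeCut_Ici_eq_zero c f)
      (hS.norm_cut_le hc) x t).trans_lt ENNReal.ofReal_lt_top)
  have hvi : ∀ x, Integrable fun w : Rn n × ℝ => pker (t - w.2) (x - w.1) • timeCut (Ici c) v w :=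
    fun x => integrable_dPot hvm ((eDPot_enorm_le_of_bounded (timeCut_Ici_eq_zero c v)
      (hS.norm_cut_grad_le hc) x t).trans_lt ENNReal.ofReal_lt_top)
  have htr : ∀ (h : Rn n) {E : Type} [NormedAddCommGroup E] [NormedSpace ℝ E] {g : Rn n × ℝ → E},
      (Integrable fun w : Rn n × ℝ => pker (t - w.2) (x + h - w.1) • g w) →
      Integrable fun w : Rn n × ℝ => pker (t - w.2) (x - w.1) • g (w + (h, 0)) := by
    intro h E _ _ g hg
    have h1 := hg.comp_add_right ((h, 0) : Rn n × ℝ)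
    simpa only [Prod.snd_add, Prod.fst_add, add_zero, add_sub_add_right_eq_sub] using h1
  have hmem : ∀ (w : Rn n × ℝ) (h : Rn n), (w + (h, 0)).2 = w.2 := fun w h => by simp
  set D : Rn n × ℝ → ℝ → Rn m := fun w θ => gradMap (timeCut (Ici c) v (w + (θ • h, 0))) h with hD
  have hinc : ∀ᵐ w : Rn n × ℝ, timeCut (Ici c) f (w + (h, 0)) - timeCut (Ici c) f w =
      ∫ θ in (0 : ℝ)..1, D w θ := by
    filter_upwards [hS.ae_increment h] with w hw
    by_cases hwc : w.2 ∈ Ici c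
    · rw [timeCut_of_mem hwc, timeCut_of_mem (by rwa [hmem]), hw]
      refine intervalIntegral.integral_congr fun θ _ => ?_
      simp only [hD]
      rw [timeCut_of_mem (by rwa [hmem])]
    · rw [timeCut_of_notMem hwc, timeCut_of_notMem (by rwa [hmem])]
      have : ∀ θ, D w θ = 0 := fun θ => by
        simp only [hD]
        rw [timeCut_of_notMem (by rwa [hmem])]
        simp
      simp [this]
  have hLcomp : ∀ θ : ℝ, gradMap (dPot (timeCut (Ici c) v) (x + θ • h) t) h =
      ∫ w : Rn n × ℝ, pker (t - w.2) (x - w.1) • D w θ := by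
    intro θ
    rw [dPot_add_left]
    have h1 := ((ContinuousLinearMap.apply ℝ (Rn m) h).comp
      (gradMap : GradVal n m →L[ℝ] Rn n →L[ℝ] Rn m)).integral_comp_comm (htr (θ • h) (hvi _))
    simp only [ContinuousLinearMap.comp_apply, ContinuousLinearMap.apply_apply] at h1
    rw [← h1]
    refine integral_congr_ae (ae_of_all _ fun w => ?_)
    simp only [hD, map_smul, smul_apply]
  rw [dPot_add_left]
  have hfi' := hfi x
  unfold dPot at hLcomp ⊢
  rw [← integral_sub (htr h (hfi _)) hfi']
  simp only [hLcomp]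
  calc ∫ w : Rn n × ℝ, (pker (t - w.2) (x - w.1) • timeCut (Ici c) f (w + (h, 0)) -
        pker (t - w.2) (x - w.1) • timeCut (Ici c) f w)
      = ∫ w : Rn n × ℝ, ∫ θ in (0 : ℝ)..1, pker (t - w.2) (x - w.1) • D w θ := by
        refine integral_congr_ae ?_
        filter_upwards [hinc] with w hw
        rw [← smul_sub, hw, intervalIntegral.integral_smul]
    _ = _ := by
        simp only [intervalIntegral.integral_of_le zero_le_one]
        refine integral_integral_swap ?_
        have hDm : StronglyMeasurable fun p : (Rn n × ℝ) × ℝ => D p.1 p.2 := by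
          have h1 : StronglyMeasurable fun p : (Rn n × ℝ) × ℝ =>
              timeCut (Ici c) v (p.1 + (p.2 • h, 0)) := hvm.comp_measurable (by fun_prop)
          exact ((ContinuousLinearMap.apply ℝ (Rn m) h).comp
            gradMap).continuous.comp_stronglyMeasurable h1
        set A := ‖(gradMap : GradVal n m →L[ℝ] Rn n →L[ℝ] Rn m)‖
        have hK := hS.pos
        have hone : Integrable fun w : Rn n × ℝ =>
            pker (t - w.2) (x - w.1) • timeCut (Ici c) (fun _ => (1 : ℝ)) w := by
          refine integrable_dPot (stronglyMeasurable_timeCut measurableSet_Ici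
            stronglyMeasurable_const) ((eDPot_enorm_le_of_bounded (B := 1)
              (timeCut_Ici_eq_zero c _) (fun w => ?_) x t).trans_lt ENNReal.ofReal_lt_top)
          by_cases hw : w.2 ∈ Ici c
          · rw [timeCut_of_mem hw, norm_one]
          · rw [timeCut_of_notMem hw, norm_zero]
            exact zero_le_one
        have hdom : Integrable (fun p : (Rn n × ℝ) × ℝ =>
            (pker (t - p.1.2) (x - p.1.1) • timeCut (Ici c) (fun _ => (1 : ℝ)) p.1) *
              (A * (K / c ^ 2) * ‖h‖))
            ((volume : Measure (Rn n × ℝ)).prod (volume.restrict (Ioc 0 1))) :=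
          hone.mul_prod (integrable_const _)
        refine hdom.mono' ?_ (ae_of_all _ fun p => ?_)
        · have hkm : Measurable fun p : (Rn n × ℝ) × ℝ => pker (t - p.1.2) (x - p.1.1) := by fun_prop
          exact (hkm.stronglyMeasurable.smul hDm).aestronglyMeasurable
        · simp only [Function.uncurry]
          rw [norm_smul, Real.norm_of_nonneg (pker_nonneg _ _), smul_eq_mul, mul_assoc]
          refine mul_le_mul_of_nonneg_left ?_ (pker_nonneg _ _)
          by_cases hp : p.1.2 ∈ Ici c
          · rw [timeCut_of_mem hp, one_mul]
            refine ((gradMap (timeCut (Ici c) v (p.1 + (p.2 • h, 0)))).le_opNorm h).trans ?_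
            have h1 := hS.norm_cut_grad_le hc (p.1 + (p.2 • h, 0))
            have h2 := (gradMap : GradVal n m →L[ℝ] Rn n →L[ℝ] Rn m).le_opNorm
              (timeCut (Ici c) v (p.1 + (p.2 • h, 0)))
            have h3 : A * ‖timeCut (Ici c) v (p.1 + (p.2 • h, 0))‖ ≤ A * (K / c ^ 2) := by gcongr
            have h4 := h2.trans h3
            gcongr
          · rw [timeCut_of_notMem hp, zero_mul]
            simp only [hD]
            rw [timeCut_of_notMem (by rwa [hmem])]
            simp

/-- Potentials of sources that vanish before a positive time are differentiable, and their gradients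
are the potentials of the weak gradients of the sources. -/
lemma IsSource.hasFDerivAt_dPot_cut (hS : IsSource T K f v) {c : ℝ} (hc : 0 < c) (x : Rn n) (t : ℝ) :
    HasFDerivAt (fun y => dPot (timeCut (Ici c) f) y t)
      (gradMap (dPot (timeCut (Ici c) v) x t)) x := by
  have hK := hS.pos
  have hcont : Continuous fun y => dPot (timeCut (Ici c) v) y t :=
    continuous_dPot_of_bounded (stronglyMeasurable_timeCut measurableSet_Ici hS.sm_grad)
      (by positivity) (timeCut_Ici_eq_zero c v) (hS.norm_cut_grad_le hc) t
  exact hasFDerivAt_of_increment (L := fun y => gradMap (dPot (timeCut (Ici c) v) y t))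
    (gradMap.continuous.comp hcont) (fun x h => hS.dPot_increment hc x h t) x

end PotentialGradient

/-! ### The potential of a source and its gradient: size, regularity, mild formulation -/

section PotentialBounds
variable {m : ℕ} {T : ℝ≥0∞} {K : ℝ} {f : Rn n × ℝ → Rn m} {v : Rn n × ℝ → GradVal n m}

/-- The constant in the uniform bound for potentials of sources. -/
def potConst (n : ℕ) : ℝ := 4 ^ (((n : ℝ) + 1) / 2) + 1

lemma potConst_pos (n : ℕ) : 0 < potConst n := by unfold potConst; positivity

/-- The constant in the bound `|∇u| ≤ C K / t` for potentials of sources. -/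
def gradConst (n : ℕ) : ℝ := Real.sqrt n * (2 * (lipConst n * potConst n)) + 2

lemma gradConst_pos (n : ℕ) : 0 < gradConst n := by
  have h1 := lipConst_ge_two n
  have h2 := potConst_pos n
  unfold gradConst
  positivity

lemma epker_sub_le {t s : ℝ} (hs : 0 ≤ s) (hst : s ≤ t / 2) (x : Rn n) :
    epker (t - s) x ≤ ENNReal.ofReal (4 ^ (((n : ℝ) + 1) / 2)) * epker t x := by
  rcases le_or_gt t 0 with ht | ht
  · rw [epker_of_nonpos (by linarith)]
    exact bot_le
  unfold epker
  rw [← ENNReal.ofReal_mul (by positivity)]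
  refine ENNReal.ofReal_le_ofReal (pker_le_of_sq_le' (by linarith) (by linarith) (by norm_num) ?_)
  nlinarith [sq_nonneg ‖x‖, mul_nonneg (by linarith : 0 ≤ t / 2 - s) (by linarith : 0 ≤ t)]

/-- The sources before time `t / 2` are controlled by the Carleson bound, the later ones by the size
bound. -/
lemma IsSource.eDPot_le (hS : IsSource T K f v) (x : Rn n) {t : ℝ} (ht : ENNReal.ofReal t < T) :
    eDPot (fun w => ‖f w‖ₑ) x t ≤ ENNReal.ofReal (potConst n * K) := by
  have hK := hS.pos
  rcases le_or_gt t 0 with ht0 | ht0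
  · calc eDPot (fun w => ‖f w‖ₑ) x t ≤ eDPot (fun _ => 0) x t :=
        eDPot_mono fun w hw => by rw [hS.eq_zero (hw.le.trans ht0), enorm_zero]
      _ ≤ _ := by simp [eDPot]
  have hfm : Measurable fun w => ‖f w‖ₑ := hS.sm.enorm
  have hsplit : eDPot (fun w => ‖f w‖ₑ) x t ≤ eDPot (timeCut (Iio (t / 2)) fun w => ‖f w‖ₑ) x t +
      eDPot (timeCut (Ici (t / 2)) fun w => ‖f w‖ₑ) x t := by
    unfold eDPot
    have hm : Measurable fun w : Rn n × ℝ =>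
        epker (t - w.2) (x - w.1) * timeCut (Iio (t / 2)) (fun w => ‖f w‖ₑ) w :=
      Measurable.mul (by fun_prop) (measurable_timeCut measurableSet_Iio hfm)
    rw [← lintegral_add_left hm]
    refine lintegral_mono fun w => ?_
    rcases lt_or_ge w.2 (t / 2) with hw | hw
    · rw [timeCut_of_mem (S := Iio (t / 2)) hw]
      exact le_self_add
    · rw [timeCut_of_mem (S := Ici (t / 2)) hw]
      exact le_add_self
  have hearly : eDPot (timeCut (Iio (t / 2)) fun w => ‖f w‖ₑ) x t ≤
      ENNReal.ofReal (4 ^ (((n : ℝ) + 1) / 2)) * ENNReal.ofReal K := by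
    calc eDPot (timeCut (Iio (t / 2)) fun w => ‖f w‖ₑ) x t
        ≤ ∫⁻ w : Rn n × ℝ, ENNReal.ofReal (4 ^ (((n : ℝ) + 1) / 2)) *
            (epker t (x - w.1) * timeCut (Ioo 0 t) (fun w => ‖f w‖ₑ) w) := by
          refine lintegral_mono fun w => ?_
          by_cases hw : w.2 ∈ Iio (t / 2)
          · rw [timeCut_of_mem hw]
            rcases le_or_gt w.2 0 with h0 | h0
            · rw [hS.eq_zero h0, enorm_zero, mul_zero]
              exact bot_le
            · rw [timeCut_of_mem (S := Ioo 0 t) ⟨h0, by rw [mem_Iio] at hw; linarith⟩, ← mul_assoc]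
              gcongr
              exact epker_sub_le h0.le (le_of_lt hw) _
          · rw [timeCut_of_notMem hw, mul_zero]
            exact bot_le
      _ = ENNReal.ofReal (4 ^ (((n : ℝ) + 1) / 2)) *
            ∫⁻ y, epker t (x - y) * ∫⁻ s in Ioo 0 t, ‖f (y, s)‖ₑ := by
          have hm : Measurable fun w : Rn n × ℝ =>
              epker t (x - w.1) * timeCut (Ioo 0 t) (fun w => ‖f w‖ₑ) w :=
            Measurable.mul (by fun_prop) (measurable_timeCut measurableSet_Ioo hfm)
          rw [lintegral_const_mul _ hm, Measure.volume_eq_prod, lintegral_prod _ hm.aemeasurable]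
          congr 1
          refine lintegral_congr fun y => ?_
          have hm2 : Measurable fun s => timeCut (Ioo 0 t) (fun w => ‖f w‖ₑ) (y, s) :=
            (measurable_timeCut measurableSet_Ioo hfm).comp measurable_prodMk_left
          change ∫⁻ s, epker t (x - y) * timeCut (Ioo 0 t) (fun w => ‖f w‖ₑ) (y, s) = _
          rw [lintegral_const_mul _ hm2, ← lintegral_indicator measurableSet_Ioo]
          rfl
      _ ≤ _ := by
          gcongr
          exact hS.avg x t ht0 ht
  have hlate : eDPot (timeCut (Ici (t / 2)) fun w => ‖f w‖ₑ) x t ≤ ENNReal.ofReal K := by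
    refine (eDPot_le_of_bounded (B := K / (t / 2)) (timeCut_Ici_eq_zero (t / 2) _)
      (fun w => ?_) x t).trans (le_of_eq ?_)
    · rw [← enorm_timeCut, ← ofReal_norm]
      exact ENNReal.ofReal_le_ofReal (hS.norm_cut_le (half_pos ht0) w)
    · rw [max_eq_right (by linarith)]
      congr 1
      field_simp
      ring
  refine hsplit.trans ((add_le_add hearly hlate).trans (le_of_eq ?_))
  rw [← ENNReal.ofReal_mul (by positivity), ← ENNReal.ofReal_add (by positivity) hK.le, potConst]
  congr 1
  ring

lemma IsSource.norm_dPot_le (hS : IsSource T K f v) (x : Rn n) {t : ℝ} (ht : ENNReal.ofReal t < T) :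
    ‖dPot f x t‖ ≤ potConst n * K := by
  have h := (enorm_dPot_le f x t).trans (hS.eDPot_le x ht)
  rw [← ofReal_norm] at h
  exact (ENNReal.ofReal_le_ofReal_iff (mul_nonneg (potConst_pos n).le hS.pos.le)).1 h

/-- The integral of the size bound for `∇f` over all times after `c`. -/
lemma IsSource.eDPot_cut_grad_le (hS : IsSource T K f v) {c : ℝ} (hc : 0 < c) (x : Rn n) (t : ℝ) :
    eDPot (fun w => ‖timeCut (Ici c) v w‖ₑ) x t ≤ ENNReal.ofReal (K / c) := by
  have hK := hS.pos
  set ψ : ℝ → ℝ≥0∞ := (Ici c).indicator fun s => ENNReal.ofReal (K * s ^ (-2 : ℝ)) with hψ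
  have hψm : Measurable ψ := Measurable.indicator (by fun_prop) measurableSet_Ici
  refine (eDPot_le_of_le_time hψm (fun w => ?_) x t).trans ?_
  · rcases lt_or_ge w.2 c with hw | hw
    · rw [timeCut_Ici_eq_zero c v w hw, enorm_zero]
      exact bot_le
    · rw [timeCut_of_mem (S := Ici c) hw, hψ, indicator_of_mem (s := Ici c) hw, ← ofReal_norm]
      refine ENNReal.ofReal_le_ofReal ((hS.norm_grad_le (hc.trans_le hw) le_rfl).trans_eq ?_)
      rw [Real.rpow_neg (hc.le.trans hw), div_eq_mul_inv]
      norm_num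
  · calc ∫⁻ s in Iio t, ψ s ≤ ∫⁻ s, ψ s := setLIntegral_le_lintegral _ _
      _ = ∫⁻ s in Ioi c, ENNReal.ofReal (K * s ^ (-2 : ℝ)) := by
          rw [hψ, lintegral_indicator measurableSet_Ici, restrict_Ioi_eq_restrict_Ici]
      _ = ENNReal.ofReal (∫ s in Ioi c, K * s ^ (-2 : ℝ)) := by
          rw [ofReal_integral_eq_lintegral_ofReal]
          · exact (integrableOn_Ioi_rpow_of_lt (by norm_num) hc).const_mul K
          · refine (ae_restrict_iff' measurableSet_Ioi).2 (ae_of_all _ fun s hs => ?_)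
            have : 0 < s := hc.trans hs
            positivity
      _ = _ := by
          rw [integral_const_mul, integral_Ioi_rpow_of_lt (by norm_num) hc]
          norm_num
          rw [Real.rpow_neg_one]
          rfl
      _ ≤ _ := le_rfl

lemma IsSource.stronglyMeasurable_dPot_slice (hS : IsSource T K f v) (t : ℝ) :
    StronglyMeasurable fun z => dPot f z t := stronglyMeasurable_dPot_left hS.sm t

lemma IsSource.hasFDerivAt_dPot (hS : IsSource T K f v) {a t : ℝ} (ha : 0 < a) (hat : a < t)
    (ht : ENNReal.ofReal t < T) (x : Rn n) :
    HasFDerivAt (fun y => dPot f y t)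
      ((∫ z, (kgrad (t - a) (x - z)).smulRight (dPot f z a)) +
        gradMap (dPot (timeCut (Ici a) v) x t)) x := by
  have haT : ENNReal.ofReal a < T := (ENNReal.ofReal_le_ofReal hat.le).trans_lt ht
  have h1 : (fun y => dPot f y t) = fun y => pconv (t - a) (fun z => dPot f z a) y +
      dPot (timeCut (Ici a) f) y t := by
    ext1 y
    exact dPot_eq_pconv_add hS.sm hat ((hS.eDPot_le y ht).trans_lt ENNReal.ofReal_lt_top)
  rw [h1]
  exact (hasFDerivAt_pconv (hS.stronglyMeasurable_dPot_slice a) (fun z => hS.norm_dPot_le z haT)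
    (sub_pos.2 hat) x).add (hS.hasFDerivAt_dPot_cut ha x t)

/-- The spatial gradient of the potential of `f`, extended by `0` off `ℝⁿ × (0,T)`. -/
def potGrad (T : ℝ≥0∞) (f : Rn n × ℝ → Rn m) : Rn n × ℝ → GradVal n m :=
  (slab n T).indicator fun z => gradOf (fderiv ℝ (fun y => dPot f y z.2) z.1)

lemma potGrad_of_pos {x : Rn n} {t : ℝ} (ht0 : 0 < t) (ht : ENNReal.ofReal t < T) :
    potGrad T f (x, t) = gradOf (fderiv ℝ (fun y => dPot f y t) x) :=
  indicator_of_mem (s := slab n T) ⟨ht0, ht⟩ _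

/-- The gradient splits into a derivative on the kernel, for the sources before time `a`, and the
potential of the weak gradient, for the sources after time `a`. -/
lemma IsSource.potGrad_eq (hS : IsSource T K f v) {a t : ℝ} (ha : 0 < a) (hat : a < t)
    (ht : ENNReal.ofReal t < T) (x : Rn n) :
    potGrad T f (x, t) = gradOf (∫ z, (kgrad (t - a) (x - z)).smulRight (dPot f z a)) +
        dPot (timeCut (Ici a) v) x t := by
  rw [potGrad_of_pos (ha.trans hat) ht, (hS.hasFDerivAt_dPot ha hat ht x).fderiv, gradOf_add,
    gradOf_gradMap]

lemma IsSource.hasFDerivAt_potGrad (hS : IsSource T K f v) {t : ℝ} (ht0 : 0 < t)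
    (ht : ENNReal.ofReal t < T) (x : Rn n) :
    HasFDerivAt (fun y => dPot f y t) (gradMap (potGrad T f (x, t))) x := by
  rw [potGrad_of_pos ht0 ht, gradMap_gradOf]
  exact (hS.hasFDerivAt_dPot (half_pos ht0) (half_lt_self ht0) ht
    x).differentiableAt.hasFDerivAt

lemma norm_integral_kgrad_smulRight_le {E : Type*} [NormedAddCommGroup E] [NormedSpace ℝ E]
    {b : Rn n → E} (hb : StronglyMeasurable b) {M : ℝ}
    (hM : ∀ z, ‖b z‖ ≤ M) {τ : ℝ} (hτ : 0 < τ) (x : Rn n) :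
    ‖∫ z, (kgrad τ (x - z)).smulRight (b z)‖ ≤ lipConst n * M / τ := by
  have hM0 : 0 ≤ M := (norm_nonneg _).trans (hM 0)
  have h2 := lipConst_ge_two n
  have hl : 0 ≤ lipConst n * M / τ := by positivity
  refine (hasFDerivAt_pconv hb hM hτ x).le_of_lipschitz (C := ⟨lipConst n * M / τ, hl⟩) ?_
  refine LipschitzWith.of_dist_le_mul fun y z => ?_
  rw [dist_eq_norm, dist_eq_norm]
  refine (norm_pconv_sub_le hM hb hτ y z).trans ?_
  calc lipConst n * M * min 1 (‖y - z‖ / τ) ≤ lipConst n * M * (‖y - z‖ / τ) := by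
        gcongr
        exact min_le_right _ _
    _ = lipConst n * M / τ * ‖y - z‖ := by ring

lemma IsSource.norm_potGrad_le (hS : IsSource T K f v) (x : Rn n) {t : ℝ} (ht0 : 0 < t)
    (ht : ENNReal.ofReal t < T) : ‖potGrad T f (x, t)‖ ≤ gradConst n * K / t := by
  have hK := hS.pos
  have haT : ENNReal.ofReal (t / 2) < T :=
    (ENNReal.ofReal_le_ofReal (half_le_self ht0.le)).trans_lt ht
  rw [hS.potGrad_eq (half_pos ht0) (half_lt_self ht0) ht x]
  have h1 := norm_integral_kgrad_smulRight_le (hS.stronglyMeasurable_dPot_slice (t / 2))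
    (fun z => hS.norm_dPot_le z haT) (sub_pos.2 (half_lt_self ht0)) x
  have h2 : ‖dPot (timeCut (Ici (t / 2)) v) x t‖ ≤ K / (t / 2) := by
    have h := (enorm_dPot_le _ x t).trans (hS.eDPot_cut_grad_le (half_pos ht0) x t)
    rw [← ofReal_norm] at h
    exact (ENNReal.ofReal_le_ofReal_iff (by positivity)).1 h
  calc _ ≤ Real.sqrt n * (lipConst n * (potConst n * K) / (t - t / 2)) + K / (t / 2) := by
        refine (norm_add_le _ _).trans (add_le_add ((norm_gradOf_le _).trans ?_) h2)
        gcongr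
    _ = _ := by
        rw [sub_half, gradConst]
        field_simp

lemma potGrad_of_notMem {z : Rn n × ℝ} (hz : z ∉ slab n T) : potGrad T f z = 0 :=
  indicator_of_notMem hz _

lemma IsSource.stronglyMeasurable_potGrad (hS : IsSource T K f v) :
    StronglyMeasurable (potGrad T f) := by
  -- the limit of difference quotients
  set W : ℕ → Rn n × ℝ → GradVal n m := fun k => (slab n T).indicator fun z =>
    WithLp.toLp 2 fun j : Fin n => ((k : ℝ) + 1) •
      (dPot f (z.1 + ((k : ℝ) + 1)⁻¹ • EuclideanSpace.single j 1) z.2 - dPot f z.1 z.2)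
  have hu := stronglyMeasurable_dPot hS.sm
  have hW : ∀ k, StronglyMeasurable (W k) := by
    intro k
    refine StronglyMeasurable.indicator ?_ (isOpen_slab n T).measurableSet
    refine Measurable.stronglyMeasurable ?_
    refine (WithLp.measurable_toLp 2 _).comp (measurable_pi_lambda _ fun j => ?_)
    have hm : Measurable fun z : Rn n × ℝ =>
        dPot f (z.1 + ((k : ℝ) + 1)⁻¹ • EuclideanSpace.single j 1) z.2 := (hu.comp_measurable (g := fun z : Rn n × ℝ =>
      (z.1 + ((k : ℝ) + 1)⁻¹ • EuclideanSpace.single j 1, z.2)) (by fun_prop)).measurable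
    exact (hm.sub hu.measurable).const_smul ((k : ℝ) + 1)
  refine stronglyMeasurable_of_tendsto Filter.atTop hW ?_
  rw [tendsto_pi_nhds]
  intro z
  by_cases hz : z ∈ slab n T
  · simp only [W, potGrad, indicator_of_mem hz]
    have hd := hS.hasFDerivAt_potGrad hz.1 hz.2 z.1
    refine ((PiLp.continuous_toLp 2 _).tendsto _).comp (tendsto_pi_nhds.2 fun j => ?_)
    rw [hd.fderiv]
    exact (hd.lim_real (EuclideanSpace.single j 1)).comp
      (Filter.tendsto_atTop_add_const_right _ 1 tendsto_natCast_atTop_atTop)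
  · simp only [W, potGrad, indicator_of_notMem hz]
    exact tendsto_const_nhds

lemma integrable_pconv_of_bounded {E : Type*} [NormedAddCommGroup E] [NormedSpace ℝ E]
    {b : Rn n → E} (hb : StronglyMeasurable b) {M : ℝ}
    (hM : ∀ z, ‖b z‖ ≤ M) (τ : ℝ) (x : Rn n) : Integrable fun z => pker τ (x - z) • b z := by
  refine integrable_pconv hb ?_
  calc ∫⁻ z, epker τ (x - z) * ‖b z‖ₑ ≤ ∫⁻ z, epker τ (x - z) * ENNReal.ofReal M := by
        refine lintegral_mono fun z => ?_
        gcongr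
        rw [← ofReal_norm]
        exact ENNReal.ofReal_le_ofReal (hM z)
    _ = (∫⁻ z, epker τ (x - z)) * ENNReal.ofReal M := lintegral_mul_const _ (by fun_prop)
    _ ≤ 1 * ENNReal.ofReal M := by
        gcongr
        exact lintegral_epker_sub_le τ x
    _ < ⊤ := by simp

/-- The mild formulation for the gradient of the potential. -/
lemma IsSource.potGrad_eq_pconv_add (hS : IsSource T K f v) {a t : ℝ} (ha : 0 < a) (hat : a < t)
    (ht : ENNReal.ofReal t < T) (x : Rn n) :
    potGrad T f (x, t) = pconv (t - a) (fun z => potGrad T f (z, a)) x +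
        dPot (timeCut (Ici a) v) x t := by
  have haT : ENNReal.ofReal a < T := (ENNReal.ofReal_le_ofReal hat.le).trans_lt ht
  have hwm : StronglyMeasurable fun z => potGrad T f (z, a) :=
    hS.stronglyMeasurable_potGrad.comp_measurable measurable_prodMk_right
  have hwM : ∀ z, ‖potGrad T f (z, a)‖ ≤ gradConst n * K / a := fun z => hS.norm_potGrad_le z ha haT
  have h1 := hasFDerivAt_pconv_of_hasFDerivAt (hS.stronglyMeasurable_dPot_slice a)
    (fun z => hS.norm_dPot_le z haT) (b' := fun z => gradMap (potGrad T f (z, a)))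
    (fun z => hS.hasFDerivAt_potGrad ha haT z) (gradMap.continuous.comp_stronglyMeasurable hwm)
    (M' := ‖(gradMap : GradVal n m →L[ℝ] Rn n →L[ℝ] Rn m)‖ * (gradConst n * K / a))
    (fun z => (gradMap.le_opNorm _).trans (by gcongr; exact hwM z)) (t - a) x
  have h2 := hasFDerivAt_pconv (hS.stronglyMeasurable_dPot_slice a)
    (fun z => hS.norm_dPot_le z haT) (sub_pos.2 hat) x
  rw [hS.potGrad_eq ha hat ht, h2.unique h1]
  congr 1
  have h3 : pconv (t - a) (fun z => gradMap (potGrad T f (z, a))) x =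
      gradMap (pconv (t - a) (fun z => potGrad T f (z, a)) x) := by
    have h4 := (gradMap : GradVal n m →L[ℝ] Rn n →L[ℝ] Rn m).integral_comp_comm
      (integrable_pconv_of_bounded hwm hwM (t - a) x)
    unfold pconv
    rw [← h4]
    simp only [map_smul]
  rw [h3, gradOf_gradMap]

end PotentialBounds

/-! ### Hölder bounds and the weak gradient of the potential -/

section Regularity
variable {m : ℕ} {T : ℝ≥0∞} {K : ℝ} {f : Rn n × ℝ → Rn m} {v : Rn n × ℝ → GradVal n m}

section Loc
variable {E : Type*} [NormedAddCommGroup E] [NormedSpace ℝ E]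

/-- Hölder continuity of a solution of the mild formulation started at time `t / 2`. -/
lemma norm_pconv_add_dPot_sub_le {b : Rn n → E} {g : Rn n × ℝ → E} {M B t : ℝ} (ht : 0 < t)
    (hb : StronglyMeasurable b) (hM : ∀ z, ‖b z‖ ≤ M) (hg : StronglyMeasurable g)
    (hB0 : 0 ≤ B) (hg0 : ∀ w : Rn n × ℝ, w.2 < t / 2 → g w = 0) (hB : ∀ w, ‖g w‖ ≤ B) (x y : Rn n) :
    ‖(pconv (t - t / 2) b x + dPot g x t) - (pconv (t - t / 2) b y + dPot g y t)‖ ≤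
      lipConst n * (2 * M + 4 * (B * t)) * min 1 ((‖x - y‖ / t) ^ (3 / 4 : ℝ)) := by
  have hM0 : 0 ≤ M := (norm_nonneg _).trans (hM 0)
  have hl := lipConst_ge_two n
  set d := ‖x - y‖ with hd
  have hd0 : 0 ≤ d := norm_nonneg _
  have hdt : 0 ≤ d / t := by positivity
  have h1 : ‖pconv (t - t / 2) b x - pconv (t - t / 2) b y‖ ≤
      lipConst n * (2 * M) * min 1 ((d / t) ^ (3 / 4 : ℝ)) := by
    refine (norm_pconv_sub_le hM hb (by linarith) x y).trans ?_
    have h2 : min 1 (d / (t - t / 2)) ≤ 2 * min 1 ((d / t) ^ (3 / 4 : ℝ)) := by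
      have h3 : d / (t - t / 2) = 2 * (d / t) := by
        rw [sub_half]
        field_simp
      rcases le_or_gt (d / t) 1 with hle | hgt
      · have h4 : d / t ≤ (d / t) ^ (3 / 4 : ℝ) := by
          have := Real.rpow_le_rpow_of_exponent_ge' hdt hle (by norm_num : (0 : ℝ) ≤ 3 / 4)
            (by norm_num : (3 / 4 : ℝ) ≤ 1)
          rwa [Real.rpow_one] at this
        have h5 : (d / t) ^ (3 / 4 : ℝ) ≤ 1 := Real.rpow_le_one hdt hle (by norm_num)
        rw [min_eq_right h5, h3]
        exact (min_le_right _ _).trans (by linarith)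
      · have h5 : 1 ≤ (d / t) ^ (3 / 4 : ℝ) := Real.one_le_rpow hgt.le (by norm_num)
        rw [min_eq_left h5]
        exact (min_le_left _ _).trans (by norm_num)
    calc _ ≤ lipConst n * M * (2 * min 1 ((d / t) ^ (3 / 4 : ℝ))) := by gcongr
      _ = _ := by ring
  have h2 : ‖dPot g x t - dPot g y t‖ ≤
      lipConst n * (4 * (B * t)) * min 1 ((d / t) ^ (3 / 4 : ℝ)) := by
    rw [mul_min_of_nonneg _ _ (by positivity)]
    refine le_min ?_ ?_
    · have h3 : ∀ x, ‖dPot g x t‖ ≤ B * t := by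
        intro x
        have h := (enorm_dPot_le g x t).trans (eDPot_enorm_le_of_bounded hg0 hB x t)
        rw [← ofReal_norm] at h
        rw [max_eq_right (by linarith)] at h
        have h4 := (ENNReal.ofReal_le_ofReal_iff
          (mul_nonneg hB0 (by linarith : 0 ≤ t - t / 2))).1 h
        refine h4.trans ?_
        gcongr
        linarith
      have hBt : 0 ≤ B * t := by positivity
      calc _ ≤ B * t + B * t := (norm_sub_le _ _).trans (add_le_add (h3 x) (h3 y))
        _ ≤ _ := by nlinarith
    · refine (norm_dPot_sub_le_of_bounded hg hB0 hg0 hB x y (by linarith)).trans ?_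
      have h3 : (t - t / 2) ^ (1 / 4 : ℝ) ≤ t ^ (1 / 4 : ℝ) :=
        Real.rpow_le_rpow (by linarith) (by linarith) (by norm_num)
      have h4 : t ^ (1 / 4 : ℝ) * t ^ (3 / 4 : ℝ) = t := by
        rw [← Real.rpow_add ht]
        norm_num
      calc _ ≤ 4 * lipConst n * B * (d ^ (3 / 4 : ℝ) * t ^ (1 / 4 : ℝ)) := by gcongr
        _ = _ := by
          rw [Real.div_rpow hd0 ht.le]
          have h5 : 0 < t ^ (3 / 4 : ℝ) := by positivity
          field_simp
          linear_combination (B * d ^ (3 / 4 : ℝ)) * h4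
  calc _ = ‖(pconv (t - t / 2) b x - pconv (t - t / 2) b y) + (dPot g x t - dPot g y t)‖ := by
        congr 1
        abel
    _ ≤ _ := (norm_add_le _ _).trans (add_le_add h1 h2)
    _ = _ := by ring

end Loc

/-- The constant in the Hölder bounds for the potential of a source and its gradient. -/
def regConst (n : ℕ) : ℝ := lipConst n * (4 * gradConst n + 2 * potConst n + 16)

lemma regConst_pos (n : ℕ) : 0 < regConst n := by
  have h1 := lipConst_ge_two n
  have h2 := potConst_pos n
  have h3 := gradConst_pos n
  unfold regConst
  positivity

lemma IsSource.norm_dPot_sub_le (hS : IsSource T K f v) {t : ℝ} (ht0 : 0 < t)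
    (ht : ENNReal.ofReal t < T) (x y : Rn n) :
    ‖dPot f x t - dPot f y t‖ ≤ regConst n * K * min 1 ((‖x - y‖ / t) ^ (3 / 4 : ℝ)) := by
  have hK := hS.pos
  have haT : ENNReal.ofReal (t / 2) < T :=
    (ENNReal.ofReal_le_ofReal (half_le_self ht0.le)).trans_lt ht
  have h1 : ∀ y, dPot f y t = _ := fun y => dPot_eq_pconv_add hS.sm (half_lt_self ht0)
    ((hS.eDPot_le y ht).trans_lt ENNReal.ofReal_lt_top)
  rw [h1 x, h1 y]
  refine (norm_pconv_add_dPot_sub_le ht0 (hS.stronglyMeasurable_dPot_slice (t / 2))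
    (fun z => hS.norm_dPot_le z haT) (stronglyMeasurable_timeCut measurableSet_Ici hS.sm)
    (by positivity) (timeCut_Ici_eq_zero (t / 2) f) (hS.norm_cut_le (half_pos ht0)) x y).trans ?_
  refine mul_le_mul_of_nonneg_right ?_ (by positivity)
  have h2 := lipConst_ge_two n
  have h3 := gradConst_pos n
  have h4 : K / (t / 2) * t = 2 * K := by field_simp
  rw [h4, regConst]
  calc lipConst n * (2 * (potConst n * K) + 4 * (2 * K))
      = lipConst n * (2 * potConst n + 8) * K := by ring
    _ ≤ _ := by
      refine mul_le_mul_of_nonneg_right (mul_le_mul_of_nonneg_left ?_ (by linarith)) hK.le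
      linarith

lemma IsSource.norm_potGrad_sub_le (hS : IsSource T K f v) {t : ℝ} (ht0 : 0 < t)
    (ht : ENNReal.ofReal t < T) (x y : Rn n) :
    ‖potGrad T f (x, t) - potGrad T f (y, t)‖ ≤
      regConst n * K / t * min 1 ((‖x - y‖ / t) ^ (3 / 4 : ℝ)) := by
  have hK := hS.pos
  have haT : ENNReal.ofReal (t / 2) < T :=
    (ENNReal.ofReal_le_ofReal (half_le_self ht0.le)).trans_lt ht
  rw [hS.potGrad_eq_pconv_add (half_pos ht0) (half_lt_self ht0) ht x,
    hS.potGrad_eq_pconv_add (half_pos ht0) (half_lt_self ht0) ht y]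
  refine (norm_pconv_add_dPot_sub_le ht0
    (hS.stronglyMeasurable_potGrad.comp_measurable measurable_prodMk_right)
    (fun z => hS.norm_potGrad_le z (half_pos ht0) haT)
    (stronglyMeasurable_timeCut measurableSet_Ici hS.sm_grad)
    (by positivity) (timeCut_Ici_eq_zero (t / 2) v) (hS.norm_cut_grad_le (half_pos ht0)) x y).trans ?_
  refine mul_le_mul_of_nonneg_right ?_ (by positivity)
  have h2 := lipConst_ge_two n
  have h3 := potConst_pos n
  have h4 : K / (t / 2) ^ 2 * t = 4 * (K / t) := by field_simp; norm_num
  have h5 : gradConst n * K / (t / 2) = 2 * gradConst n * (K / t) := by field_simp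
  rw [h4, h5, regConst]
  calc lipConst n * (2 * (2 * gradConst n * (K / t)) + 4 * (4 * (K / t)))
      = lipConst n * (4 * gradConst n + 16) * (K / t) := by ring
    _ ≤ lipConst n * (4 * gradConst n + 2 * potConst n + 16) * (K / t) := by
      gcongr
      linarith
    _ = _ := by ring

/-- The bound `t |d_{1/2} u|² ≤ C K²`. -/
lemma IsSource.fracSq_dPot_le (hn : 1 ≤ n) (hS : IsSource T K f v) {t : ℝ} (ht0 : 0 < t)
    (ht : ENNReal.ofReal t < T) (x : Rn n) :
    fracSq (fun z => dPot f z.1 z.2) x t ≤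
      ENNReal.ofReal (holderConst n * ((regConst n * K) ^ 2 / t)) :=
  odSq_fracGrad_le_of_holder hn ht0 fun y => hS.norm_dPot_sub_le ht0 ht x y

/-- The bound `t³ |d_{1/2} ∇u|² ≤ C K²`. -/
lemma IsSource.fracSq_potGrad_le (hn : 1 ≤ n) (hS : IsSource T K f v) {t : ℝ} (ht0 : 0 < t)
    (ht : ENNReal.ofReal t < T) (x : Rn n) :
    fracSq (potGrad T f) x t ≤
      ENNReal.ofReal (holderConst n * ((regConst n * K / t) ^ 2 / t)) :=
  odSq_fracGrad_le_of_holder hn ht0 fun y => hS.norm_potGrad_sub_le ht0 ht x y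

/-- The classical gradient is a weak gradient. -/
lemma IsSource.isWeakGrad_potGrad (hS : IsSource T K f v) :
    IsWeakGrad T (fun z => dPot f z.1 z.2) (potGrad T f) := by
  have hK := hS.pos
  have hg0 := gradConst_pos n
  have hum := stronglyMeasurable_dPot hS.sm
  have hwm := hS.stronglyMeasurable_potGrad
  refine ⟨locallyIntegrableOn_slab hum.aestronglyMeasurable fun c _ =>
    ⟨potConst n * K, fun w hw _ => hS.norm_dPot_le w.1 hw.2⟩,
    locallyIntegrableOn_slab hwm.aestronglyMeasurable fun c hc =>
    ⟨gradConst n * K / c, fun w hw hcw => (hS.norm_potGrad_le w.1 hw.1 hw.2).trans (by gcongr)⟩, ?_⟩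
  intro φ hφ hc hs j
  obtain ⟨c, hc0, hcs⟩ := exists_pos_le_of_tsupport_subset hc hs
  set e : Rn n := EuclideanSpace.single j 1 with he
  have hdc : Continuous fun w => fderiv ℝ φ w (e, 0) :=
    (hφ.continuous_fderiv (by simp)).clm_apply continuous_const
  have hdsup : tsupport (fun w => fderiv ℝ φ w (e, 0)) ⊆ tsupport φ :=
    tsupport_fderiv_apply_subset ℝ _
  set U : Rn n × ℝ → Rn m := (slab n T).indicator fun z => dPot f z.1 z.2 with hU
  have hUm : StronglyMeasurable U := hum.indicator (isOpen_slab n T).measurableSet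
  have hUb : ∀ w, ‖U w‖ ≤ potConst n * K := by
    intro w
    by_cases hw : w ∈ slab n T
    · rw [hU, indicator_of_mem hw]
      exact hS.norm_dPot_le w.1 hw.2
    · rw [hU, indicator_of_notMem hw, norm_zero]
      have := potConst_pos n
      positivity
  have hwb : ∀ w : Rn n × ℝ, c ≤ w.2 → ‖potGrad T f w‖ ≤ gradConst n * K / c := by
    intro w hw
    by_cases hws : w ∈ slab n T
    · exact (hS.norm_potGrad_le w.1 hws.1 hws.2).trans (by gcongr)
    · rw [potGrad_of_notMem hws, norm_zero]
      positivity
  have hwjm : StronglyMeasurable fun w => potGrad T f w j :=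
    (PiLp.proj 2 (fun _ : Fin n => Rn m) j : GradVal n m →L[ℝ] Rn m).continuous.comp_stronglyMeasurable
      hwm
  have hi1 : Integrable fun w => (fderiv ℝ φ w (e, 0)) • U w :=
    integrable_smul_of_tsupport hdc (hc.mono' ((subset_tsupport _).trans hdsup))
      (fun w hw => hcs w (hdsup hw)) hUm fun w _ => hUb w
  have hi2 : Integrable fun w => φ w • potGrad T f w j :=
    integrable_smul_of_tsupport hφ.continuous hc hcs hwjm
      fun w hw => (PiLp.norm_apply_le _ j).trans (hwb w hw)
  have e1 : ∫ z in slab n T, (fderiv ℝ φ z (e, 0)) • dPot f z.1 z.2 =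
      ∫ z, (fderiv ℝ φ z (e, 0)) • U z := by
    rw [← integral_indicator (isOpen_slab n T).measurableSet]
    congr 1
    ext1 z
    rw [hU]
    by_cases hz : z ∈ slab n T
    · simp only [indicator_of_mem hz]
    · simp only [indicator_of_notMem hz, smul_zero]
  have e2 : ∫ z in slab n T, φ z • potGrad T f z j = ∫ z, φ z • potGrad T f z j :=
    setIntegral_eq_integral_of_forall_compl_eq_zero fun w hw => by
      rw [potGrad_of_notMem hw, PiLp.zero_apply, smul_zero]
  rw [e1, e2, Measure.volume_eq_prod, integral_prod_symm _ hi1, integral_prod_symm _ hi2,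
    ← integral_neg]
  congr 1
  ext1 t
  by_cases ht : 0 < t ∧ ENNReal.ofReal t < T
  · have hUt : ∀ x, U (x, t) = dPot f x t := fun x => indicator_of_mem (s := slab n T) ht _
    simp only [hUt]
    have hφt : ∀ x, HasFDerivAt (fun x => φ (x, t))
        ((fderiv ℝ φ (x, t)).comp (ContinuousLinearMap.inl ℝ (Rn n) ℝ)) x := fun x =>
      ((hφ.differentiable (by simp)) (x, t)).hasFDerivAt.comp x (hasFDerivAt_prodMk_left x t)
    have hclosed : Topology.IsClosedEmbedding fun x : Rn n => (x, t) := by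
      refine ⟨isEmbedding_prodMkLeft t, ?_⟩
      have h1 : range (fun x : Rn n => (x, t)) = Prod.snd ⁻¹' {t} := by
        ext z
        exact ⟨fun ⟨x, hx⟩ => by rw [← hx]; rfl, fun hz => ⟨z.1, Prod.ext rfl (Eq.symm hz)⟩⟩
      rw [h1]
      exact isClosed_singleton.preimage continuous_snd
    have h2 : HasCompactSupport fun x => φ (x, t) := hc.comp_isClosedEmbedding hclosed
    have h2' : HasCompactSupport fun x => fderiv ℝ φ (x, t) (e, 0) :=
      HasCompactSupport.comp_isClosedEmbedding (f := fun w => fderiv ℝ φ w (e, 0))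
        (hc.mono' ((subset_tsupport _).trans hdsup)) hclosed
    have hslice : ∀ x, potGrad T f (x, t) j = fderiv ℝ (fun y => dPot f y t) x e := by
      intro x
      rw [potGrad_of_pos ht.1 ht.2, gradOf_apply]
    have hdiff : ∀ x, fderiv ℝ (fun x => φ (x, t)) x e = fderiv ℝ φ (x, t) (e, 0) := fun x => by
      rw [(hφt x).fderiv]
      simp
    have hint : ∀ {ψ : Rn n → ℝ} {F : Rn n → Rn m} {B : ℝ}, Continuous ψ → HasCompactSupport ψ →
        StronglyMeasurable F → (∀ x, ‖F x‖ ≤ B) → Integrable fun x => ψ x • F x := by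
      intro ψ F B h1 h2 h3 h4
      refine (((h1.integrable_of_hasCompactSupport h2).norm).mul_const B).mono'
        (h1.aestronglyMeasurable.smul h3.aestronglyMeasurable) (ae_of_all _ fun w => ?_)
      rw [norm_smul]
      have := h4 w
      gcongr
    have hcφ : Continuous fun x => φ (x, t) := hφ.continuous.comp (by fun_prop)
    have hus := hS.stronglyMeasurable_dPot_slice t
    have hub : ∀ x, ‖dPot f x t‖ ≤ potConst n * K := fun x => hS.norm_dPot_le x ht.2
    have key := integral_smul_fderiv_eq_neg_fderiv_smul_of_integrable (𝕜 := ℝ) (μ := volume)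
      (f := fun x => φ (x, t)) (g := fun x => dPot f x t) (v := e) ?_ ?_ ?_
      (fun x _ => (hφt x).differentiableAt)
      (fun x _ => (hS.hasFDerivAt_potGrad ht.1 ht.2 x).differentiableAt)
    · simp only [hslice]
      simp only [hdiff] at key
      rw [key, neg_neg]
    · simp only [hdiff]
      exact hint (hdc.comp (by fun_prop)) h2' hus hub
    · simp only [← hslice]
      exact hint hcφ h2 (hwjm.comp_measurable measurable_prodMk_right)
        fun x => (PiLp.norm_apply_le _ j).trans (hS.norm_potGrad_le x ht.1 ht.2)
    · exact hint hcφ h2 hus hub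
  · have h1 : ∀ x, U (x, t) = 0 := fun x => indicator_of_notMem (s := slab n T) ht _
    have h2 : ∀ x : Rn n, potGrad T f (x, t) = 0 := fun x => potGrad_of_notMem ht
    simp [h1, h2]

end Regularity

/-! ### Localized energy estimates and the Carleson bound for the potential -/

section Ball

/-- The constant comparing averages over balls with averages against Poisson kernels. -/
def ballConst (n : ℕ) : ℝ :=
  5 ^ (((n : ℝ) + 1) / 2) * (1 + (gammaConst n * (volume (Metric.ball (0 : Rn n) 1)).toReal)⁻¹)

lemma volume_ball_one_toReal_pos : 0 < (volume (Metric.ball (0 : Rn n) 1)).toReal :=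
  ENNReal.toReal_pos (Metric.measure_ball_pos volume _ one_pos).ne' measure_ball_lt_top.ne

lemma ballConst_pos (n : ℕ) : 0 < ballConst n := by
  have h1 := gammaConst_pos n
  have h2 := volume_ball_one_toReal_pos (n := n)
  unfold ballConst
  positivity

lemma volume_ball_mul_epker_zero (x : Rn n) {R : ℝ} (hR : 0 < R) :
    volume (Metric.ball x R) * epker R (0 : Rn n) =
      ENNReal.ofReal (gammaConst n * (volume (Metric.ball (0 : Rn n) 1)).toReal) := by
  have h1 := gammaConst_pos n
  rw [Measure.addHaar_ball_of_pos volume x hR, ← ENNReal.ofReal_toReal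
    (measure_ball_lt_top (μ := volume) (x := (0 : Rn n)) (r := 1)).ne, epker,
    ← ENNReal.ofReal_mul (by positivity), ← ENNReal.ofReal_mul (by positivity),
    ENNReal.toReal_ofReal ENNReal.toReal_nonneg, pker_of_pos hR, norm_zero, finrank_euclideanSpace,
    Fintype.card_fin]
  congr 1
  have h2 : (R ^ 2 + 0 ^ 2) ^ (((n : ℝ) + 1) / 2) = R ^ (n + 1) := by
    rw [zero_pow two_ne_zero, add_zero, ← Real.rpow_natCast R 2, ← Real.rpow_mul hR.le,
      ← Real.rpow_natCast R (n + 1)]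
    congr 1
    push_cast
    ring
  rw [h2, pow_succ]
  field_simp

lemma one_le_volume_ball_mul_epker (x : Rn n) {R : ℝ} (hR : 0 < R) {z : Rn n} (hz : ‖z‖ ≤ 2 * R) :
    1 ≤ ENNReal.ofReal (ballConst n) * (volume (Metric.ball x R) * epker R z) := by
  have h1 := gammaConst_pos n
  have h2 := volume_ball_one_toReal_pos (n := n)
  set A := gammaConst n * (volume (Metric.ball (0 : Rn n) 1)).toReal with hA
  have hA0 : 0 < A := by positivity
  have h3 : epker R (0 : Rn n) ≤ ENNReal.ofReal (5 ^ (((n : ℝ) + 1) / 2)) * epker R z := by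
    unfold epker
    rw [← ENNReal.ofReal_mul (by positivity)]
    refine ENNReal.ofReal_le_ofReal (pker_le_of_sq_le' hR le_rfl (by norm_num) ?_)
    rw [norm_zero]
    nlinarith [norm_nonneg z]
  calc (1 : ℝ≥0∞) = ENNReal.ofReal A⁻¹ * (volume (Metric.ball x R) * epker R (0 : Rn n)) := by
        rw [volume_ball_mul_epker_zero x hR, ← hA, ← ENNReal.ofReal_mul (by positivity),
          inv_mul_cancel₀ hA0.ne', ENNReal.ofReal_one]
    _ ≤ ENNReal.ofReal A⁻¹ * (volume (Metric.ball x R) *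
          (ENNReal.ofReal (5 ^ (((n : ℝ) + 1) / 2)) * epker R z)) := by gcongr
    _ = ENNReal.ofReal (5 ^ (((n : ℝ) + 1) / 2) * A⁻¹) * (volume (Metric.ball x R) * epker R z) := by
        rw [ENNReal.ofReal_mul (by positivity)]
        ring
    _ ≤ _ := by
        gcongr
        rw [ballConst, ← hA]
        gcongr
        linarith

/-- The mass in a ball of a Poisson kernel of smaller scale. -/
lemma setLIntegral_ball_epker_le (x z : Rn n) {t R : ℝ} (ht : 0 < t) (htR : t ≤ R) :
    ∫⁻ y in Metric.ball x R, epker t (y - z) ≤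
      ENNReal.ofReal (ballConst n) * (volume (Metric.ball x R) * epker R (x - z)) := by
  have hR := ht.trans_le htR
  rcases le_or_gt ‖x - z‖ (2 * R) with h | h
  · calc ∫⁻ y in Metric.ball x R, epker t (y - z) ≤ ∫⁻ y, epker t (y - z) :=
        setLIntegral_le_lintegral _ _
      _ = 1 := by rw [lintegral_sub_right_eq_self (fun y => epker t y) z, lintegral_epker ht]
      _ ≤ _ := one_le_volume_ball_mul_epker x hR h
  · calc ∫⁻ y in Metric.ball x R, epker t (y - z)
        ≤ ∫⁻ y in Metric.ball x R, ENNReal.ofReal (5 ^ (((n : ℝ) + 1) / 2)) * epker R (x - z) := by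
          refine setLIntegral_mono measurable_const fun y hy => ?_
          unfold epker
          rw [← ENNReal.ofReal_mul (by positivity)]
          refine ENNReal.ofReal_le_ofReal (pker_le_of_sq_le' ht htR (by norm_num) ?_)
          have h1 : ‖x - z‖ ≤ ‖y - x‖ + ‖y - z‖ := by
            calc ‖x - z‖ = ‖(y - z) - (y - x)‖ := by congr 1; abel
              _ ≤ _ := (norm_sub_le _ _).trans_eq (add_comm _ _)
          rw [Metric.mem_ball, dist_eq_norm] at hy
          have h2 : ‖x - z‖ / 2 ≤ ‖y - z‖ := by linarith
          nlinarith [sq_nonneg t, norm_nonneg (x - z)]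
      _ = ENNReal.ofReal (5 ^ (((n : ℝ) + 1) / 2)) * (volume (Metric.ball x R) * epker R (x - z)) := by
          rw [setLIntegral_const]
          ring
      _ ≤ _ := by
          gcongr
          have h1 := gammaConst_pos n
          have h2 := volume_ball_one_toReal_pos (n := n)
          exact le_mul_of_one_le_right (by positivity) (le_add_of_nonneg_right (by positivity))

/-- The mass of sources over a ball is controlled by a Poisson average. -/
lemma setLIntegral_ball_prod_le {φ : Rn n × ℝ → ℝ≥0∞} (hφ : Measurable φ) (x : Rn n) {R : ℝ}
    (hR : 0 < R) :
    ∫⁻ w in Metric.ball x (2 * R) ×ˢ univ, φ w ≤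
      ENNReal.ofReal (ballConst n) * volume (Metric.ball x R) *
        ∫⁻ w : Rn n × ℝ, epker R (x - w.1) * φ w := by
  have hm : Measurable fun w : Rn n × ℝ => epker R (x - w.1) * φ w :=
    Measurable.mul (by fun_prop) hφ
  rw [← lintegral_const_mul _ hm]
  calc ∫⁻ w in Metric.ball x (2 * R) ×ˢ univ, φ w
      ≤ ∫⁻ w in Metric.ball x (2 * R) ×ˢ univ, ENNReal.ofReal (ballConst n) *
          volume (Metric.ball x R) * (epker R (x - w.1) * φ w) := by
        refine setLIntegral_mono (hm.const_mul _) fun w hw => ?_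
        have h1 : ‖x - w.1‖ ≤ 2 * R := by
          have := hw.1
          rw [Metric.mem_ball, dist_comm, dist_eq_norm] at this
          exact this.le
        calc φ w = 1 * φ w := (one_mul _).symm
          _ ≤ (ENNReal.ofReal (ballConst n) * (volume (Metric.ball x R) * epker R (x - w.1))) * φ w := by
            gcongr
            exact one_le_volume_ball_mul_epker x hR h1
          _ = _ := by ring
    _ ≤ _ := setLIntegral_le_lintegral _ _

end Ball

section Slices
variable {E : Type*} [NormedAddCommGroup E] [NormedSpace ℝ E] {w : Rn n × ℝ → E}

lemma measurable_odSq_fracGrad_slice (hw : StronglyMeasurable w) :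
    Measurable fun p : ℝ × Rn n => odSq (fracGrad fun y => w (y, p.1)) p.2 := by
  have h1 : StronglyMeasurable (Function.uncurry fun (s : ℝ) (y : Rn n) => w (y, s)) :=
    hw.comp_measurable measurable_swap
  have h2 := measurable_odSq_fracGrad h1
  beta_reduce at h2
  exact h2

lemma measurable_odSq_fracGrad_slice_left (hw : StronglyMeasurable w) (t : ℝ) :
    Measurable fun y : Rn n => odSq (fracGrad fun y => w (y, t)) y := by
  have hsl : Measurable fun y : Rn n => (t, y) := by fun_prop
  have h := (measurable_odSq_fracGrad_slice hw).comp hsl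
  simp only [Function.comp_def] at h
  exact h

lemma measurable_fracSq (hw : StronglyMeasurable w) :
    Measurable (Function.uncurry fun y s => fracSq w y s) := by
  have hsw : Measurable fun p : Rn n × ℝ => (p.2, p.1) := by fun_prop
  have h := (measurable_odSq_fracGrad_slice hw).comp hsw
  simp only [Function.comp_def] at h
  exact h

end Slices

section Localization
variable {E : Type*} [NormedAddCommGroup E] [InnerProductSpace ℝ E]

/-- The constant in the Hölder bound for potentials of distant sources. -/
def farConst (n : ℕ) : ℝ := 8 + 2 * ((n : ℝ) + 1) * 100 ^ (((n : ℝ) + 1) / 2)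

/-- Potentials of sources at distance `R` are Lipschitz at scale `R`. -/
lemma norm_dPot_sub_le_of_far {g : Rn n × ℝ → E} (hg : StronglyMeasurable g)
    (hg0 : ∀ w : Rn n × ℝ, w.2 ≤ 0 → g w = 0) {M R : ℝ} (hM0 : 0 ≤ M) (hR : 0 < R)
    {x₀ : Rn n} (hfar : ∀ w : Rn n × ℝ, w.1 ∈ Metric.ball x₀ (2 * R) → g w = 0)
    (hM : ∀ x t, eDPot (fun w => ‖g w‖ₑ) x t ≤ ENNReal.ofReal M)
    (hA : ∀ x, ∫⁻ w : Rn n × ℝ, epker R (x - w.1) * ‖g w‖ₑ ≤ ENNReal.ofReal M)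
    {t : ℝ} (htR : t ≤ R) {y : Rn n} (hy : y ∈ Metric.ball x₀ R) (y' : Rn n) :
    ‖dPot g y t - dPot g y' t‖ ≤ farConst n * M * min 1 ((‖y - y'‖ / R) ^ (3 / 4 : ℝ)) := by
  set d := ‖y - y'‖ with hd
  have hd0 : 0 ≤ d := norm_nonneg _
  have hdR : 0 ≤ d / R := by positivity
  set C := 2 * ((n : ℝ) + 1) * 100 ^ (((n : ℝ) + 1) / 2) with hC
  have hC0 : 0 < C := by positivity
  have hfC : farConst n = 8 + C := rfl
  rcases le_or_gt d (R / 4) with hle | hgt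
  · have hd1 : d / R ≤ 1 := by
      rw [div_le_one hR]
      linarith
    have h4 : d / R ≤ (d / R) ^ (3 / 4 : ℝ) := by
      have := Real.rpow_le_rpow_of_exponent_ge' hdR hd1 (by norm_num : (0 : ℝ) ≤ 3 / 4)
        (by norm_num : (3 / 4 : ℝ) ≤ 1)
      rwa [Real.rpow_one] at this
    rw [min_eq_right (Real.rpow_le_one hdR hd1 (by norm_num))]
    have hi : ∀ y, Integrable fun w : Rn n × ℝ => pker (t - w.2) (y - w.1) • g w := fun y =>
      integrable_dPot hg ((hM y t).trans_lt ENNReal.ofReal_lt_top)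
    have h5 : ‖dPot g y t - dPot g y' t‖ₑ ≤ ENNReal.ofReal (C * (d / R) * M) := by
      unfold dPot
      rw [← integral_sub (hi y) (hi y')]
      refine (enorm_integral_le_lintegral_enorm _).trans ?_
      calc ∫⁻ w : Rn n × ℝ, ‖pker (t - w.2) (y - w.1) • g w - pker (t - w.2) (y' - w.1) • g w‖ₑ
          ≤ ∫⁻ w : Rn n × ℝ, ENNReal.ofReal (C * (d / R)) * (epker R (y - w.1) * ‖g w‖ₑ) := by
            refine lintegral_mono fun w => ?_
            by_cases hw : 0 < w.2 ∧ w.2 < t ∧ w.1 ∉ Metric.ball x₀ (2 * R)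
            · rw [← sub_smul, enorm_smul, ← mul_assoc]
              gcongr
              rw [epker, ← ENNReal.ofReal_mul (by positivity), Real.enorm_eq_ofReal_abs]
              refine ENNReal.ofReal_le_ofReal ?_
              have hdist : R ≤ ‖y - w.1‖ := by
                have h6 := hw.2.2
                rw [Metric.mem_ball, not_lt] at h6
                rw [Metric.mem_ball] at hy
                have h7 := dist_triangle w.1 y x₀
                rw [← dist_eq_norm, dist_comm]
                linarith
              have h8 : (y - w.1) - (y' - w.1) = y - y' := by abel
              have h9 := abs_pker_sub_pker_le_of_far (τ := t - w.2) (by linarith) (by linarith) hdist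
                (y := y' - w.1) (by rwa [h8]) (z := y - w.1) (by rw [sub_self, norm_zero]; positivity)
              rwa [h8] at h9
            · have h0 : pker (t - w.2) (y - w.1) • g w - pker (t - w.2) (y' - w.1) • g w = 0 := by
                rcases le_or_gt w.2 0 with h1 | h1
                · simp [hg0 w h1]
                rcases le_or_gt t w.2 with h2 | h2
                · simp [pker_of_nonpos (sub_nonpos.2 h2)]
                · have h3 : w.1 ∈ Metric.ball x₀ (2 * R) := by
                    by_contra h3
                    exact hw ⟨h1, h2, h3⟩
                  simp [hfar w h3]
              rw [h0, enorm_zero]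
              exact bot_le
        _ = ENNReal.ofReal (C * (d / R)) * ∫⁻ w : Rn n × ℝ, epker R (y - w.1) * ‖g w‖ₑ := by
            have hm : Measurable fun w : Rn n × ℝ => epker R (y - w.1) * ‖g w‖ₑ :=
              Measurable.mul (by fun_prop) hg.enorm
            exact lintegral_const_mul _ hm
        _ ≤ ENNReal.ofReal (C * (d / R)) * ENNReal.ofReal M := by
            gcongr
            exact hA y
        _ = _ := (ENNReal.ofReal_mul (by positivity)).symm
    rw [← ofReal_norm] at h5
    refine ((ENNReal.ofReal_le_ofReal_iff (by positivity)).1 h5).trans ?_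
    rw [hfC]
    calc C * (d / R) * M ≤ (8 + C) * (d / R) ^ (3 / 4 : ℝ) * M := by
          gcongr
          linarith
      _ = _ := by ring
  · have h1 : ∀ x, ‖dPot g x t‖ ≤ M := fun x => by
      have h := (enorm_dPot_le g x t).trans (hM x t)
      rw [← ofReal_norm] at h
      exact (ENNReal.ofReal_le_ofReal_iff hM0).1 h
    have h2 : (1 / 4 : ℝ) ≤ min 1 ((d / R) ^ (3 / 4 : ℝ)) := by
      refine le_min (by norm_num) ?_
      have h3 : (1 / 4 : ℝ) ≤ d / R := by
        rw [le_div_iff₀ hR]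
        linarith
      calc (1 / 4 : ℝ) = (1 / 4 : ℝ) ^ (1 : ℝ) := (Real.rpow_one _).symm
        _ ≤ (1 / 4 : ℝ) ^ (3 / 4 : ℝ) :=
          Real.rpow_le_rpow_of_exponent_ge (by norm_num) (by norm_num) (by norm_num)
        _ ≤ _ := Real.rpow_le_rpow (by norm_num) h3 (by norm_num)
    calc _ ≤ M + M := (norm_sub_le _ _).trans (add_le_add (h1 y) (h1 y'))
      _ = 8 * M * (1 / 4) := by ring
      _ ≤ _ := by
        rw [hfC]
        gcongr
        linarith

/-- Localized energy inequality: near sources are treated by the energy inequality, distant ones by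
their regularity. -/
lemma setLIntegral_odSq_fracGrad_dPot_le [CompleteSpace E] (hn : 1 ≤ n) {g : Rn n × ℝ → E}
    (hg : StronglyMeasurable g)
    (hg0 : ∀ w : Rn n × ℝ, w.2 ≤ 0 → g w = 0) {M R : ℝ} (hM0 : 0 ≤ M) (hR : 0 < R)
    (hM : ∀ x t, eDPot (fun w => ‖g w‖ₑ) x t ≤ ENNReal.ofReal M)
    (hA : ∀ x, ∫⁻ w : Rn n × ℝ, epker R (x - w.1) * ‖g w‖ₑ ≤ ENNReal.ofReal M)
    (x₀ : Rn n) {L : ℝ} (hLR : L ≤ R) :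
    ∫⁻ t in Ioo 0 L, ∫⁻ y in Metric.ball x₀ R, odSq (fracGrad fun y => dPot g y t) y ≤
      (ENNReal.ofReal (4 * ballConst n * M) *
          ∫⁻ w : Rn n × ℝ, epker R (x₀ - w.1) * ‖g w‖ₑ) * volume (Metric.ball x₀ R) +
        ENNReal.ofReal (2 * holderConst n * (farConst n * M) ^ 2 * (L / R)) *
          volume (Metric.ball x₀ R) := by
  -- `g₁` holds the sources over the ball of radius `2R`, `g₂` the sources at distance at least `R`
  -- from the ball of radius `R`
  set S : Set (Rn n × ℝ) := Metric.ball x₀ (2 * R) ×ˢ univ with hSdef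
  have hSm : MeasurableSet S := Metric.isOpen_ball.measurableSet.prod MeasurableSet.univ
  set g₁ := S.indicator g with hg₁
  set g₂ := Sᶜ.indicator g with hg₂
  have hg₁m : StronglyMeasurable g₁ := hg.indicator hSm
  have hg₂m : StronglyMeasurable g₂ := hg.indicator hSm.compl
  have hle : ∀ (A : Set (Rn n × ℝ)) w, ‖A.indicator g w‖ₑ ≤ ‖g w‖ₑ := fun A w => by
    rw [enorm_indicator_eq_indicator_enorm]
    exact indicator_le_self _ _ w
  have hMi : ∀ (A : Set (Rn n × ℝ)) x t, eDPot (fun w => ‖A.indicator g w‖ₑ) x t ≤ ENNReal.ofReal M :=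
    fun A x t => (eDPot_mono fun w _ => hle A w).trans (hM x t)
  have h0i : ∀ (A : Set (Rn n × ℝ)) (w : Rn n × ℝ), w.2 ≤ 0 → A.indicator g w = 0 := fun A w hw => by
    by_cases h : w ∈ A
    · rw [indicator_of_mem h, hg0 w hw]
    · rw [indicator_of_notMem h]
  have hAi : ∀ x, ∫⁻ w : Rn n × ℝ, epker R (x - w.1) * ‖g₂ w‖ₑ ≤ ENNReal.ofReal M := fun x =>
    (lintegral_mono fun w => by gcongr; exact hle _ w).trans (hA x)
  have hsplit : ∀ t, (fun y => dPot g y t) = (fun y => dPot g₁ y t) + fun y => dPot g₂ y t := by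
    intro t
    ext1 y
    have hi : ∀ A : Set (Rn n × ℝ), MeasurableSet A → Integrable fun w : Rn n × ℝ =>
        pker (t - w.2) (y - w.1) • A.indicator g w := fun A hA =>
      integrable_dPot (hg.indicator hA) ((hMi A y t).trans_lt ENNReal.ofReal_lt_top)
    rw [Pi.add_apply]
    unfold dPot
    rw [← integral_add (hi S hSm) (hi Sᶜ hSm.compl)]
    refine integral_congr_ae (ae_of_all _ fun w => ?_)
    simp only
    rw [← smul_add, ← Pi.add_apply, indicator_self_add_compl]
  have hd₁ := stronglyMeasurable_dPot hg₁m
  have hm₁ := measurable_odSq_fracGrad_slice hd₁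
  have hm₁t := measurable_odSq_fracGrad_slice_left hd₁
  set N : ℝ → ℝ≥0∞ := fun t => ∫⁻ y, odSq (fracGrad fun y => dPot g₁ y t) y with hN
  have hNm : Measurable N := hm₁.lintegral_prod_right'
  set c₂ : ℝ≥0∞ := ENNReal.ofReal (holderConst n * ((farConst n * M) ^ 2 / R)) with hc₂
  have hpt : ∀ t ∈ Ioo 0 L, ∫⁻ y in Metric.ball x₀ R, odSq (fracGrad fun y => dPot g y t) y ≤
      2 * N t + 2 * c₂ * volume (Metric.ball x₀ R) := by
    intro t ht
    have htR : t ≤ R := ht.2.le.trans hLR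
    calc ∫⁻ y in Metric.ball x₀ R, odSq (fracGrad fun y => dPot g y t) y
        ≤ ∫⁻ y in Metric.ball x₀ R, (2 * odSq (fracGrad fun y => dPot g₁ y t) y + 2 * c₂) := by
          refine setLIntegral_mono ?_ fun y hy => ?_
          · exact ((hm₁t t).const_mul 2).add_const _
          · rw [hsplit t]
            refine (odSq_fracGrad_add_le _ _ (stronglyMeasurable_dPot_left hg₁m t) y).trans ?_
            gcongr
            refine odSq_fracGrad_le_of_holder hn hR fun y' => ?_
            refine norm_dPot_sub_le_of_far hg₂m (h0i _) hM0 hR (fun w hw => ?_) (hMi _) hAi htR hy y'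
            have hwS : w ∈ S := ⟨hw, mem_univ _⟩
            exact indicator_of_notMem (not_not.2 hwS) _
      _ = 2 * (∫⁻ y in Metric.ball x₀ R, odSq (fracGrad fun y => dPot g₁ y t) y) +
            2 * c₂ * volume (Metric.ball x₀ R) := by
          rw [lintegral_add_right _ measurable_const, lintegral_const_mul _ (hm₁t t),
            setLIntegral_const]
      _ ≤ _ := by
          gcongr
          exact setLIntegral_le_lintegral _ _
  calc ∫⁻ t in Ioo 0 L, ∫⁻ y in Metric.ball x₀ R, odSq (fracGrad fun y => dPot g y t) y
      ≤ ∫⁻ t in Ioo 0 L, (2 * N t + 2 * c₂ * volume (Metric.ball x₀ R)) :=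
        setLIntegral_mono ((hNm.const_mul 2).add_const _) hpt
    _ = 2 * (∫⁻ t in Ioo 0 L, N t) + 2 * c₂ * volume (Metric.ball x₀ R) * ENNReal.ofReal L := by
        rw [lintegral_add_right _ measurable_const, lintegral_const_mul _ hNm, setLIntegral_const,
          Real.volume_Ioo, sub_zero]
    _ ≤ 2 * (2 * (ENNReal.ofReal M * ∫⁻ w, ‖g₁ w‖ₑ)) +
          2 * c₂ * volume (Metric.ball x₀ R) * ENNReal.ofReal L := by
        gcongr
        exact lintegral_odSq_fracGrad_dPot_le hg₁m (h0i S) (hMi S) L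
    _ ≤ _ := by
        refine add_le_add ?_ (le_of_eq ?_)
        · have h1 : ∫⁻ w, ‖g₁ w‖ₑ = ∫⁻ w in S, ‖g w‖ₑ := by
            rw [← lintegral_indicator hSm]
            refine lintegral_congr fun w => ?_
            rw [hg₁, enorm_indicator_eq_indicator_enorm]
          rw [h1]
          calc 2 * (2 * (ENNReal.ofReal M * ∫⁻ w in S, ‖g w‖ₑ))
              ≤ 2 * (2 * (ENNReal.ofReal M * (ENNReal.ofReal (ballConst n) *
                volume (Metric.ball x₀ R) * ∫⁻ w : Rn n × ℝ, epker R (x₀ - w.1) * ‖g w‖ₑ))) := by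
                gcongr
                exact setLIntegral_ball_prod_le hg.enorm x₀ hR
            _ = _ := by
                rw [ENNReal.ofReal_mul (mul_nonneg (by norm_num) (ballConst_pos n).le),
                  ENNReal.ofReal_mul (by norm_num), ENNReal.ofReal_ofNat]
                ring
        · have h2 : 2 * holderConst n * (farConst n * M) ^ 2 * (L / R) =
              2 * (holderConst n * ((farConst n * M) ^ 2 / R)) * L := by ring
          have := holderConst_nonneg n
          rw [h2, ENNReal.ofReal_mul (by positivity), ENNReal.ofReal_mul (by norm_num), ← hc₂,
            ENNReal.ofReal_ofNat]
          ring

end Localization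

section Carleson
variable {m : ℕ} {T : ℝ≥0∞} {K : ℝ} {f : Rn n × ℝ → Rn m} {v : Rn n × ℝ → GradVal n m}

/-- The constant in the Carleson bound for the potential of a source. -/
def carlConst (n : ℕ) : ℝ :=
  4 * ballConst n * potConst n + 2 * holderConst n * (farConst n * potConst n) ^ 2

lemma carlConst_pos (n : ℕ) : 0 < carlConst n := by
  have h1 := ballConst_pos n
  have h2 := potConst_pos n
  have h3 := holderConst_nonneg n
  unfold carlConst
  positivity

/-- Averages over space-time against a Poisson kernel in space, as iterated integrals. -/
lemma lintegral_epker_mul_timeCut {φ : Rn n × ℝ → ℝ≥0∞} (hφ : Measurable φ) {S : Set ℝ}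
    (hS : MeasurableSet S) (R : ℝ) (x : Rn n) :
    ∫⁻ w : Rn n × ℝ, epker R (x - w.1) * timeCut S φ w =
      ∫⁻ y, epker R (x - y) * ∫⁻ s in S, φ (y, s) := by
  have hm : Measurable fun w : Rn n × ℝ => epker R (x - w.1) * timeCut S φ w :=
    Measurable.mul (by fun_prop) (measurable_timeCut hS hφ)
  rw [Measure.volume_eq_prod, lintegral_prod _ hm.aemeasurable]
  refine lintegral_congr fun y => ?_
  have hm2 : Measurable fun s => timeCut S φ (y, s) :=
    (measurable_timeCut hS hφ).comp measurable_prodMk_left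
  change ∫⁻ s, epker R (x - y) * timeCut S φ (y, s) = _
  rw [lintegral_const_mul _ hm2, ← lintegral_indicator hS]
  rfl

/-- The Carleson bound for `|d_{1/2} u|²`. -/
lemma IsSource.boxMean_fracSq_dPot_le (hn : 1 ≤ n) (hS : IsSource T K f v) (x₀ : Rn n) {R : ℝ}
    (hR : 0 < R) (hRT : ENNReal.ofReal R < T) :
    boxMean (fun y s => fracSq (fun z => dPot f z.1 z.2) y s) x₀ R ≤
      ENNReal.ofReal (carlConst n * K ^ 2) := by
  have hK := hS.pos
  have hp1 : 1 ≤ potConst n := by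
    unfold potConst
    have : (0 : ℝ) < 4 ^ (((n : ℝ) + 1) / 2) := by positivity
    linarith
  have hum := stronglyMeasurable_dPot hS.sm
  have hmeas := measurable_fracSq hum
  rw [boxMean_eq hmeas, lintegral_lintegral_swap hmeas.aemeasurable]
  -- later sources do not matter, and the Carleson bound only covers times up to `R`
  set g := timeCut (Ioo 0 R) f with hg
  have hgm : StronglyMeasurable g := stronglyMeasurable_timeCut measurableSet_Ioo hS.sm
  have hgf : ∀ w : Rn n × ℝ, w.2 < R → f w = g w := fun w hw => by
    by_cases h0 : 0 < w.2
    · rw [hg, timeCut_of_mem (S := Ioo 0 R) ⟨h0, hw⟩]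
    · rw [hg, timeCut_of_notMem (S := Ioo 0 R) fun h => h0 h.1, hS.eq_zero (not_lt.1 h0)]
  have hgle : ∀ w, ‖g w‖ₑ ≤ ‖f w‖ₑ := fun w => by
    rw [hg, enorm_timeCut]
    exact timeCut_le _ _ w
  have havg : ∀ x, ∫⁻ w : Rn n × ℝ, epker R (x - w.1) * ‖g w‖ₑ ≤ ENNReal.ofReal K := by
    intro x
    simp only [hg, enorm_timeCut]
    rw [lintegral_epker_mul_timeCut hS.sm.enorm measurableSet_Ioo]
    exact hS.avg x R hR hRT
  have hKp : K ≤ potConst n * K := le_mul_of_one_le_left hK.le hp1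
  have key := setLIntegral_odSq_fracGrad_dPot_le hn hgm
    (fun w hw => timeCut_of_notMem (S := Ioo 0 R) fun h => (not_lt.2 hw) h.1)
    (M := potConst n * K) (by positivity) hR
    (eDPot_le_of_le_upTo hgm.enorm (R := R)
      (fun w hw => by
        rw [hg, timeCut_of_notMem (S := Ioo 0 R) fun h => (not_lt.2 hw) h.2, enorm_zero])
      fun x t ht => (eDPot_mono fun w _ => hgle w).trans
        (hS.eDPot_le x ((ENNReal.ofReal_le_ofReal ht).trans_lt hRT)))
    (fun x => (havg x).trans (ENNReal.ofReal_le_ofReal hKp)) x₀ le_rfl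
  have hV0 : volume (Metric.ball x₀ R) ≠ 0 := (Metric.measure_ball_pos volume _ hR).ne'
  have hVt : volume (Metric.ball x₀ R) ≠ ⊤ := measure_ball_lt_top.ne
  have hsame : ∫⁻ s in Ioo 0 R, ∫⁻ y in Metric.ball x₀ R, fracSq (fun z => dPot f z.1 z.2) y s =
      ∫⁻ t in Ioo 0 R, ∫⁻ y in Metric.ball x₀ R, odSq (fracGrad fun y => dPot g y t) y := by
    refine setLIntegral_congr_fun measurableSet_Ioo fun t ht => ?_
    have h1 : (fun y => dPot f y t) = fun y => dPot g y t := by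
      ext1 y
      exact dPot_congr fun w hw => hgf w (hw.trans ht.2)
    simp only [fracSq, h1]
  rw [hsame, ← div_eq_mul_inv]
  refine ENNReal.div_le_of_le_mul (key.trans ?_)
  rw [← add_mul]
  gcongr
  rw [div_self hR.ne', mul_one]
  have hh := holderConst_nonneg n
  have hb := ballConst_pos n
  calc _ ≤ ENNReal.ofReal (4 * ballConst n * (potConst n * K)) * ENNReal.ofReal K +
        ENNReal.ofReal (2 * holderConst n * (farConst n * (potConst n * K)) ^ 2) := by
        gcongr
        exact havg x₀
    _ = _ := by
      rw [← ENNReal.ofReal_mul (by positivity), ← ENNReal.ofReal_add (by positivity) (by positivity),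
        carlConst]
      congr 1
      ring

end Carleson

/-! ### The Carleson bound for the gradient of the potential -/

section GradCarleson
variable {m : ℕ} {T : ℝ≥0∞} {K : ℝ} {f : Rn n × ℝ → Rn m} {v : Rn n × ℝ → GradVal n m}

/-- Averaging a bound over the free starting time `a ∈ (t/4, t/2)` of a mild formulation. After
exchanging the integrals, `a` fixed leaves `t ∈ (2a, 4a)`, an interval of length comparable to `a`. -/
lemma lintegral_le_of_forall_start {R : ℝ} {F A : ℝ → ℝ≥0∞} {H : ℝ × ℝ → ℝ≥0∞} (hA : Measurable A)
    (hH : Measurable H)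
    (h : ∀ t ∈ Ioo 0 R, ∀ a ∈ Ioo (t / 4) (t / 2), F t ≤ A a + H (a, t)) :
    ∫⁻ t in Ioo 0 R, F t ≤ ∫⁻ a in Ioo 0 R, (4 * A a +
      ENNReal.ofReal (2 / a) * ∫⁻ t in Ioo 0 (min (4 * a) R), H (a, t)) := by
  set D : Set (ℝ × ℝ) := {p | 0 < p.1 ∧ 2 * p.1 < p.2 ∧ p.2 < 4 * p.1 ∧ p.2 < R} with hD
  have hDm : MeasurableSet D := by
    refine (measurableSet_lt measurable_const measurable_fst).inter
      ((measurableSet_lt (by fun_prop) measurable_snd).inter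
        ((measurableSet_lt measurable_snd (by fun_prop)).inter
          (measurableSet_lt measurable_snd measurable_const)))
  set J : ℝ × ℝ → ℝ≥0∞ := D.indicator fun p => ENNReal.ofReal (2 / p.1) * (A p.1 + H p) with hJ
  have hJm : Measurable J := by
    refine Measurable.indicator ?_ hDm
    exact Measurable.mul (by fun_prop) ((hA.comp measurable_fst).add hH)
  have h1 : ∀ t ∈ Ioo 0 R, F t ≤ ∫⁻ a, J (a, t) := by
    intro t ht
    -- `t / 4` is the length of the interval of starting times
    calc F t = ENNReal.ofReal (4 / t) * F t * volume (Ioo (t / 4) (t / 2)) := by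
          rw [Real.volume_Ioo, mul_right_comm, ← ENNReal.ofReal_mul (by have := ht.1; positivity)]
          have : 4 / t * (t / 2 - t / 4) = 1 := by
            have := ht.1.ne'
            field_simp
            norm_num
          rw [this, ENNReal.ofReal_one, one_mul]
      _ = ∫⁻ _ in Ioo (t / 4) (t / 2), ENNReal.ofReal (4 / t) * F t := (setLIntegral_const _ _).symm
      _ ≤ ∫⁻ a in Ioo (t / 4) (t / 2), J (a, t) := by
          refine setLIntegral_mono (hJm.comp measurable_prodMk_right) fun a ha => ?_
          have ht0 := ht.1
          have ha0 : 0 < a := (by positivity : 0 < t / 4).trans ha.1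
          have hmem : (a, t) ∈ D := by
            refine ⟨ha0, ?_, ?_, ht.2⟩
            · have := ha.2
              simp only
              linarith
            · have := ha.1
              simp only
              linarith
          rw [hJ, indicator_of_mem hmem]
          refine mul_le_mul' (ENNReal.ofReal_le_ofReal ?_) (h t ht a ha)
          rw [div_le_div_iff₀ ht0 ha0]
          have := ha.2
          linarith
      _ ≤ _ := setLIntegral_le_lintegral _ _
  have h2 : ∀ a ∈ Ioo 0 R, ∫⁻ t, J (a, t) ≤ 4 * A a +
      ENNReal.ofReal (2 / a) * ∫⁻ t in Ioo 0 (min (4 * a) R), H (a, t) := by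
    intro a ha
    have ha0 := ha.1
    have hHa : Measurable fun t => H (a, t) := hH.comp measurable_prodMk_left
    set P : ℝ → ℝ≥0∞ := (Ioo (2 * a) (4 * a)).indicator fun _ => ENNReal.ofReal (2 / a) * A a
    set Q : ℝ → ℝ≥0∞ := (Ioo 0 (min (4 * a) R)).indicator fun t => ENNReal.ofReal (2 / a) * H (a, t)
    have hP : Measurable P := measurable_const.indicator measurableSet_Ioo
    calc ∫⁻ t, J (a, t) ≤ ∫⁻ t, (P t + Q t) := by
          refine lintegral_mono fun t => ?_
          by_cases hm : (a, t) ∈ D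
          · have hmP : t ∈ Ioo (2 * a) (4 * a) := ⟨hm.2.1, hm.2.2.1⟩
            have hmQ : t ∈ Ioo 0 (min (4 * a) R) :=
              ⟨(by positivity : 0 < 2 * a).trans hm.2.1, lt_min hm.2.2.1 hm.2.2.2⟩
            simp only [hJ, P, Q]
            rw [indicator_of_mem hm, indicator_of_mem hmP, indicator_of_mem hmQ, mul_add]
          · rw [hJ, indicator_of_notMem hm]
            exact bot_le
      _ = _ := by
          rw [lintegral_add_left hP, lintegral_indicator measurableSet_Ioo,
            lintegral_indicator measurableSet_Ioo, lintegral_const_mul _ hHa, setLIntegral_const,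
            Real.volume_Ioo, mul_right_comm, ← ENNReal.ofReal_mul (by positivity)]
          congr 2
          have : 2 / a * (4 * a - 2 * a) = 4 := by
            field_simp
            norm_num
          rw [this, ENNReal.ofReal_ofNat]
  calc ∫⁻ t in Ioo 0 R, F t ≤ ∫⁻ t in Ioo 0 R, ∫⁻ a, J (a, t) :=
        setLIntegral_mono hJm.lintegral_prod_left' h1
    _ ≤ ∫⁻ t, ∫⁻ a, J (a, t) := setLIntegral_le_lintegral _ _
    _ = ∫⁻ a, ∫⁻ t, J (a, t) := lintegral_lintegral_swap (hJm.comp measurable_swap).aemeasurable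
    _ = ∫⁻ a in Ioo 0 R, ∫⁻ t, J (a, t) := by
        refine (setLIntegral_eq_of_support_subset ?_).symm
        intro a ha
        by_contra hna
        refine ha ?_
        have : ∀ t, J (a, t) = 0 := fun t => by
          refine indicator_of_notMem (fun hm => hna ⟨hm.1, ?_⟩) _
          have h3 := hm.1
          have h4 := hm.2.1
          have h5 := hm.2.2.2
          simp only at h3 h4 h5
          linarith
        simp [this]
    _ ≤ _ := by
        refine setLIntegral_mono' measurableSet_Ioo h2

lemma stronglyMeasurable_dPot_cut {E : Type*} [NormedAddCommGroup E] [NormedSpace ℝ E]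
    {g : Rn n × ℝ → E} (hg : StronglyMeasurable g) :
    StronglyMeasurable (Function.uncurry fun (p : ℝ × ℝ) (y : Rn n) =>
      dPot (timeCut (Ici p.1) g) y p.2) := by
  have hset : MeasurableSet {q : ((ℝ × ℝ) × Rn n) × (Rn n × ℝ) | q.1.1.1 ≤ q.2.2} :=
    measurableSet_le (by fun_prop) (by fun_prop)
  have h1 : StronglyMeasurable fun q : ((ℝ × ℝ) × Rn n) × (Rn n × ℝ) =>
      timeCut (Ici q.1.1.1) g q.2 := (hg.comp_measurable measurable_snd).indicator hset
  have hk : Measurable fun q : ((ℝ × ℝ) × Rn n) × (Rn n × ℝ) =>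
      pker (q.1.1.2 - q.2.2) (q.1.2 - q.2.1) := by fun_prop
  exact (hk.stronglyMeasurable.smul h1).integral_prod_right'

lemma measurable_setLIntegral_odSq_cut {E : Type*} [NormedAddCommGroup E] [NormedSpace ℝ E]
    {g : Rn n × ℝ → E} (hg : StronglyMeasurable g) (x₀ : Rn n) (R : ℝ) :
    Measurable fun p : ℝ × ℝ => ∫⁻ y in Metric.ball x₀ R,
      odSq (fracGrad fun y => dPot (timeCut (Ici p.1) g) y p.2) y := by
  have h := measurable_odSq_fracGrad (stronglyMeasurable_dPot_cut hg)
  beta_reduce at h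
  exact h.lintegral_prod_right'

/-- The part of the gradient that comes from the sources before time `a`. -/
lemma IsSource.setLIntegral_odSq_early_le (hS : IsSource T K f v) {a t R : ℝ}
    (ha : a ∈ Ioo (t / 4) (t / 2)) (ht : t ∈ Ioo 0 R) (hRT : ENNReal.ofReal R < T) (x₀ : Rn n) :
    ENNReal.ofReal t ^ 2 * ∫⁻ y in Metric.ball x₀ R,
        odSq (fracGrad fun y => gradOf (∫ z, (kgrad (t - a) (y - z)).smulRight (dPot f z a))) y ≤
      ENNReal.ofReal (4 * n * ((n : ℝ) + 1) ^ 2 * ballConst n) * volume (Metric.ball x₀ R) *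
        ∫⁻ z, epker R (x₀ - z) * fracSq (fun z => dPot f z.1 z.2) z a := by
  have ht0 := ht.1
  have ha1 := ha.1
  have ha2 := ha.2
  have hτ : 0 < t - a := by linarith
  have haT : ENNReal.ofReal a < T :=
    (ENNReal.ofReal_le_ofReal (by have := ht.2; linarith)).trans_lt hRT
  set c : ℝ := Real.sqrt n * (((n : ℝ) + 1) / (t - a)) with hc
  have hc0 : 0 ≤ c := by positivity
  have hb := hS.stronglyMeasurable_dPot_slice a
  set b : Rn n → Rn m := fun z => dPot f z a with hbdef
  set O : Rn n → ℝ≥0∞ := fun z => odSq (fracGrad b) z with hO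
  have hOm : Measurable O :=
    measurable_odSq_fracGrad_slice_left (stronglyMeasurable_dPot hS.sm) a
  have hpt : ∀ y, odSq (fracGrad fun y =>
      gradOf (∫ z, (kgrad (t - a) (y - z)).smulRight (dPot f z a))) y ≤
        ENNReal.ofReal (c ^ 2) * ∫⁻ z, epker (t - a) (y - z) * O z := by
    intro y
    have h1 := odSq_fracGrad_le_of_convolution
      (κ := fun h : Rn n => ENNReal.ofReal c * epker (t - a) h) (by fun_prop) hb
      (Q := fun y => gradOf (∫ z, (kgrad (t - a) (y - z)).smulRight (dPot f z a))) (fun x y => by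
        have h2 := enorm_fderiv_pconv_sub_le hb (fun z => hS.norm_dPot_le z haT) hτ x y
        rw [← gradOf_sub]
        calc _ ≤ ENNReal.ofReal (Real.sqrt n) *
              ‖(∫ z, (kgrad (t - a) (x - z)).smulRight (b z)) -
                ∫ z, (kgrad (t - a) (y - z)).smulRight (b z)‖ₑ := by
              rw [← ofReal_norm, ← ofReal_norm, ← ENNReal.ofReal_mul (by positivity)]
              exact ENNReal.ofReal_le_ofReal (norm_gradOf_le _)
          _ ≤ ENNReal.ofReal (Real.sqrt n) * ∫⁻ h, ENNReal.ofReal (((n : ℝ) + 1) / (t - a)) *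
                epker (t - a) h * ‖b (x - h) - b (y - h)‖ₑ := by gcongr
          _ = _ := by
              rw [← lintegral_const_mul' _ _ ENNReal.ofReal_ne_top]
              refine lintegral_congr fun h => ?_
              rw [hc, ENNReal.ofReal_mul (Real.sqrt_nonneg _)]
              ring) y
    refine h1.trans (le_of_eq ?_)
    rw [lintegral_const_mul _ (by fun_prop), lintegral_epker hτ, mul_one, pow_two,
      ENNReal.ofReal_mul hc0, mul_assoc]
    congr 1
    rw [← lintegral_const_mul' _ _ ENNReal.ofReal_ne_top,
      ← lintegral_sub_left_eq_self (fun h => ENNReal.ofReal c * epker (t - a) h * O (y - h)) y]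
    refine lintegral_congr fun z => ?_
    rw [sub_sub_cancel, mul_assoc]
  have hm2 : Measurable fun p : Rn n × Rn n => epker (t - a) (p.1 - p.2) * O p.2 :=
    Measurable.mul (by fun_prop) (hOm.comp measurable_snd)
  have hfub : ∫⁻ y in Metric.ball x₀ R, ∫⁻ z, epker (t - a) (y - z) * O z ≤
      ENNReal.ofReal (ballConst n) * volume (Metric.ball x₀ R) * ∫⁻ z, epker R (x₀ - z) * O z := by
    rw [lintegral_lintegral_swap hm2.aemeasurable,
      ← lintegral_const_mul' _ _ (ENNReal.mul_ne_top ENNReal.ofReal_ne_top measure_ball_lt_top.ne)]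
    refine lintegral_mono fun z => ?_
    rw [lintegral_mul_const _ (by fun_prop)]
    calc _ ≤ ENNReal.ofReal (ballConst n) * (volume (Metric.ball x₀ R) * epker R (x₀ - z)) * O z := by
          gcongr
          exact setLIntegral_ball_epker_le x₀ z hτ (by have := ht.2; linarith)
      _ = _ := by ring
  have hc2 : t ^ 2 * c ^ 2 ≤ 4 * n * ((n : ℝ) + 1) ^ 2 := by
    have h1 : t / (t - a) ≤ 2 := by
      rw [div_le_iff₀ hτ]
      linarith
    have h0 : 0 ≤ t / (t - a) := by positivity
    have h2 : t ^ 2 * c ^ 2 = n * ((n : ℝ) + 1) ^ 2 * (t / (t - a)) ^ 2 := by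
      rw [hc, mul_pow, Real.sq_sqrt (by positivity)]
      ring
    rw [h2]
    have h3 : (t / (t - a)) ^ 2 ≤ 2 ^ 2 := by gcongr
    calc n * ((n : ℝ) + 1) ^ 2 * (t / (t - a)) ^ 2 ≤ n * ((n : ℝ) + 1) ^ 2 * 2 ^ 2 := by gcongr
      _ = _ := by ring
  calc _ ≤ ENNReal.ofReal t ^ 2 * ∫⁻ y in Metric.ball x₀ R,
          ENNReal.ofReal (c ^ 2) * ∫⁻ z, epker (t - a) (y - z) * O z := by
        gcongr with y
        exact hpt y
    _ = ENNReal.ofReal (t ^ 2 * c ^ 2) *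
          ∫⁻ y in Metric.ball x₀ R, ∫⁻ z, epker (t - a) (y - z) * O z := by
        rw [lintegral_const_mul' _ _ ENNReal.ofReal_ne_top, ← mul_assoc,
          ENNReal.ofReal_mul (by positivity), ENNReal.ofReal_pow ht0.le]
    _ ≤ ENNReal.ofReal (4 * n * ((n : ℝ) + 1) ^ 2) * (ENNReal.ofReal (ballConst n) *
          volume (Metric.ball x₀ R) * ∫⁻ z, epker R (x₀ - z) * O z) := by gcongr
    _ = _ := by
        rw [ENNReal.ofReal_mul (p := 4 * n * ((n : ℝ) + 1) ^ 2) (by positivity)]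
        simp only [hO, fracSq, hbdef]
        ring

/-- The part of the gradient that comes from the sources after time `a`, over times comparable
to `a`. -/
lemma IsSource.setLIntegral_odSq_late_le (hn : 1 ≤ n) (hS : IsSource T K f v) {a R : ℝ}
    (ha : 0 < a) (haR : a < R) (x₀ : Rn n) :
    ∫⁻ t in Ioo 0 (min (4 * a) R), ∫⁻ y in Metric.ball x₀ R,
        odSq (fracGrad fun y => dPot (timeCut (Ici a) v) y t) y ≤
      (ENNReal.ofReal (12 * ballConst n * K / a) *
          (∫⁻ w : Rn n × ℝ, epker R (x₀ - w.1) * ‖timeCut (Ico a (min (4 * a) R)) v w‖ₑ) +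
        ENNReal.ofReal (72 * holderConst n * farConst n ^ 2 * K ^ 2 / (a * R))) *
          volume (Metric.ball x₀ R) := by
  have hK := hS.pos
  have hR := ha.trans haR
  have hh := holderConst_nonneg n
  set L := min (4 * a) R with hL
  have hLR : L ≤ R := min_le_right _ _
  have hL4 : L ≤ 4 * a := min_le_left _ _
  have haL : a < L := lt_min (by linarith) haR
  -- sources after time `L` are not felt before time `L`
  set g := timeCut (Ico a L) v with hg
  have hgm : StronglyMeasurable g := stronglyMeasurable_timeCut measurableSet_Ico hS.sm_grad
  have hgle : ∀ w, ‖g w‖ₑ ≤ ‖timeCut (Ici a) v w‖ₑ := by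
    intro w
    by_cases h : w.2 ∈ Ico a L
    · rw [hg, timeCut_of_mem h, timeCut_of_mem (S := Ici a) h.1]
    · rw [hg, timeCut_of_notMem h, enorm_zero]
      exact bot_le
  have hA : ∀ x, ∫⁻ w : Rn n × ℝ, epker R (x - w.1) * ‖g w‖ₑ ≤ ENNReal.ofReal (3 * K / a) := by
    intro x
    simp only [hg, enorm_timeCut]
    rw [lintegral_epker_mul_timeCut hS.sm_grad.enorm measurableSet_Ico]
    calc ∫⁻ y, epker R (x - y) * ∫⁻ s in Ico a L, ‖v (y, s)‖ₑ
        ≤ ∫⁻ y, epker R (x - y) * ENNReal.ofReal (3 * K / a) := by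
          refine lintegral_mono fun y => ?_
          gcongr
          calc ∫⁻ s in Ico a L, ‖v (y, s)‖ₑ ≤ ∫⁻ _ in Ico a L, ENNReal.ofReal (K / a ^ 2) := by
                refine setLIntegral_mono measurable_const fun s hs => ?_
                rw [← ofReal_norm]
                exact ENNReal.ofReal_le_ofReal (hS.norm_grad_le ha hs.1)
            _ = ENNReal.ofReal (K / a ^ 2 * (L - a)) := by
                rw [setLIntegral_const, Real.volume_Ico, ← ENNReal.ofReal_mul (by positivity)]
            _ ≤ _ := by
                refine ENNReal.ofReal_le_ofReal ?_
                calc K / a ^ 2 * (L - a) ≤ K / a ^ 2 * (3 * a) := by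
                      gcongr
                      linarith
                  _ = _ := by field_simp
      _ = (∫⁻ y, epker R (x - y)) * ENNReal.ofReal (3 * K / a) := lintegral_mul_const _ (by fun_prop)
      _ = _ := by rw [lintegral_epker_sub hR, one_mul]
  have hM : ∀ x t, eDPot (fun w => ‖g w‖ₑ) x t ≤ ENNReal.ofReal (3 * K / a) := fun x t =>
    ((eDPot_mono fun w _ => hgle w).trans (hS.eDPot_cut_grad_le ha x t)).trans
      (ENNReal.ofReal_le_ofReal (by gcongr; linarith))
  have key := setLIntegral_odSq_fracGrad_dPot_le hn hgm
    (fun w hw => timeCut_of_notMem (S := Ico a L) fun h => absurd (ha.trans_le h.1) (not_lt.2 hw))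
    (by positivity) hR hM hA x₀ hLR
  have hsame : ∫⁻ t in Ioo 0 L, ∫⁻ y in Metric.ball x₀ R,
      odSq (fracGrad fun y => dPot (timeCut (Ici a) v) y t) y =
      ∫⁻ t in Ioo 0 L, ∫⁻ y in Metric.ball x₀ R, odSq (fracGrad fun y => dPot g y t) y := by
    refine setLIntegral_congr_fun measurableSet_Ioo fun t ht => ?_
    have h1 : (fun y => dPot (timeCut (Ici a) v) y t) = fun y => dPot g y t := by
      ext1 y
      refine dPot_congr fun w hw => ?_
      by_cases hwa : a ≤ w.2
      · rw [hg, timeCut_of_mem (S := Ici a) hwa,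
          timeCut_of_mem (S := Ico a L) ⟨hwa, hw.trans ht.2⟩]
      · rw [hg, timeCut_of_notMem (S := Ici a) hwa,
          timeCut_of_notMem (S := Ico a L) fun h => hwa h.1]
    simp only [h1]
  rw [hsame]
  refine key.trans ?_
  rw [← add_mul]
  gcongr ?_ * _
  refine add_le_add (le_of_eq ?_) (ENNReal.ofReal_le_ofReal ?_)
  · congr 2
    ring
  · calc 2 * holderConst n * (farConst n * (3 * K / a)) ^ 2 * (L / R)
        ≤ 2 * holderConst n * (farConst n * (3 * K / a)) ^ 2 * (4 * a / R) := by gcongr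
      _ = _ := by
        field_simp
        ring

/-- Integrating over the starting time turns `|v|` into `s |v|`: a source at time `s` is active only
for starting times `a ≤ s`. -/
lemma IsSource.lintegral_epker_mul_cut_le (hS : IsSource T K f v) {R : ℝ} (hR : 0 < R)
    (hRT : ENNReal.ofReal R < T) (x₀ : Rn n) :
    ∫⁻ a in Ioo 0 R, ∫⁻ w : Rn n × ℝ, epker R (x₀ - w.1) *
      ‖timeCut (Ico a (min (4 * a) R)) v w‖ₑ ≤ ENNReal.ofReal K := by
  have hset : MeasurableSet {q : ℝ × (Rn n × ℝ) | q.1 ≤ q.2.2 ∧ q.2.2 < min (4 * q.1) R} :=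
    MeasurableSet.inter (s₁ := {q : ℝ × (Rn n × ℝ) | q.1 ≤ q.2.2})
      (s₂ := {q : ℝ × (Rn n × ℝ) | q.2.2 < min (4 * q.1) R})
      (measurableSet_le (by fun_prop) (by fun_prop))
      (measurableSet_lt (by fun_prop) (by fun_prop))
  have hm : Measurable fun q : ℝ × (Rn n × ℝ) =>
      timeCut (Ico q.1 (min (4 * q.1) R)) (fun w => ‖v w‖ₑ) q.2 :=
    (hS.sm_grad.enorm.comp measurable_snd).indicator hset
  have hm2 : Measurable fun q : ℝ × (Rn n × ℝ) => epker R (x₀ - q.2.1) *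
      timeCut (Ico q.1 (min (4 * q.1) R)) (fun w => ‖v w‖ₑ) q.2 :=
    Measurable.mul (by fun_prop) hm
  simp only [enorm_timeCut]
  rw [lintegral_lintegral_swap hm2.aemeasurable]
  calc ∫⁻ w : Rn n × ℝ, ∫⁻ a in Ioo 0 R, epker R (x₀ - w.1) *
        timeCut (Ico a (min (4 * a) R)) (fun w => ‖v w‖ₑ) w
      ≤ ∫⁻ w : Rn n × ℝ, epker R (x₀ - w.1) *
          timeCut (Ioo 0 R) (fun w => ENNReal.ofReal w.2 * ‖v w‖ₑ) w := by
        refine lintegral_mono fun w => ?_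
        have hmw : Measurable fun a => timeCut (Ico a (min (4 * a) R)) (fun w => ‖v w‖ₑ) w :=
          hm.comp measurable_prodMk_right
        rw [lintegral_const_mul _ hmw]
        gcongr
        by_cases hw : w.2 ∈ Ioo 0 R
        · rw [timeCut_of_mem hw]
          calc ∫⁻ a in Ioo 0 R, timeCut (Ico a (min (4 * a) R)) (fun w => ‖v w‖ₑ) w
              ≤ ∫⁻ a, (Ioc 0 w.2).indicator (fun _ => ‖v w‖ₑ) a := by
                rw [← lintegral_indicator measurableSet_Ioo]
                refine lintegral_mono fun a => ?_
                by_cases ha : a ∈ Ioo 0 R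
                · rw [indicator_of_mem ha]
                  by_cases haw : a ≤ w.2
                  · rw [indicator_of_mem (s := Ioc 0 w.2) ⟨ha.1, haw⟩]
                    exact timeCut_le _ _ w
                  · rw [timeCut_of_notMem (S := Ico a (min (4 * a) R)) fun h => haw h.1]
                    exact bot_le
                · rw [indicator_of_notMem ha]
                  exact bot_le
            _ = _ := by
                rw [lintegral_indicator measurableSet_Ioc, setLIntegral_const, Real.volume_Ioc,
                  sub_zero, mul_comm]
        · have h0 : ∀ a ∈ Ioo 0 R, timeCut (Ico a (min (4 * a) R)) (fun w => ‖v w‖ₑ) w = 0 :=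
            fun a ha => timeCut_of_notMem (S := Ico a (min (4 * a) R)) fun h =>
              hw ⟨ha.1.trans_le h.1, h.2.trans_le (min_le_right _ _)⟩
          rw [setLIntegral_congr_fun measurableSet_Ioo h0]
          simp
    _ = ∫⁻ y, epker R (x₀ - y) * ∫⁻ s in Ioo 0 R, ENNReal.ofReal s * ‖v (y, s)‖ₑ := by
        have h1 : Measurable fun w : Rn n × ℝ => ENNReal.ofReal w.2 * ‖v w‖ₑ :=
          Measurable.mul (by fun_prop) hS.sm_grad.enorm
        exact lintegral_epker_mul_timeCut h1 measurableSet_Ioo R x₀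
    _ ≤ _ := hS.avg_grad x₀ R hR hRT

/-- The constant in the Carleson bound for the gradient of the potential of a source. -/
def gradCarlConst (n : ℕ) : ℝ :=
  32 * n * ((n : ℝ) + 1) ^ 2 * ballConst n * (3 ^ (((n : ℝ) + 1) / 2) * carlConst n) +
    (768 * ballConst n + 4608 * holderConst n * farConst n ^ 2)

/-- The Carleson bound for `s² |d_{1/2} ∇u|²`. -/
lemma IsSource.boxMean_fracSq_potGrad_le (hn : 1 ≤ n) (hS : IsSource T K f v) (x₀ : Rn n) {R : ℝ}
    (hR : 0 < R) (hRT : ENNReal.ofReal R < T) :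
    boxMean (fun y s => ENNReal.ofReal s ^ 2 * fracSq (potGrad T f) y s) x₀ R ≤
      ENNReal.ofReal (gradCarlConst n * K ^ 2) := by
  have hK := hS.pos
  have hh := holderConst_nonneg n
  have hb := ballConst_pos n
  have hcl := carlConst_pos n
  have hum := stronglyMeasurable_dPot hS.sm
  have hu := measurable_fracSq hum
  have hwm := hS.stronglyMeasurable_potGrad
  have hwf := measurable_fracSq hwm
  have hmeas : Measurable (Function.uncurry fun (y : Rn n) s =>
      ENNReal.ofReal s ^ 2 * fracSq (potGrad T f) y s) :=
    Measurable.mul (f := fun p : Rn n × ℝ => ENNReal.ofReal p.2 ^ 2) (by fun_prop) hwf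
  set V := volume (Metric.ball x₀ R) with hV
  set Ψ : ℝ → ℝ≥0∞ := fun a => ∫⁻ z, epker R (x₀ - z) * fracSq (fun z => dPot f z.1 z.2) z a with hΨ
  have hΨm2 : Measurable fun p : Rn n × ℝ => epker R (x₀ - p.1) *
      fracSq (fun z => dPot f z.1 z.2) p.1 p.2 := Measurable.mul (by fun_prop) hu
  have hΨm : Measurable Ψ := hΨm2.lintegral_prod_left'
  set Θ : ℝ × ℝ → ℝ≥0∞ := fun p => ∫⁻ y in Metric.ball x₀ R,
      odSq (fracGrad fun y => dPot (timeCut (Ici p.1) v) y p.2) y with hΘ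
  have hΘm : Measurable Θ := measurable_setLIntegral_odSq_cut hS.sm_grad x₀ R
  set c₁ := ENNReal.ofReal (4 * n * ((n : ℝ) + 1) ^ 2 * ballConst n) with hc₁
  have hpt : ∀ t ∈ Ioo 0 R, ∀ a ∈ Ioo (t / 4) (t / 2),
      ENNReal.ofReal t ^ 2 * ∫⁻ y in Metric.ball x₀ R, fracSq (potGrad T f) y t ≤
        2 * (c₁ * V * Ψ a) + 2 * (ENNReal.ofReal t ^ 2 * Θ (a, t)) := by
    intro t ht a ha
    have ht0 := ht.1
    have ha0 : 0 < a := (by positivity : 0 < t / 4).trans ha.1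
    have hat : a < t := by have := ha.2; linarith
    have htT : ENNReal.ofReal t < T := (ENNReal.ofReal_le_ofReal ht.2.le).trans_lt hRT
    have haT : ENNReal.ofReal a < T := (ENNReal.ofReal_le_ofReal hat.le).trans_lt htT
    set Q : Rn n → GradVal n m :=
      fun y => gradOf (∫ z, (kgrad (t - a) (y - z)).smulRight (dPot f z a)) with hQ
    set D : Rn n → GradVal n m := fun y => dPot (timeCut (Ici a) v) y t with hD
    have hdec : (fun y => potGrad T f (y, t)) = Q + D := by
      ext1 y
      exact hS.potGrad_eq ha0 hat htT y
    have hDm : StronglyMeasurable D := stronglyMeasurable_dPot_left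
      (stronglyMeasurable_timeCut measurableSet_Ici hS.sm_grad) t
    have hQm : StronglyMeasurable Q := by
      have h1 : Q = (fun y => potGrad T f (y, t)) - D := by rw [hdec, add_sub_cancel_right]
      rw [h1]
      exact (hwm.comp_measurable measurable_prodMk_right).sub hDm
    have hDo : Measurable fun y => odSq (fracGrad D) y :=
      measurable_odSq_fracGrad_slice_left (stronglyMeasurable_dPot
        (stronglyMeasurable_timeCut measurableSet_Ici hS.sm_grad)) t
    calc ENNReal.ofReal t ^ 2 * ∫⁻ y in Metric.ball x₀ R, fracSq (potGrad T f) y t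
        ≤ ENNReal.ofReal t ^ 2 * ∫⁻ y in Metric.ball x₀ R,
            (2 * odSq (fracGrad Q) y + 2 * odSq (fracGrad D) y) := by
          gcongr with y
          unfold fracSq
          rw [hdec]
          exact odSq_fracGrad_add_le Q D hQm y
      _ = 2 * (ENNReal.ofReal t ^ 2 * ∫⁻ y in Metric.ball x₀ R, odSq (fracGrad Q) y) +
            2 * (ENNReal.ofReal t ^ 2 * Θ (a, t)) := by
          rw [lintegral_add_right _ (hDo.const_mul 2), lintegral_const_mul' _ _ (by norm_num),
            lintegral_const_mul' _ _ (by norm_num)]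
          simp only [hΘ, ← hD]
          ring
      _ ≤ _ := by
          gcongr 2 * ?_ + _
          exact hS.setLIntegral_odSq_early_le ha ht hRT x₀
  have havg := lintegral_le_of_forall_start (R := R)
    (F := fun t => ENNReal.ofReal t ^ 2 * ∫⁻ y in Metric.ball x₀ R, fracSq (potGrad T f) y t)
    (A := fun a => 2 * (c₁ * V * Ψ a)) (H := fun p => 2 * (ENNReal.ofReal p.2 ^ 2 * Θ p))
    ((hΨm.const_mul _).const_mul _) (Measurable.const_mul (Measurable.mul (by fun_prop) hΘm) _) hpt
  have hV0 : V ≠ 0 := (Metric.measure_ball_pos volume _ hR).ne'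
  have hVt : V ≠ ⊤ := measure_ball_lt_top.ne
  set Γ : ℝ → ℝ≥0∞ := fun a => ∫⁻ w : Rn n × ℝ, epker R (x₀ - w.1) *
      ‖timeCut (Ico a (min (4 * a) R)) v w‖ₑ with hΓ
  set c₂ := ENNReal.ofReal (768 * ballConst n * K) with hc₂
  set c₃ := ENNReal.ofReal (4608 * holderConst n * farConst n ^ 2 * K ^ 2 / R) with hc₃
  have hlate : ∀ a ∈ Ioo 0 R, ENNReal.ofReal (2 / a) *
      (∫⁻ t in Ioo 0 (min (4 * a) R), 2 * (ENNReal.ofReal t ^ 2 * Θ (a, t))) ≤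
        (c₂ * Γ a + c₃) * V := by
    intro a ha
    have ha0 := ha.1
    calc _ ≤ ENNReal.ofReal (2 / a) *
          ∫⁻ t in Ioo 0 (min (4 * a) R), ENNReal.ofReal (32 * a ^ 2) * Θ (a, t) := by
          refine mul_le_mul_right ?_ _
          refine setLIntegral_mono' measurableSet_Ioo fun t ht => ?_
          rw [← mul_assoc]
          gcongr
          rw [← ENNReal.ofReal_pow ht.1.le, ← ENNReal.ofReal_ofNat,
            ← ENNReal.ofReal_mul (by norm_num)]
          refine ENNReal.ofReal_le_ofReal ?_
          have h1 : t ≤ 4 * a := ht.2.le.trans (min_le_left _ _)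
          have h2 := ht.1
          nlinarith
      _ = ENNReal.ofReal (64 * a) * ∫⁻ t in Ioo 0 (min (4 * a) R), Θ (a, t) := by
          rw [lintegral_const_mul' _ _ ENNReal.ofReal_ne_top, ← mul_assoc,
            ← ENNReal.ofReal_mul (by positivity)]
          congr 2
          field_simp
          norm_num
      _ ≤ ENNReal.ofReal (64 * a) * ((ENNReal.ofReal (12 * ballConst n * K / a) * Γ a +
            ENNReal.ofReal (72 * holderConst n * farConst n ^ 2 * K ^ 2 / (a * R))) * V) := by
          exact mul_le_mul_right (hS.setLIntegral_odSq_late_le hn ha0 ha.2 x₀) _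
      _ = _ := by
          have h1 : 64 * a * (12 * ballConst n * K / a) = 768 * ballConst n * K := by
            field_simp
            norm_num
          have h2 : 64 * a * (72 * holderConst n * farConst n ^ 2 * K ^ 2 / (a * R)) =
              4608 * holderConst n * farConst n ^ 2 * K ^ 2 / R := by
            field_simp
            ring
          rw [← mul_assoc, mul_add, ← mul_assoc, ← ENNReal.ofReal_mul (by positivity),
            ← ENNReal.ofReal_mul (by positivity), h1, h2]
  have hΨint : ∫⁻ a in Ioo 0 R, Ψ a ≤
      ENNReal.ofReal (3 ^ (((n : ℝ) + 1) / 2) * (carlConst n * K ^ 2)) := by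
    calc ∫⁻ a in Ioo 0 R, Ψ a
        = ∫⁻ z, ∫⁻ a in Ioo 0 R, epker R (x₀ - z) * fracSq (fun z => dPot f z.1 z.2) z a :=
          lintegral_lintegral_swap (hΨm2.comp measurable_swap).aemeasurable
      _ = ∫⁻ z, epker R (x₀ - z) * ∫⁻ a in Ioo 0 R, fracSq (fun z => dPot f z.1 z.2) z a :=
          lintegral_congr fun z => lintegral_const_mul' _ _ (epker_lt_top _ _).ne
      _ ≤ ENNReal.ofReal (3 ^ (((n : ℝ) + 1) / 2)) * ENNReal.ofReal (carlConst n * K ^ 2) :=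
          lintegral_epker_mul_le_of_boxMean_le hu hR
            (ae_of_all _ fun z => hS.boxMean_fracSq_dPot_le hn z hR hRT) x₀
      _ = _ := (ENNReal.ofReal_mul (by positivity)).symm
  rw [boxMean_eq hmeas, lintegral_lintegral_swap hmeas.aemeasurable, ← div_eq_mul_inv]
  refine ENNReal.div_le_of_le_mul ?_
  calc ∫⁻ s in Ioo 0 R, ∫⁻ y in Metric.ball x₀ R, ENNReal.ofReal s ^ 2 * fracSq (potGrad T f) y s
      = ∫⁻ s in Ioo 0 R, ENNReal.ofReal s ^ 2 * ∫⁻ y in Metric.ball x₀ R, fracSq (potGrad T f) y s :=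
        lintegral_congr fun s => lintegral_const_mul' _ _ (by finiteness)
    _ ≤ _ := havg
    _ ≤ ∫⁻ a in Ioo 0 R, (4 * (2 * (c₁ * V * Ψ a)) + (c₂ * Γ a + c₃) * V) := by
        refine setLIntegral_mono' measurableSet_Ioo fun a ha => ?_
        exact add_le_add le_rfl (hlate a ha)
    _ = 8 * c₁ * V * (∫⁻ a in Ioo 0 R, Ψ a) +
          ((c₂ * ∫⁻ a in Ioo 0 R, Γ a) + c₃ * ENNReal.ofReal R) * V := by
        have h1 : Measurable fun a => 4 * (2 * (c₁ * V * Ψ a)) :=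
          ((hΨm.const_mul _).const_mul _).const_mul _
        rw [lintegral_add_left h1, lintegral_mul_const' _ _ hVt, lintegral_add_right _ measurable_const,
          lintegral_const_mul' _ _ ENNReal.ofReal_ne_top, setLIntegral_const, Real.volume_Ioo, sub_zero]
        congr 1
        rw [lintegral_const_mul' _ _ (by norm_num), lintegral_const_mul' _ _ (by norm_num),
          lintegral_const_mul' _ _ (ENNReal.mul_ne_top ENNReal.ofReal_ne_top hVt)]
        ring
    _ ≤ 8 * c₁ * V * ENNReal.ofReal (3 ^ (((n : ℝ) + 1) / 2) * (carlConst n * K ^ 2)) +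
          (c₂ * ENNReal.ofReal K + c₃ * ENNReal.ofReal R) * V := by
        gcongr
        exact hS.lintegral_epker_mul_cut_le hR hRT x₀
    _ = (ENNReal.ofReal (gradCarlConst n * K ^ 2)) * V := by
        rw [hc₁, hc₂, hc₃, ← ENNReal.ofReal_mul (by positivity), ← ENNReal.ofReal_mul (by positivity),
          ← ENNReal.ofReal_add (by positivity) (by positivity),
          ← ENNReal.ofReal_ofNat 8, mul_right_comm, ← ENNReal.ofReal_mul (by positivity),
          ← ENNReal.ofReal_mul (by positivity), ← add_mul,
          ← ENNReal.ofReal_add (by positivity) (by positivity)]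
        congr 2
        rw [gradCarlConst]
        field_simp
        ring

end GradCarleson

/-! ### From the function spaces to sources -/

section Reduction
variable {m : ℕ} {T : ℝ≥0∞}

lemma ae_slice_of_ae_slab {P : Rn n × ℝ → Prop}
    (h : ∀ᵐ w ∂(volume.restrict (slab n T)), P w) :
    ∀ᵐ s : ℝ, ∀ᵐ y : Rn n, (y, s) ∈ slab n T → P (y, s) := by
  have h1 : ∀ᵐ w : Rn n × ℝ, w ∈ slab n T → P w :=
    (ae_restrict_iff' (isOpen_slab n T).measurableSet).1 h
  have h2 : ∀ᵐ p ∂((volume : Measure ℝ).prod (volume : Measure (Rn n))),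
      p.swap ∈ slab n T → P p.swap :=
    (Measure.measurePreserving_swap).quasiMeasurePreserving.ae h1
  exact Measure.ae_ae_of_ae_prod h2

lemma mem_slab_of_mem_Ioo {t s : ℝ} (ht : ENNReal.ofReal t < T) (hs : s ∈ Ioo 0 t) (y : Rn n) :
    (y, s) ∈ slab n T := ⟨hs.1, (ENNReal.ofReal_le_ofReal hs.2.le).trans_lt ht⟩

lemma boxMean_congr_ae {φ ψ : Rn n × ℝ → ℝ≥0∞}
    (h : ∀ᵐ w ∂(volume.restrict (slab n T)), φ w = ψ w) (x : Rn n) {t : ℝ}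
    (ht : ENNReal.ofReal t < T) :
    boxMean (fun y s => φ (y, s)) x t = boxMean (fun y s => ψ (y, s)) x t := by
  unfold boxMean
  refine lintegral_congr_ae ?_
  filter_upwards [ae_restrict_of_ae (ae_slice_of_ae_slab h),
    ae_restrict_mem (measurableSet_Ioo (a := (0 : ℝ)) (b := t))] with s hs hst
  refine laverage_congr (ae_restrict_of_ae ?_)
  filter_upwards [hs] with y hy
  exact hy (mem_slab_of_mem_Ioo ht hst y)

lemma boxMean_congr {φ ψ : Rn n → ℝ → ℝ≥0∞} {t : ℝ} (h : ∀ y, ∀ s ∈ Ioo 0 t, φ y s = ψ y s)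
    (x : Rn n) : boxMean φ x t = boxMean ψ x t := by
  unfold boxMean
  refine setLIntegral_congr_fun measurableSet_Ioo fun s hs => ?_
  simp only [h _ s hs]

/-- The constant lost in passing from averages over boxes to averages against Poisson kernels. -/
def avgConst (n : ℕ) : ℝ := 2 * 3 ^ (((n : ℝ) + 1) / 2) + 1

lemma one_le_avgConst (n : ℕ) : 1 ≤ avgConst n := by
  have : (0 : ℝ) < 3 ^ (((n : ℝ) + 1) / 2) := by positivity
  unfold avgConst
  linarith

/-- A Carleson bound that holds for almost all boxes gives a bound for all averages against Poisson
kernels: almost every scale `R ∈ (t/2, t)` is good, and the times in `(R, t)` are covered by the size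
bound. -/
lemma lintegral_epker_mul_le_of_ae_boxMean_le {φ : Rn n × ℝ → ℝ≥0∞} (hφ : Measurable φ) {K : ℝ}
    (hK : 0 < K) (hsize : ∀ w : Rn n × ℝ, 0 < w.2 → φ w ≤ ENNReal.ofReal (K / w.2))
    (hbox : ∀ᵐ z ∂(volume.restrict (slab n T)),
      boxMean (fun y s => φ (y, s)) z.1 z.2 ≤ ENNReal.ofReal K)
    (x : Rn n) {t : ℝ} (ht0 : 0 < t) (ht : ENNReal.ofReal t < T) :
    ∫⁻ y, epker t (x - y) * ∫⁻ s in Ioo 0 t, φ (y, s) ≤ ENNReal.ofReal (avgConst n * K) := by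
  obtain ⟨R, hRm, hR⟩ : ∃ R ∈ Ioo (t / 2) t,
      ∀ᵐ y : Rn n, boxMean (fun y s => φ (y, s)) y R ≤ ENNReal.ofReal K := by
    have h1 : ∀ᵐ R : ℝ ∂(volume.restrict (Ioo (t / 2) t)), R ∈ Ioo (t / 2) t ∧
        ∀ᵐ y : Rn n, boxMean (fun y s => φ (y, s)) y R ≤ ENNReal.ofReal K := by
      filter_upwards [ae_restrict_of_ae (ae_slice_of_ae_slab hbox),
        ae_restrict_mem measurableSet_Ioo] with R hR hRm
      refine ⟨hRm, ?_⟩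
      filter_upwards [hR] with y hy
      exact hy (mem_slab_of_mem_Ioo ht ⟨(half_pos ht0).trans hRm.1, hRm.2⟩ y)
    have : Filter.NeBot (ae (volume.restrict (Ioo (t / 2) t))) := by
      rw [ae_restrict_neBot, Real.volume_Ioo]
      simp [ht0]
    exact h1.exists
  have hR0 : 0 < R := (half_pos ht0).trans hRm.1
  have htR : t ≤ 2 * R := by have := hRm.1; linarith
  have hk : ∀ z : Rn n, epker t z ≤ 2 * epker R z := by
    intro z
    unfold epker
    rw [← ENNReal.ofReal_ofNat, ← ENNReal.ofReal_mul (by norm_num)]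
    refine ENNReal.ofReal_le_ofReal ((pker_le_of_sq_le ht0 hR0 (L := 1) zero_le_one
      (y := z) ?_).trans ?_)
    · have := hRm.2
      nlinarith
    · rw [Real.one_rpow, mul_one]
      have h1 : t / R ≤ 2 := by rwa [div_le_iff₀ hR0]
      exact mul_le_mul_of_nonneg_right h1 (pker_nonneg _ _)
  have hlate : ∀ y : Rn n, ∫⁻ s in Ico R t, φ (y, s) ≤ ENNReal.ofReal K := by
    intro y
    calc ∫⁻ s in Ico R t, φ (y, s) ≤ ∫⁻ _ in Ico R t, ENNReal.ofReal (K / R) := by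
          refine setLIntegral_mono measurable_const fun s hs => ?_
          have hs0 : 0 < s := hR0.trans_le hs.1
          refine (hsize (y, s) hs0).trans (ENNReal.ofReal_le_ofReal ?_)
          have := hs.1
          gcongr
      _ = ENNReal.ofReal (K / R * (t - R)) := by
          rw [setLIntegral_const, Real.volume_Ico, ← ENNReal.ofReal_mul (by positivity)]
      _ ≤ _ := by
          refine ENNReal.ofReal_le_ofReal ?_
          calc K / R * (t - R) ≤ K / R * R := by
                gcongr
                linarith
            _ = K := by field_simp
  have hin : ∀ y : Rn n, ∫⁻ s in Ioo 0 t, φ (y, s) ≤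
      (∫⁻ s in Ioo 0 R, φ (y, s)) + ENNReal.ofReal K := by
    intro y
    rw [← Ioo_union_Ico_eq_Ioo hR0 hRm.2.le]
    exact (lintegral_union_le _ _ _).trans (by gcongr; exact hlate y)
  have hm : Measurable fun y : Rn n => epker R (x - y) * ∫⁻ s in Ioo 0 R, φ (y, s) :=
    Measurable.mul (by fun_prop) (Measurable.lintegral_prod_right' hφ)
  calc ∫⁻ y, epker t (x - y) * ∫⁻ s in Ioo 0 t, φ (y, s)
      ≤ ∫⁻ y, (2 * (epker R (x - y) * ∫⁻ s in Ioo 0 R, φ (y, s)) +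
          epker t (x - y) * ENNReal.ofReal K) := by
        refine lintegral_mono fun y => ?_
        calc _ ≤ epker t (x - y) * ((∫⁻ s in Ioo 0 R, φ (y, s)) + ENNReal.ofReal K) := by
              gcongr
              exact hin y
          _ = epker t (x - y) * (∫⁻ s in Ioo 0 R, φ (y, s)) +
                epker t (x - y) * ENNReal.ofReal K := mul_add _ _ _
          _ ≤ _ := by
              rw [← mul_assoc]
              gcongr
              exact hk _
    _ = 2 * (∫⁻ y, epker R (x - y) * ∫⁻ s in Ioo 0 R, φ (y, s)) + ENNReal.ofReal K := by
        rw [lintegral_add_left (hm.const_mul 2), lintegral_const_mul _ hm,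
          lintegral_mul_const _ (by fun_prop), lintegral_epker_sub ht0, one_mul]
    _ ≤ 2 * (ENNReal.ofReal (3 ^ (((n : ℝ) + 1) / 2)) * ENNReal.ofReal K) + ENNReal.ofReal K := by
        gcongr
        exact lintegral_epker_mul_le_of_boxMean_le (g := fun y s => φ (y, s)) hφ hR0 hR x
    _ = _ := by
        rw [← ENNReal.ofReal_mul (by positivity), ← ENNReal.ofReal_ofNat,
          ← ENNReal.ofReal_mul (by norm_num), ← ENNReal.ofReal_add (by positivity) hK.le, avgConst]
        congr 1
        ring

lemma ae_le_of_slabSup_le {g : Rn n → ℝ → ℝ≥0∞} {K : ℝ≥0∞} (h : slabSup T g ≤ K) :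
    ∀ᵐ z ∂(volume.restrict (slab n T)), g z.1 z.2 ≤ K := by
  filter_upwards [ENNReal.ae_le_essSup (μ := volume.restrict (slab n T))
    fun z : Rn n × ℝ => g z.1 z.2] with z hz
  exact hz.trans h

section Trunc
variable {E : Type*} [NormedAddCommGroup E]

/-- A representative with everywhere valid size bounds, extended by `0` off `ℝⁿ × (0,T)`. -/
lemma exists_stronglyMeasurable_of_size {g : Rn n × ℝ → E} {k : ℕ} {K : ℝ} (hK : 0 < K)
    (hg : AEStronglyMeasurable g (volume.restrict (slab n T)))
    (hsize : ∀ᵐ z ∂(volume.restrict (slab n T)),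
      ENNReal.ofReal z.2 ^ k * ‖g z‖ₑ ≤ ENNReal.ofReal K) :
    ∃ g' : Rn n × ℝ → E, StronglyMeasurable g' ∧ (∀ w ∉ slab n T, g' w = 0) ∧
      (∀ w ∈ slab n T, ‖g' w‖ ≤ K / w.2 ^ k) ∧ ∀ᵐ z ∂(volume.restrict (slab n T)), g z = g' z := by
  set g₀ := hg.mk g with hg₀
  have hg₀m : StronglyMeasurable g₀ := hg.stronglyMeasurable_mk
  set S : Set (Rn n × ℝ) := slab n T ∩ {z | ENNReal.ofReal z.2 ^ k * ‖g₀ z‖ₑ ≤ ENNReal.ofReal K}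
  have hSm : MeasurableSet S := by
    refine (isOpen_slab n T).measurableSet.inter (measurableSet_le ?_ measurable_const)
    exact Measurable.mul (by fun_prop) hg₀m.enorm
  refine ⟨S.indicator g₀, hg₀m.indicator hSm, fun w hw => indicator_of_notMem (fun h => hw h.1) _,
    fun w hw => ?_, ?_⟩
  · have hw0 : 0 < w.2 := hw.1
    by_cases h : w ∈ S
    · rw [indicator_of_mem h, le_div_iff₀ (by positivity), mul_comm]
      have h1 := h.2
      rw [mem_ofPred_eq, ← ofReal_norm, ← ENNReal.ofReal_pow hw0.le,
        ← ENNReal.ofReal_mul (by positivity)] at h1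
      exact (ENNReal.ofReal_le_ofReal_iff hK.le).1 h1
    · rw [indicator_of_notMem h, norm_zero]
      positivity
  · filter_upwards [hg.ae_eq_mk, hsize, ae_restrict_mem (isOpen_slab n T).measurableSet]
      with z hz hsz hzs
    have : z ∈ S := ⟨hzs, by rw [mem_ofPred_eq, hg₀, ← hz]; exact hsz⟩
    rw [indicator_of_mem this, hz]

end Trunc

/-- An element of `Y_T` of norm less than `K` is, up to a null set, a source of size `C K`. -/
lemma exists_isSource {f : Rn n × ℝ → Rn m} (hf : AEStronglyMeasurable f (volume.restrict (slab n T)))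
    {K : ℝ} (hfK : normY T f < ENNReal.ofReal K) :
    ∃ f' v', IsSource T (avgConst n * K) f' v' ∧
      ∀ᵐ z ∂(volume.restrict (slab n T)), f z = f' z := by
  have hK : 0 < K := by
    by_contra h
    rw [ENNReal.ofReal_of_nonpos (not_lt.1 h)] at hfK
    exact not_lt_bot hfK
  have hKC : K ≤ avgConst n * K := le_mul_of_one_le_left hK.le (one_le_avgConst n)
  obtain ⟨v, hv, hvK⟩ : ∃ v, IsWeakGrad T f v ∧ baseNormY T f + gradPartY T v < ENNReal.ofReal K := by
    have h1 : seminormY T f < ENNReal.ofReal K - baseNormY T f := by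
      rw [normY] at hfK
      exact lt_tsub_iff_left.2 hfK
    unfold seminormY at h1
    obtain ⟨v, hv⟩ := iInf_lt_iff.1 h1
    obtain ⟨hw, hlt⟩ := iInf_lt_iff.1 hv
    exact ⟨v, hw, lt_tsub_iff_left.1 hlt⟩
  have hb : baseNormY T f ≤ ENNReal.ofReal K := le_self_add.trans hvK.le
  have hg : gradPartY T v ≤ ENNReal.ofReal K := le_add_self.trans hvK.le
  have hb1 := ae_le_of_slabSup_le (le_self_add.trans hb)
  have hb2 := ae_le_of_slabSup_le (le_add_self.trans hb)
  have hg1 := ae_le_of_slabSup_le (le_self_add.trans hg)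
  have hg2 := ae_le_of_slabSup_le (le_add_self.trans hg)
  obtain ⟨f', hf'm, hf'0, hf's, hff'⟩ := exists_stronglyMeasurable_of_size (k := 1) hK hf
    (by simpa only [pow_one] using hb1)
  obtain ⟨v', hv'm, hv'0, hv's, hvv'⟩ := exists_stronglyMeasurable_of_size (k := 2) hK
    hv.2.1.aestronglyMeasurable hg1
  simp only [pow_one] at hf's
  have hslab : MeasurableSet (slab n T) := (isOpen_slab n T).measurableSet
  refine ⟨f', v', ⟨hK.trans_le hKC, hf'm, hv'm, hf'0, hv'0, fun w hw => ?_, fun w hw => ?_,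
    fun x t ht0 ht => ?_, fun x t ht0 ht => ?_, ?_, ?_, ?_⟩, hff'⟩
  · have := hw.1
    exact (hf's w hw).trans (by gcongr)
  · have := hw.1
    exact (hv's w hw).trans (by gcongr)
  · refine lintegral_epker_mul_le_of_ae_boxMean_le (φ := fun w => ‖f' w‖ₑ) hf'm.enorm hK
      (fun w hw => ?_) ?_ x ht0 ht
    · by_cases hws : w ∈ slab n T
      · rw [← ofReal_norm]
        exact ENNReal.ofReal_le_ofReal (hf's w hws)
      · rw [hf'0 w hws, enorm_zero]
        exact bot_le
    · filter_upwards [hb2, ae_restrict_mem hslab] with z hz hzs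
      exact (boxMean_congr_ae (φ := fun w => ‖f w‖ₑ) (ψ := fun w => ‖f' w‖ₑ)
        (hff'.mono fun w hw => by rw [hw]) z.1 hzs.2).symm.trans_le hz
  · refine lintegral_epker_mul_le_of_ae_boxMean_le (φ := fun w => ENNReal.ofReal w.2 * ‖v' w‖ₑ)
      (Measurable.mul (by fun_prop) hv'm.enorm) hK (fun w hw => ?_) ?_ x ht0 ht
    · by_cases hws : w ∈ slab n T
      · rw [← ofReal_norm, ← ENNReal.ofReal_mul hw.le]
        refine ENNReal.ofReal_le_ofReal ?_
        calc w.2 * ‖v' w‖ ≤ w.2 * (K / w.2 ^ 2) := by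
              gcongr
              exact hv's w hws
          _ = K / w.2 := by field_simp
      · rw [hv'0 w hws, enorm_zero, mul_zero]
        exact bot_le
    · filter_upwards [hg2, ae_restrict_mem hslab] with z hz hzs
      exact (boxMean_congr_ae (φ := fun w => ENNReal.ofReal w.2 * ‖v w‖ₑ)
        (ψ := fun w => ENNReal.ofReal w.2 * ‖v' w‖ₑ)
        (hvv'.mono fun w hw => by rw [hw]) z.1 hzs.2).symm.trans_le hz
  · exact locallyIntegrableOn_slab hf'm.aestronglyMeasurable fun c hc =>
      ⟨K / c, fun w hw hcw => (hf's w hw).trans (by gcongr)⟩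
  · exact locallyIntegrableOn_slab hv'm.aestronglyMeasurable fun c hc =>
      ⟨K / c ^ 2, fun w hw hcw => (hv's w hw).trans (by gcongr)⟩
  · intro φ hφ hc hs j
    have h1 := hv.2.2 φ hφ hc hs j
    have h2 : ∫ z in slab n T, (fderiv ℝ φ z (EuclideanSpace.single j 1, 0)) • f z =
        ∫ z in slab n T, (fderiv ℝ φ z (EuclideanSpace.single j 1, 0)) • f' z :=
      integral_congr_ae (hff'.mono fun w hw => by simp only [hw])
    have h3 : ∫ z in slab n T, φ z • v z j = ∫ z in slab n T, φ z • v' z j :=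
      integral_congr_ae (hvv'.mono fun w hw => by simp only [hw])
    rwa [h2, h3] at h1

end Reduction

/-! ### The Duhamel term -/

section Duhamel
variable {m : ℕ} {T : ℝ≥0∞} {K : ℝ} {f f' : Rn n × ℝ → Rn m} {v : Rn n × ℝ → GradVal n m}

lemma IsSource.integrable_pker_smul (hS : IsSource T K f' v) (x : Rn n) {t : ℝ}
    (ht : ENNReal.ofReal t < T) :
    Integrable fun w : Rn n × ℝ => pker (t - w.2) (x - w.1) • f' w :=
  integrable_dPot hS.sm ((hS.eDPot_le x ht).trans_lt ENNReal.ofReal_lt_top)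

lemma IsSource.integrableOn_poissonKernelAt_smul (hS : IsSource T K f' v)
    (hff' : ∀ᵐ z ∂(volume.restrict (slab n T)), f z = f' z) (x : Rn n) {t : ℝ}
    (ht : ENNReal.ofReal t < T) :
    IntegrableOn (fun w : Rn n × ℝ => poissonKernelAt (t - w.2) (x - w.1) • f w)
      {w | 0 < w.2 ∧ w.2 < t} := by
  have hmeas : MeasurableSet {w : Rn n × ℝ | 0 < w.2 ∧ w.2 < t} :=
    measurable_snd measurableSet_Ioo
  have hsub : {w : Rn n × ℝ | 0 < w.2 ∧ w.2 < t} ⊆ slab n T :=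
    fun w hw => mem_slab_of_mem_Ioo ht hw w.1
  refine (hS.integrable_pker_smul x ht).integrableOn.congr ?_
  filter_upwards [ae_restrict_of_ae_restrict_of_subset hsub hff', ae_restrict_mem hmeas] with w hw hwm
  rw [hw, poissonKernelAt_eq_pker (sub_pos.2 hwm.2)]

/-- The Duhamel term is the potential of the source. -/
lemma IsSource.duhamel_eq (hS : IsSource T K f' v)
    (hff' : ∀ᵐ z ∂(volume.restrict (slab n T)), f z = f' z) {z : Rn n × ℝ} (hz : z ∈ slab n T) :
    duhamel f z = dPot f' z.1 z.2 := by
  obtain ⟨x, t⟩ := z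
  have ht0 : 0 < t := hz.1
  have hint := hS.integrable_pker_smul x hz.2
  unfold duhamel dPot
  have h0 : ∀ s ∉ Ioo 0 t, ∫ y : Rn n, pker (t - s) (x - y) • f' (y, s) = 0 := by
    intro s hs
    have h1 : ∀ y : Rn n, pker (t - s) (x - y) • f' (y, s) = 0 := by
      intro y
      rcases le_or_gt s 0 with h | h
      · rw [hS.eq_zero h, smul_zero]
      · rw [pker_of_nonpos (sub_nonpos.2 (not_lt.1 fun h' => hs ⟨h, h'⟩)), zero_smul]
    simp [h1]
  rw [Measure.volume_eq_prod, integral_prod_symm _ hint, intervalIntegral.integral_of_le ht0.le,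
    integral_Ioc_eq_integral_Ioo, ← setIntegral_eq_integral_of_forall_compl_eq_zero h0]
  refine integral_congr_ae ?_
  filter_upwards [ae_restrict_of_ae (ae_slice_of_ae_slab hff'),
    ae_restrict_mem (measurableSet_Ioo (a := (0 : ℝ)) (b := t))] with s hs hst
  unfold poissonSemigroup
  refine integral_congr_ae ?_
  filter_upwards [hs] with y hy
  rw [hy (mem_slab_of_mem_Ioo hz.2 hst y), poissonKernelAt_eq_pker (sub_pos.2 hst.2)]

lemma fracSq_congr {E : Type*} [NormedAddCommGroup E] [NormedSpace ℝ E] {u U : Rn n × ℝ → E}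
    (h : ∀ z ∈ slab n T, u z = U z) {t : ℝ} (ht0 : 0 < t) (ht : ENNReal.ofReal t < T) (x : Rn n) :
    fracSq u x t = fracSq U x t := by
  have h1 : (fun y => u (y, t)) = fun y => U (y, t) := by
    ext1 y
    exact h (y, t) ⟨ht0, ht⟩
  unfold fracSq
  rw [h1]

lemma IsWeakGrad.congr {u U : Rn n × ℝ → Rn m} {w : Rn n × ℝ → GradVal n m}
    (hU : IsWeakGrad T U w) (h : ∀ z ∈ slab n T, u z = U z) : IsWeakGrad T u w := by
  have hslab : MeasurableSet (slab n T) := (isOpen_slab n T).measurableSet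
  refine ⟨fun z hz => ?_, hU.2.1, fun φ hφ hc hs j => ?_⟩
  · obtain ⟨s, hs, hi⟩ := hU.1 z hz
    refine ⟨s ∩ slab n T, Filter.inter_mem hs self_mem_nhdsWithin, ?_⟩
    refine (hi.mono_set inter_subset_left).congr ?_
    refine ae_restrict_of_ae_restrict_of_subset inter_subset_right ?_
    exact (ae_restrict_iff' hslab).2 (ae_of_all _ fun z hz => (h z hz).symm)
  · rw [← hU.2.2 φ hφ hc hs j]
    refine setIntegral_congr_fun hslab fun z hz => ?_
    simp only [h z hz]

lemma slabSup_le {g : Rn n → ℝ → ℝ≥0∞} {C : ℝ≥0∞}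
    (h : ∀ x t, 0 < t → ENNReal.ofReal t < T → g x t ≤ C) : slabSup T g ≤ C := by
  refine essSup_le_of_ae_le C ?_
  filter_upwards [ae_restrict_mem (isOpen_slab n T).measurableSet] with z hz
  exact h z.1 z.2 hz.1 hz.2

/-- Quadratic bounds in the form in which they enter the norm of `X_T`. -/
lemma rpow_half_le {X : ℝ≥0∞} {A K : ℝ} (hK : 0 ≤ K)
    (h : X ≤ ENNReal.ofReal (A * K ^ 2)) : X ^ (1 / 2 : ℝ) ≤ ENNReal.ofReal (Real.sqrt A * K) := by
  refine (ENNReal.rpow_le_rpow h (by norm_num)).trans (le_of_eq ?_)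
  rw [mul_comm A, ENNReal.ofReal_mul (by positivity), ENNReal.mul_rpow_of_nonneg _ _ (by norm_num),
    mul_comm (Real.sqrt A), ENNReal.ofReal_mul hK]
  congr 1
  · rw [ENNReal.ofReal_rpow_of_nonneg (by positivity) (by norm_num), ← Real.sqrt_eq_rpow,
      Real.sqrt_sq hK]
  · rcases le_or_gt 0 A with hA | hA
    · rw [ENNReal.ofReal_rpow_of_nonneg hA (by norm_num), ← Real.sqrt_eq_rpow]
    · rw [ENNReal.ofReal_of_nonpos hA.le, Real.sqrt_eq_zero_of_nonpos hA.le]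
      simp

/-- The constant in the estimate of `|||G(f)|||` for sources `f`. -/
def sourceConst (n : ℕ) : ℝ :=
  potConst n + (2 * (Real.sqrt (holderConst n) * regConst n) + Real.sqrt (carlConst n) +
    Real.sqrt (gradCarlConst n))

lemma sourceConst_pos (n : ℕ) : 0 < sourceConst n := by
  have h1 := potConst_pos n
  have h2 := regConst_pos n
  unfold sourceConst
  positivity

/-- The `X_T` norm of the potential of a source: the five terms are bounded by
`IsSource.norm_dPot_le`, `IsSource.fracSq_dPot_le`, `IsSource.boxMean_fracSq_dPot_le`,
`IsSource.fracSq_potGrad_le` and `IsSource.boxMean_fracSq_potGrad_le`. -/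
lemma IsSource.normX_le (hn : 1 ≤ n) (hS : IsSource T K f' v) {u : Rn n × ℝ → Rn m}
    (hu : ∀ z ∈ slab n T, u z = dPot f' z.1 z.2) :
    normX T u ≤ ENNReal.ofReal (sourceConst n * K) := by
  have hK := hS.pos
  have hp := potConst_pos n
  have hr := regConst_pos n
  have hh := holderConst_nonneg n
  have hsub : ∀ {s t : ℝ}, ENNReal.ofReal t < T → s ∈ Ioo 0 t → ENNReal.ofReal s < T :=
    fun ht hs => (ENNReal.ofReal_le_ofReal hs.2.le).trans_lt ht
  have h1 : supNormX T u ≤ ENNReal.ofReal (potConst n * K) := slabSup_le fun x t ht0 ht => by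
    rw [hu (x, t) ⟨ht0, ht⟩, ← ofReal_norm]
    exact ENNReal.ofReal_le_ofReal (hS.norm_dPot_le x ht)
  have h2 : slabSup T (fun x t => ENNReal.ofReal t ^ (1 / 2 : ℝ) * fracSq u x t ^ (1 / 2 : ℝ)) ≤
      ENNReal.ofReal (Real.sqrt (holderConst n) * (regConst n * K)) := slabSup_le fun x t ht0 ht => by
    rw [← ENNReal.mul_rpow_of_nonneg _ _ (by norm_num), fracSq_congr hu ht0 ht]
    refine rpow_half_le (by positivity) ?_
    calc _ ≤ ENNReal.ofReal t * ENNReal.ofReal (holderConst n * ((regConst n * K) ^ 2 / t)) := by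
          gcongr
          exact hS.fracSq_dPot_le hn ht0 ht x
      _ = _ := by
          rw [← ENNReal.ofReal_mul ht0.le]
          congr 1
          field_simp
  have h3 : slabSup T (fun x t => boxMean (fun y s => fracSq u y s) x t ^ (1 / 2 : ℝ)) ≤
      ENNReal.ofReal (Real.sqrt (carlConst n) * K) := slabSup_le fun x t ht0 ht => by
    refine rpow_half_le hK.le ?_
    rw [boxMean_congr (fun y s hs => fracSq_congr hu hs.1 (hsub ht hs) y) x]
    exact hS.boxMean_fracSq_dPot_le hn x ht0 ht
  have h4 : slabSup T (fun x t => ENNReal.ofReal t ^ (3 / 2 : ℝ) *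
      fracSq (potGrad T f') x t ^ (1 / 2 : ℝ)) ≤
      ENNReal.ofReal (Real.sqrt (holderConst n) * (regConst n * K)) := slabSup_le fun x t ht0 ht => by
    have h5 : ENNReal.ofReal t ^ (3 / 2 : ℝ) = (ENNReal.ofReal t ^ 3) ^ (1 / 2 : ℝ) := by
      rw [← ENNReal.rpow_natCast, ← ENNReal.rpow_mul]
      norm_num
    rw [h5, ← ENNReal.mul_rpow_of_nonneg _ _ (by norm_num)]
    refine rpow_half_le (by positivity) ?_
    calc _ ≤ ENNReal.ofReal t ^ 3 *
          ENNReal.ofReal (holderConst n * ((regConst n * K / t) ^ 2 / t)) := by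
          gcongr
          exact hS.fracSq_potGrad_le hn ht0 ht x
      _ = _ := by
          rw [← ENNReal.ofReal_pow ht0.le, ← ENNReal.ofReal_mul (by positivity)]
          congr 1
          field_simp
  have h5 : slabSup T (fun x t =>
      boxMean (fun y s => ENNReal.ofReal s ^ 2 * fracSq (potGrad T f') y s) x t ^ (1 / 2 : ℝ)) ≤
      ENNReal.ofReal (Real.sqrt (gradCarlConst n) * K) := slabSup_le fun x t ht0 ht =>
    rpow_half_le hK.le (hS.boxMean_fracSq_potGrad_le hn x ht0 ht)
  have h6 : seminormX1 T u ≤ gradPartX T (potGrad T f') :=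
    iInf₂_le _ (hS.isWeakGrad_potGrad.congr hu)
  calc normX T u ≤ ENNReal.ofReal (potConst n * K) +
        ((ENNReal.ofReal (Real.sqrt (holderConst n) * (regConst n * K)) +
          ENNReal.ofReal (Real.sqrt (carlConst n) * K)) +
        (ENNReal.ofReal (Real.sqrt (holderConst n) * (regConst n * K)) +
          ENNReal.ofReal (Real.sqrt (gradCarlConst n) * K))) :=
        add_le_add h1 (add_le_add (add_le_add h2 h3) (h6.trans (add_le_add h4 h5)))
    _ = _ := by
        rw [← ENNReal.ofReal_add (by positivity) (by positivity),
          ← ENNReal.ofReal_add (by positivity) (by positivity),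
          ← ENNReal.ofReal_add (by positivity) (by positivity),
          ← ENNReal.ofReal_add (by positivity) (by positivity), sourceConst]
        congr 1
        ring

end Duhamel

end

theorem proposition4p3 (n : ℕ) (hn : 1 ≤ n) :
    ∃ c : ℝ≥0, 0 < c ∧
      ∀ (m : ℕ) (T : ℝ≥0∞) (f : Rn n × ℝ → Rn m), MemY T f →
        (∀ (x : Rn n) (t : ℝ), 0 < t → ENNReal.ofReal t < T →
          IntegrableOn (fun w : Rn n × ℝ => poissonKernelAt (t - w.2) (x - w.1) • f w)
            {w | 0 < w.2 ∧ w.2 < t}) ∧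
        MemX T (duhamel f) ∧
        normX T (duhamel f) ≤ (c : ℝ≥0∞) * normY T f := by
  have hC : 0 < sourceConst n * avgConst n :=
    mul_pos (sourceConst_pos n) (one_pos.trans_le (one_le_avgConst n))
  refine ⟨(sourceConst n * avgConst n).toNNReal, Real.toNNReal_pos.2 hC, fun m T f hf => ?_⟩
  -- sources have size `K > 0` while `‖f‖` may vanish, and the weak gradient in `normY` is an infimum;
  -- so `K = ‖f‖ + ε` is taken with `ε → 0`
  set N := (normY T f).toReal with hN
  have hNe : normY T f = ENNReal.ofReal N := (ENNReal.ofReal_toReal hf.2.ne).symm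
  have hsrc : ∀ ε : ℝ, 0 < ε → ∃ f' v', IsSource T (avgConst n * (N + ε)) f' v' ∧
      ∀ᵐ z ∂(volume.restrict (slab n T)), f z = f' z := fun ε hε => by
    refine exists_isSource hf.1 ?_
    rw [hNe]
    exact (ENNReal.ofReal_lt_ofReal_iff (by positivity)).2 (by linarith)
  have hle : normX T (duhamel f) ≤ ((sourceConst n * avgConst n).toNNReal : ℝ≥0∞) * normY T f := by
    refine ENNReal.le_of_forall_pos_le_add fun ε hε _ => ?_
    have hε' : 0 < (ε : ℝ) / (sourceConst n * avgConst n) := by positivity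
    obtain ⟨f', v', hS, hff'⟩ := hsrc _ hε'
    refine (hS.normX_le hn fun z hz => hS.duhamel_eq hff' hz).trans (le_of_eq ?_)
    have h1 : sourceConst n * (avgConst n * (N + ε / (sourceConst n * avgConst n))) =
        sourceConst n * avgConst n * N + ε := by
      rw [← mul_assoc, mul_add, mul_div_cancel₀ _ hC.ne']
    have hN0 : 0 ≤ N := ENNReal.toReal_nonneg
    have h2 : 0 ≤ sourceConst n * avgConst n * N := mul_nonneg hC.le hN0
    rw [h1, ENNReal.ofReal_add h2 ε.coe_nonneg, ENNReal.ofReal_mul hC.le, ← hNe,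
      ENNReal.ofReal_coe_nnreal]
    rfl
  obtain ⟨f', v', hS, hff'⟩ := hsrc 1 one_pos
  refine ⟨fun x t _ ht => hS.integrableOn_poissonKernelAt_smul hff' x ht, ⟨?_, ?_⟩, hle⟩
  · refine (stronglyMeasurable_dPot hS.sm).aestronglyMeasurable.congr ?_
    filter_upwards [ae_restrict_mem (isOpen_slab n T).measurableSet] with z hz
    exact (hS.duhamel_eq hff' hz).symm
  · exact hle.trans_lt (ENNReal.mul_lt_top ENNReal.coe_lt_top hf.2)
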